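/- Let $D$ be a (possibly unbounded) self-adjoint operator in a complex Hilbert space $\mathcal H$ such that $(D-i)^{-s}$ is trace class for some real $s\ge 0$, let $R$ be a bounded operator on $\mathcal H$, and let $f\in\mathcal E^s$. Here, with $u(x)=x-i$ and the Fourier transform normalized by $h(x)=\int_{\mathbb R}\widehat h(\xi)e^{i\xi x}\,d\xi$, $\mathcal E^s$ is the set of smooth $f:\mathbb R\to\mathbb C$ for which there is $C\ge 1$ such that $(fu^m)^{(n)}$ has an integrable Fourier transform with $$\big\|\widehat{(fu^m)^{(n)}}\big\|_1\le C^{n+1}\,n!$$ for all integers $n\ge 0$ and all $m\in\{0,1,2,\dots\}\cup\{s\}$ with $m\le s$ (that is, $m=0,\dots,s$ if $s$ is an integer). For real $t$ put $$f(D+tR)=\int_{\mathbb R}\widehat f(\xi)\,e^{i\xi(D+tR)}\,d\xi,\qquad e^{i\xi(D+tR)}=\sum_{n\ge 0}(it\xi)^n\int_{\Delta_n}e^{is_0\xi D}R\,e^{is_1\xi D}R\cdots R\,e^{is_n\xi D}\,d^ns,$$ where $\Delta_n=\{s\in\mathbb R_{\ge0}^{n+1}:\sum_k s_k=1\}$ has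 volume $1/n!$ and the integrals are taken on each vector of $\mathcal H$. Divided differences are defined by $g[x_0]=g(x_0)$ and $$g[x_0,\dots,x_n]=\frac{g[x_1,\dots,x_n]-g[x_0,\dots,x_{n-1}]}{x_n-x_0}$$ at pairwise distinct points, and by $g[x_0,\dots,x_n]=\int_{\Delta_n}g^{(n)}\big(\sum_k s_kx_k\big)\,d^ns$ otherwise. Then $\mathcal H$ has an orthonormal basis of eigenvectors of $D$, and there is $\delta>0$ such that for $|t|<\delta$ the expression $f(D+tR)$ converges to a trace class operator, the function $t\mapsto \operatorname{tr} f(D+tR)$ is smooth on $(-\delta,\delta)$, and for every orthonormal basis $(e_i)_{i\in I}$ of eigenvectors of $D$, with $De_i=\lambda_ie_i$ and $R_{ij}=\langle e_i,Re_j\rangle$, and every $n\ge 1$, $$\frac{d^n}{dt^n}\operatorname{tr} f(D+tR)\Big|_{t=0}=(n-1)!\sum_{i_1,\dots,i_n}R_{i_1i_2}R_{i_2i_3}\cdots R_{i_ni_1}\,f'[\lambda_{i_1},\dots,\lambda_{i_n}].$$ The sum is the limit, along the finite subsets $J\subset I$ directed by inclusion, of the finite sums over $i_1,\dots,i_n\in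 J$. -/

import Mathlib

open MeasureTheory Filter Topology
open scoped ContDiff

noncomputable section

namespace SpectralAction

variable {H : Type*} [NormedAddCommGroup H] [InnerProductSpace ℂ H] [CompleteSpace H]

/-- A bounded operator `T` is trace class (nuclear) if it is an absolutely convergent sum of
rank one operators: `T v = ∑ₖ ⟪xₖ, v⟫ yₖ` with `∑ₖ ‖xₖ‖ ‖yₖ‖ < ∞`. -/
def IsTraceClass (T : H →L[ℂ] H) : Prop :=
  ∃ x y : ℕ → H, (Summable fun k => ‖x k‖ * ‖y k‖) ∧
    ∀ v, HasSum (fun k => inner ℂ (x k) v • y k) (T v)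

/-- The trace `∑ᵢ ⟪eᵢ, T eᵢ⟫` over an orthonormal basis of `H`; for a trace class operator the
value does not depend on the basis. -/
def trace (T : H →L[ℂ] H) : ℂ :=
  ∑' i, inner ℂ ((exists_hilbertBasis ℂ H).choose_spec.choose i)
    (T ((exists_hilbertBasis ℂ H).choose_spec.choose i))

/-- The bounded operator `S` is the resolvent `(D - z)⁻¹` of the unbounded operator `D`. -/
def IsResolvent (D : H →ₗ.[ℂ] H) (z : ℂ) (S : H →L[ℂ] H) : Prop :=
  (∀ v : H, ∃ h : S v ∈ D.domain, D ⟨S v, h⟩ - z • S v = v) ∧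
    ∀ x : D.domain, S (D x - z • (x : H)) = x

/-- `D` is `s`-summable: `(D - i)⁻ˢ` is trace class. Here `(D - i)⁻ˢ` is the function `z ↦ zˢ`
(principal branch) of the bounded normal operator `(D - i)⁻¹`, whose spectrum lies in
`{0} ∪ {Im z > 0}`; for integral `s` it is the `s`-th power of `(D - i)⁻¹`. -/
def IsSummable (D : H →ₗ.[ℂ] H) (s : ℝ) : Prop :=
  ∃ S : H →L[ℂ] H, IsResolvent D Complex.I S ∧
    IsTraceClass (cfc (fun z : ℂ => z ^ (s : ℂ)) S)

/-- `φ` is the Fourier transform of `h`, and it is integrable; the normalization is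
`h x = ∫ φ ξ * exp (i ξ x) dξ`. -/
def HasIntegrableFourier (h : ℝ → ℂ) (φ : ℝ → ℂ) : Prop :=
  Integrable φ ∧ ∀ x : ℝ, h x = ∫ ξ : ℝ, φ ξ * Complex.exp (Complex.I * ξ * x)

/-- The integrable Fourier transform of `f` (unique almost everywhere, if there is one). -/
def fourierHat (f : ℝ → ℂ) : ℝ → ℂ :=
  Classical.epsilon fun φ => HasIntegrableFourier f φ

/-- The class `ℰˢ`: smooth `f` for which there is `C ≥ 1` such that the `n`-th derivative of
`f uᵐ`, `u x = x - i`, has a Fourier transform of `L¹`-norm at most `Cⁿ⁺¹ n!`, for all `n ≥ 0`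
and all `m ≤ s` in `{0, 1, 2, …} ∪ {s}`. (For integral `s` this is `m = 0, …, s`.) -/
def ClassE (s : ℝ) (f : ℝ → ℂ) : Prop :=
  ContDiff ℝ ∞ f ∧ ∃ C : ℝ, 1 ≤ C ∧
    ∀ m : ℝ, m ≤ s → (m = s ∨ ∃ k : ℕ, m = k) → ∀ n : ℕ,
      ∃ φ : ℝ → ℂ,
        HasIntegrableFourier
          (iteratedDeriv n fun x : ℝ => f x * ((x : ℂ) - Complex.I) ^ (m : ℂ)) φ ∧
        ∫ ξ, ‖φ ξ‖ ≤ C ^ (n + 1) * (n.factorial : ℝ)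

/-- `U` is the strongly continuous one-parameter unitary group with generator `i D`. When `D` is
self-adjoint there is exactly one such `U`, since a self-adjoint operator has no proper symmetric
extension. -/
structure IsUnitaryGroup (D : H →ₗ.[ℂ] H) (U : ℝ → H →L[ℂ] H) : Prop where
  zero : U 0 = 1
  add : ∀ a b, U (a + b) = U a * U b
  norm_map : ∀ a v, ‖U a v‖ = ‖v‖
  continuous : ∀ v, Continuous fun a => U a v
  generator : ∀ x : D.domain, HasDerivAt (fun a => U a (x : H)) (Complex.I • D x) 0

/-- The unitary group `a ↦ exp (i a D)`. -/
def unitaryGroup (D : H →ₗ.[ℂ] H) : ℝ → H →L[ℂ] H :=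
  Classical.epsilon fun U => IsUnitaryGroup D U

/-- The integral over the simplex `{s₀, …, sₙ ≥ 0, s₀ + ⋯ + sₙ = 1}`, with respect to Lebesgue
measure in the coordinates `s₁, …, sₙ`; the volume of the simplex is `1 / n!`. -/
def simplexIntegral {E : Type*} [NormedAddCommGroup E] [NormedSpace ℝ E] (n : ℕ)
    (F : (Fin (n + 1) → ℝ) → E) : E :=
  ∫ s : Fin n → ℝ in {s | (∀ i, 0 ≤ s i) ∧ ∑ i, s i ≤ 1}, F (Fin.cons (1 - ∑ i, s i) s)

/-- The product `U(a₀) R U(a₁) R ⋯ R U(aₙ)`. -/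
def alternatingProduct (U : ℝ → H →L[ℂ] H) (R : H →L[ℂ] H) :
    (n : ℕ) → (Fin (n + 1) → ℝ) → H →L[ℂ] H
  | 0, a => U (a 0)
  | n + 1, a => U (a 0) * R * alternatingProduct U R n (Fin.tail a)

/-- The `n`-th term of the expansional of `exp (i ξ (D + t R))`, applied to the vector `v`:
`(i t ξ)ⁿ ∫ exp(i s₀ ξ D) R exp(i s₁ ξ D) ⋯ R exp(i sₙ ξ D) v` over the `n`-simplex. -/
def expansionalTerm (D : H →ₗ.[ℂ] H) (R : H →L[ℂ] H) (t ξ : ℝ) (v : H) (n : ℕ) : H :=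
  (Complex.I * t * ξ) ^ n •
    simplexIntegral n fun s => alternatingProduct (unitaryGroup D) R n (ξ • s) v

/-- `exp (i ξ (D + t R)) v`, as the sum of the expansional. -/
def expansional (D : H →ₗ.[ℂ] H) (R : H →L[ℂ] H) (t ξ : ℝ) (v : H) : H :=
  ∑' n, expansionalTerm D R t ξ v n

/-- The bounded operator `T` is `f(D + t R) = ∫ f̂(ξ) exp (i ξ (D + t R)) dξ`, the integral and the
expansional being convergent on every vector. -/
def IsPerturbedFunction (D : H →ₗ.[ℂ] H) (R : H →L[ℂ] H) (f : ℝ → ℂ) (t : ℝ)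
    (T : H →L[ℂ] H) : Prop :=
  ∀ v : H, (∀ ξ, Summable (expansionalTerm D R t ξ v)) ∧
    Integrable (fun ξ => fourierHat f ξ • expansional D R t ξ v) ∧
    T v = ∫ ξ, fourierHat f ξ • expansional D R t ξ v

/-- `e` is an orthonormal basis of eigenvectors of `D`, with eigenvalues `l`. -/
def IsEigenbasis {ι : Type*} (D : H →ₗ.[ℂ] H) (e : HilbertBasis ι ℂ H) (l : ι → ℝ) : Prop :=
  ∀ j, ∃ h : e j ∈ D.domain, D ⟨e j, h⟩ = (l j : ℂ) • e j

/-- The recursion for divided differences at distinct points. -/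
def dividedDiffRec (f : ℝ → ℂ) : (n : ℕ) → (Fin (n + 1) → ℝ) → ℂ
  | 0, x => f (x 0)
  | n + 1, x =>
    (dividedDiffRec f n (Fin.tail x) - dividedDiffRec f n (Fin.init x)) /
      ((x (Fin.last (n + 1)) - x 0 : ℝ) : ℂ)

open Classical in
/-- The divided difference `f[x₀, …, xₙ]`: given by the recursion at distinct points, and by
Hermite's formula `∫ f⁽ⁿ⁾(s₀ x₀ + ⋯ + sₙ xₙ)` over the `n`-simplex otherwise. -/
def dividedDiff (f : ℝ → ℂ) (n : ℕ) (x : Fin (n + 1) → ℝ) : ℂ :=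
  if Function.Injective x then dividedDiffRec f n x
  else simplexIntegral n fun s => iteratedDeriv n f (∑ i, s i * x i)

end SpectralAction

end

/-!
# Taylor coefficients of the spectral action

Everything is read off from one power series in `t`. The coefficient of `tⁿ` in `exp (i ξ (D + t
R)) v` satisfies Duhamel's recursion (`duhamel`), which makes the formal series a one-parameter
group in `ξ` (`duhamel_add`). For `φ` with an exponential moment the superposition `∫ φ(ξ) exp (i
ξ (D + t R)) dξ` is then a power series with bounded coefficients (`fourierSeries`), and
convolution of the `φ` becomes the product of the series (`fourierSeries_convolution`): a
functional calculus for `D + t R` that needs no domain considerations.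

*Spectrum.* The Cayley transform of `D` is unitary, so the resolvent `S` is normal and the
functional calculus in the hypothesis is genuine. The compact operator `|S ^ s| ^ 2` is injective
and commutes with `S`; on its finite dimensional eigenspaces `D` is a symmetric matrix. This gives
an eigenbasis (`IsResolvent.exists_eigenbasis`), the summability of `|λᵢ - i| ^ (-s)`
(`IsResolvent.summable_norm_rpow`), and the unitary group as a group of diagonal operators.

*Trace class estimates.* The bounds in `ℰˢ` give exponential moments for the Fourier transforms of
`f` and `f (x - i) ^ s` (`HasIntegrableFourier.expIntegrable`). Choose an integer `k > s` and put
`a = s / k < 1`. Up to constants `f` is the product of `f (x - i) ^ s` and the `k`-th power of `(1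
+ i x) ^ (-a)`, whose Fourier transform is a Gamma density, so that the series of `f` is `Z V ^ k`
(`ClassE.exists_fourierSeries_factor`). Every coefficient of `V` decays like `2 ^ (-a j)` beyond
the dyadic spectral level `j` of `D` (`cutoffDecay_gamma`): the leftmost unitary factor of the
Duhamel integral can be integrated against the Gamma density, and cancellation in the truncated
Gamma integrals gives `|λ - i| ^ (-a)` (`norm_integral_shifted_le`). Telescoping `Z V ^ k` along
the levels yields terms with a factor of finite rank, hence trace norm bounds that are geometric
in the order (`nuclearBound_mul_pow`), and the same bounds dominate the passage to the limit when
`R` is replaced by its compressions `R_J` to the spans of finitely many basis vectors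
(`tendsto_trace_mul_pow`). This replaces the Hölder inequality for Schatten classes, for which
only the case at hand is needed.

*Combinatorics.* For `R_J` the traces are those of finite matrices. The derivative in `t` of `tr
exp (i ξ (D + t R_J))` is `i ξ tr (R_J exp (i ξ (D + t R_J)))`, which follows from the group law
alone (`trace_coeff_group`), and the matrix elements of the coefficients are sums over paths with
divided differences of exponentials as weights (`inner_duhamel_compression`). Integration against
the Fourier transform of `f` turns the latter into divided differences of the derivative of `f`
(`dividedDiff_deriv_eq_integral`), and the finite sums of the theorem are exactly the Taylor
coefficients for `R_J` (`trace_coeff_compression`); in the limit over `J` they become those for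
`R`.
-/

open MeasureTheory Filter Topology
open scoped ContDiff

noncomputable section

namespace SpectralAction

variable {H : Type*} [NormedAddCommGroup H] [InnerProductSpace ℂ H] [CompleteSpace H]

set_option linter.unusedSectionVars false

/-! ### The expansional as a Duhamel series -/

section

variable {D : H →ₗ.[ℂ] H} {U : ℝ → H →L[ℂ] H} {R : H →L[ℂ] H}

/-- The coefficient of `tⁿ` in `exp (i ξ (D + t R)) v`, defined by Duhamel's recursion
`Eₙ₊₁(ξ) v = i ∫₀^ξ U(ξ - η) R Eₙ(η) v dη`, `E₀ = U`. -/
def duhamel (U : ℝ → H →L[ℂ] H) (R : H →L[ℂ] H) : ℕ → H → ℝ → H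
  | 0, v, ξ => U ξ v
  | n + 1, v, ξ => Complex.I • ∫ η in (0 : ℝ)..ξ, U (ξ - η) (R (duhamel U R n v η))

lemma duhamel_zero (v : H) (ξ : ℝ) : duhamel U R 0 v ξ = U ξ v := rfl

lemma duhamel_succ (n : ℕ) (v : H) (ξ : ℝ) : duhamel U R (n + 1) v ξ
    = Complex.I • ∫ η in (0 : ℝ)..ξ, U (ξ - η) (R (duhamel U R n v η)) := rfl

namespace IsUnitaryGroup

lemma add_apply (hU : IsUnitaryGroup D U) (a b : ℝ) (v : H) : U (a + b) v = U a (U b v) := by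
  rw [hU.add]; rfl

lemma zero_apply (hU : IsUnitaryGroup D U) (v : H) : U 0 v = v := by
  rw [hU.zero]; rfl

/-- A strongly continuous group of isometries is jointly continuous. -/
lemma continuous_apply (hU : IsUnitaryGroup D U) {X : Type*} [TopologicalSpace X] {a : X → ℝ}
    {g : X → H} (ha : Continuous a) (hg : Continuous g) : Continuous fun x => U (a x) (g x) := by
  rw [continuous_iff_continuousAt]
  intro x
  have h1 : Tendsto (fun y => U (a y) (g x)) (𝓝 x) (𝓝 (U (a x) (g x))) :=
    ((hU.continuous (g x)).comp ha).continuousAt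
  have h2 : Tendsto (fun y => U (a y) (g y - g x)) (𝓝 x) (𝓝 0) := by
    rw [tendsto_zero_iff_norm_tendsto_zero]
    simp_rw [hU.norm_map]
    have : Tendsto (fun y => ‖g y - g x‖) (𝓝 x) (𝓝 ‖g x - g x‖) :=
      ((hg.sub continuous_const).norm).continuousAt
    simpa using this
  have := h1.add h2
  simpa [ContinuousAt] using this

end IsUnitaryGroup

lemma duhamel_succ_eq (hU : IsUnitaryGroup D U) (n : ℕ) (v : H) (ξ : ℝ) :
    duhamel U R (n + 1) v ξ
      = Complex.I • U ξ (∫ η in (0 : ℝ)..ξ, U (-η) (R (duhamel U R n v η))) := by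
  rw [duhamel]
  congr 1
  have : ∀ η, U (ξ - η) (R (duhamel U R n v η)) = U ξ (U (-η) (R (duhamel U R n v η))) := by
    intro η
    rw [sub_eq_add_neg, hU.add_apply]
  simp_rw [this]
  by_cases hi : IntervalIntegrable (fun η => U (-η) (R (duhamel U R n v η))) volume 0 ξ
  · exact (U ξ).intervalIntegral_comp_comm hi
  · rw [intervalIntegral.integral_undef hi, map_zero, intervalIntegral.integral_undef]
    intro h
    apply hi
    have h' : IntervalIntegrable (fun η => U (-ξ) (U ξ (U (-η) (R (duhamel U R n v η)))))
        volume 0 ξ :=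
      ⟨(U (-ξ)).integrable_comp h.1, (U (-ξ)).integrable_comp h.2⟩
    simpa only [← hU.add_apply, neg_add_cancel_left] using h'

lemma continuous_duhamel (hU : IsUnitaryGroup D U) (R : H →L[ℂ] H) (n : ℕ) (v : H) :
    Continuous (duhamel U R n v) := by
  induction n with
  | zero => exact hU.continuous v
  | succ n ih =>
    have : duhamel U R (n + 1) v = fun ξ =>
        Complex.I • U ξ (∫ η in (0 : ℝ)..ξ, U (-η) (R (duhamel U R n v η))) :=
      funext fun ξ => duhamel_succ_eq hU n v ξ
    rw [this]
    have hc : Continuous fun η => U (-η) (R (duhamel U R n v η)) :=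
      hU.continuous_apply continuous_neg (R.continuous.comp ih)
    exact (hU.continuous_apply continuous_id
      (intervalIntegral.continuous_primitive (fun a b => hc.intervalIntegrable a b) 0)).const_smul _

/-- The integrand of the Duhamel recursion is continuous. -/
lemma continuous_duhamel_integrand (hU : IsUnitaryGroup D U) (R : H →L[ℂ] H) (n : ℕ) (v : H)
    {X : Type*} [TopologicalSpace X] {a b : X → ℝ} (ha : Continuous a) (hb : Continuous b) :
    Continuous fun x => U (a x) (R (duhamel U R n v (b x))) :=
  hU.continuous_apply ha (R.continuous.comp ((continuous_duhamel hU R n v).comp hb))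

/-- Duhamel's recursion, rescaled to the unit interval. -/
lemma duhamel_succ_unit (n : ℕ) (v : H) (ξ : ℝ) :
    duhamel U R (n + 1) v ξ
      = (Complex.I * ξ) • ∫ r in (0 : ℝ)..1, U ((1 - r) * ξ) (R (duhamel U R n v (r * ξ))) := by
  have := intervalIntegral.smul_integral_comp_mul_left
    (f := fun η => U (ξ - η) (R (duhamel U R n v η))) (a := 0) (b := 1) ξ
  rw [mul_zero, mul_one] at this
  rw [duhamel, ← this, mul_smul]
  congr 1
  rw [Complex.coe_smul]
  congr 1
  refine intervalIntegral.integral_congr fun r _ => ?_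
  simp only [mul_comm ξ r, sub_mul, one_mul]

lemma norm_duhamel_le (hU : IsUnitaryGroup D U) (R : H →L[ℂ] H) (n : ℕ) (v : H) (ξ : ℝ) :
    ‖duhamel U R n v ξ‖ ≤ (|ξ| * ‖R‖) ^ n / n.factorial * ‖v‖ := by
  induction n generalizing ξ with
  | zero => simp [duhamel, hU.norm_map]
  | succ n ih =>
    rw [duhamel_succ_unit, norm_smul]
    have hb : ‖∫ r in (0 : ℝ)..1, U ((1 - r) * ξ) (R (duhamel U R n v (r * ξ)))‖
        ≤ ∫ r in (0 : ℝ)..1, ‖R‖ * ((|ξ| * ‖R‖) ^ n / n.factorial * ‖v‖) * r ^ n := by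
      refine intervalIntegral.norm_integral_le_of_norm_le zero_le_one ?_
        ((continuous_const.mul (continuous_pow n)).intervalIntegrable _ _)
      refine Eventually.of_forall fun r hr => ?_
      rw [hU.norm_map]
      refine (R.le_opNorm _).trans ?_
      rw [mul_assoc]
      refine mul_le_mul_of_nonneg_left ((ih _).trans (le_of_eq ?_)) (norm_nonneg _)
      rw [abs_mul, abs_of_pos hr.1]
      ring
    calc _ ≤ ‖Complex.I * (ξ : ℂ)‖ * _ := mul_le_mul_of_nonneg_left hb (norm_nonneg _)
      _ = _ := by
        rw [intervalIntegral.integral_const_mul, integral_pow, norm_mul, Complex.norm_I,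
          Complex.norm_real, Real.norm_eq_abs, Nat.factorial_succ]
        push_cast
        have : (n : ℝ) + 1 ≠ 0 := by positivity
        have : (n.factorial : ℝ) ≠ 0 := by positivity
        field_simp
        ring

lemma duhamel_add_vec (hU : IsUnitaryGroup D U) (n : ℕ) (v w : H) (ξ : ℝ) :
    duhamel U R n (v + w) ξ = duhamel U R n v ξ + duhamel U R n w ξ := by
  induction n generalizing ξ with
  | zero => simp [duhamel]
  | succ n ih =>
    simp only [duhamel, ih, map_add]
    rw [intervalIntegral.integral_add, smul_add]
    · exact (continuous_duhamel_integrand hU R n v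
        (continuous_const.sub continuous_id) continuous_id).intervalIntegrable _ _
    · exact (continuous_duhamel_integrand hU R n w
        (continuous_const.sub continuous_id) continuous_id).intervalIntegrable _ _

lemma duhamel_smul_vec (n : ℕ) (c : ℂ) (v : H) (ξ : ℝ) :
    duhamel U R n (c • v) ξ = c • duhamel U R n v ξ := by
  induction n generalizing ξ with
  | zero => simp [duhamel]
  | succ n ih =>
    simp only [duhamel, ih, map_smul]
    rw [intervalIntegral.integral_smul, smul_comm]

/-- The group law `Eₙ(ξ + η) = ∑ Eₚ(ξ) E_q(η)`, the sum over `p + q = n`. -/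
lemma duhamel_add (hU : IsUnitaryGroup D U) (n : ℕ) (v : H) (ξ η : ℝ) :
    duhamel U R n v (ξ + η)
      = ∑ p ∈ Finset.HasAntidiagonal.antidiagonal n, duhamel U R p.1 (duhamel U R p.2 v η) ξ := by
  induction n generalizing ξ with
  | zero => simp [duhamel, hU.add_apply]
  | succ n ih =>
    rw [Finset.Nat.sum_antidiagonal_succ]
    have hcont : Continuous fun τ => U (ξ + η - τ) (R (duhamel U R n v τ)) :=
      continuous_duhamel_integrand hU R n v (continuous_const.sub continuous_id) continuous_id
    have hsplit := intervalIntegral.integral_add_adjacent_intervals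
      (hcont.intervalIntegrable 0 η) (hcont.intervalIntegrable η (ξ + η)) (μ := volume)
    rw [duhamel_succ, ← hsplit, smul_add]
    congr 1
    · simp only [duhamel_zero, duhamel_succ]
      rw [map_smul, ← (U ξ).intervalIntegral_comp_comm]
      · simp_rw [← hU.add_apply, add_sub_assoc]
      · exact (continuous_duhamel_integrand hU R n v
          (continuous_const.sub continuous_id) continuous_id).intervalIntegrable _ _
    · have hshift := intervalIntegral.integral_comp_add_right
        (fun τ => U (ξ + η - τ) (R (duhamel U R n v τ))) η (a := 0) (b := ξ)
      rw [zero_add] at hshift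
      rw [← hshift]
      simp only [ih, map_sum, add_sub_add_right_eq_sub, duhamel_succ]
      rw [intervalIntegral.integral_finsetSum, Finset.smul_sum]
      intro p _
      exact (continuous_duhamel_integrand hU R p.1 _
          (continuous_const.sub continuous_id) continuous_id).intervalIntegrable _ _

/-- `duhamel` as a bounded operator. It is indexed by a proof that `U` is a unitary group because
additivity needs the integrals to converge. -/
def duhamelCLM (hU : IsUnitaryGroup D U) (R : H →L[ℂ] H) (n : ℕ) (ξ : ℝ) : H →L[ℂ] H :=
  LinearMap.mkContinuous
    { toFun := fun v => duhamel U R n v ξ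
      map_add' := fun v w => duhamel_add_vec hU n v w ξ
      map_smul' := fun c v => duhamel_smul_vec n c v ξ }
    ((|ξ| * ‖R‖) ^ n / n.factorial) fun v => norm_duhamel_le hU R n v ξ

@[simp]
lemma duhamelCLM_apply (hU : IsUnitaryGroup D U) (R : H →L[ℂ] H) (n : ℕ) (ξ : ℝ) (v : H) :
    duhamelCLM hU R n ξ v = duhamel U R n v ξ := rfl

end

/-! ### Integration over simplices -/

section

/-- The corner `{s ≥ 0, ∑ sᵢ ≤ 1}` in the coordinates used by `simplexIntegral`. -/
def corner (n : ℕ) : Set (Fin n → ℝ) := {s | (∀ i, 0 ≤ s i) ∧ ∑ i, s i ≤ 1}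

lemma isClosed_corner (n : ℕ) : IsClosed (corner n) := by
  have : corner n = (⋂ i, {s | 0 ≤ s i}) ∩ {s | ∑ i, s i ≤ 1} := by
    ext s; simp [corner]
  rw [this]
  refine (isClosed_iInter fun i => isClosed_le continuous_const (continuous_apply i)).inter
    (isClosed_le (by fun_prop) continuous_const)

lemma corner_subset (n : ℕ) : corner n ⊆ Set.Icc 0 1 := by
  rintro s ⟨h0, h1⟩
  exact ⟨fun i => h0 i, fun i =>
    (Finset.single_le_sum (f := s) (fun j _ => h0 j) (Finset.mem_univ i)).trans h1⟩

lemma isCompact_corner (n : ℕ) : IsCompact (corner n) :=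
  isCompact_Icc.of_isClosed_subset (isClosed_corner n) (corner_subset n)

section Slicing

variable {E : Type*} [NormedAddCommGroup E] [NormedSpace ℝ E]

lemma simplexIntegral_eq (n : ℕ) (F : (Fin (n + 1) → ℝ) → E) :
    simplexIntegral n F
      = ∫ s, (corner n).indicator (fun s => F (Fin.cons (1 - ∑ i, s i) s)) s := by
  rw [integral_indicator (isClosed_corner n).measurableSet]
  rfl

lemma simplexIntegral_zero [CompleteSpace E] (F : (Fin 1 → ℝ) → E) : simplexIntegral 0 F = F fun _ => 1 := by
  rw [simplexIntegral_eq, integral_unique]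
  have h2 : (volume : Measure (Fin 0 → ℝ)).real Set.univ = 1 := by
    simp [measureReal_def, volume_pi]
  rw [h2, one_smul, Set.indicator_of_mem (by simp [corner])]
  congr 1
  funext i
  fin_cases i
  simp

/-- The region over which a simplex is sliced: `r` is the sum of all coordinates. -/
def sliceRegion (n : ℕ) : Set (ℝ × (Fin n → ℝ)) :=
  {p | (∀ i, 0 ≤ p.2 i) ∧ ∑ i, p.2 i ≤ p.1 ∧ p.1 ≤ 1}

lemma isClosed_sliceRegion (n : ℕ) : IsClosed (sliceRegion n) := by
  have : sliceRegion n = (⋂ i, {p : ℝ × (Fin n → ℝ) | 0 ≤ p.2 i}) ∩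
      ({p | ∑ i, p.2 i ≤ p.1} ∩ {p | p.1 ≤ 1}) := by
    ext s; simp [sliceRegion]
  rw [this]
  refine (isClosed_iInter fun i => isClosed_le continuous_const (by fun_prop)).inter
    ((isClosed_le (by fun_prop) (by fun_prop)).inter (isClosed_le (by fun_prop) continuous_const))

lemma isCompact_sliceRegion (n : ℕ) : IsCompact (sliceRegion n) := by
  refine (isCompact_Icc (a := (0 : ℝ × (Fin n → ℝ))) (b := 1)).of_isClosed_subset
    (isClosed_sliceRegion n) ?_
  rintro ⟨r, y⟩ ⟨h0, h1, h2⟩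
  have hs : 0 ≤ ∑ i, y i := Finset.sum_nonneg fun i _ => h0 i
  refine ⟨⟨hs.trans h1, fun i => h0 i⟩, ⟨h2, fun i => ?_⟩⟩
  exact ((Finset.single_le_sum (f := y) (fun j _ => h0 j) (Finset.mem_univ i)).trans h1).trans h2

/-- Slicing the `(n+1)`-simplex along its first barycentric coordinate `1 - r`. -/
lemma simplexIntegral_succ (n : ℕ) {F : (Fin (n + 2) → ℝ) → E} (hF : Continuous F) :
    simplexIntegral (n + 1) F
      = ∫ r in (0 : ℝ)..1, r ^ n • simplexIntegral n fun s => F (Fin.cons (1 - r) (r • s)) := by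
  set g : (Fin (n + 1) → ℝ) → E := (corner (n + 1)).indicator
    (fun s => F (Fin.cons (1 - ∑ i, s i) s)) with hg
  set G : ℝ × (Fin n → ℝ) → E := (sliceRegion n).indicator
    (fun p => F (Fin.cons (1 - p.1) (Fin.cons (p.1 - ∑ i, p.2 i) p.2))) with hG
  have hGint : Integrable G := by
    rw [hG, integrable_indicator_iff (isClosed_sliceRegion n).measurableSet]
    refine ContinuousOn.integrableOn_compact (isCompact_sliceRegion n) (Continuous.continuousOn ?_)
    refine hF.comp ?_
    refine Continuous.finCons (by fun_prop) (Continuous.finCons (by fun_prop) (by fun_prop))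
  have hgint : Integrable g := by
    rw [hg, integrable_indicator_iff (isClosed_corner _).measurableSet]
    refine ContinuousOn.integrableOn_compact (isCompact_corner _) (Continuous.continuousOn ?_)
    exact hF.comp (Continuous.finCons (by fun_prop) (by fun_prop))
  have hmp := (volume_preserving_piFinSuccAbove (fun _ : Fin (n + 1) => ℝ) 0).symm
  have hsymm : ∀ p : ℝ × (Fin n → ℝ),
      (MeasurableEquiv.piFinSuccAbove (fun _ : Fin (n + 1) => ℝ) 0).symm p = Fin.cons p.1 p.2 := by
    intro p
    simp [MeasurableEquiv.piFinSuccAbove]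
    rfl
  have hgG : ∀ (x : ℝ) (y : Fin n → ℝ), g (Fin.cons x y) = G (x + ∑ i, y i, y) := by
    intro x y
    simp only [hg, hG]
    have : (Fin.cons x y : Fin (n + 1) → ℝ) ∈ corner (n + 1) ↔ (x + ∑ i, y i, y) ∈ sliceRegion n := by
      simp only [corner, sliceRegion, Set.mem_ofPred_eq, Fin.forall_fin_succ, Fin.cons_zero,
        Fin.cons_succ, Fin.sum_univ_succ, le_add_iff_nonneg_left]
      tauto
    by_cases h : (x + ∑ i, y i, y) ∈ sliceRegion n
    · rw [Set.indicator_of_mem h, Set.indicator_of_mem (this.2 h)]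
      simp [Fin.sum_univ_succ]
    · rw [Set.indicator_of_notMem h, Set.indicator_of_notMem (fun h' => h (this.1 h'))]
  -- Fubini in the first coordinate `x` and the remaining ones `y`, then the shear `r = x + ∑ y`
  have step1 : simplexIntegral (n + 1) F
      = ∫ y : Fin n → ℝ, ∫ x : ℝ, g (Fin.cons x y) := by
    rw [simplexIntegral_eq, ← hmp.integral_comp (MeasurableEquiv.measurableEmbedding _)]
    simp_rw [hsymm]
    refine integral_prod_symm (fun p : ℝ × (Fin n → ℝ) => g (Fin.cons p.1 p.2)) ?_
    have := (hmp.integrable_comp_emb (MeasurableEquiv.measurableEmbedding _)).2 hgint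
    refine this.congr (Eventually.of_forall fun p => ?_)
    simp only [Function.comp, hsymm]
  have step2 : simplexIntegral (n + 1) F = ∫ r : ℝ, ∫ y : Fin n → ℝ, G (r, y) := by
    rw [step1, integral_integral_swap (f := fun r y => G (r, y)) hGint]
    refine integral_congr_ae (Eventually.of_forall fun y => ?_)
    simp_rw [hgG]
    exact integral_add_right_eq_self (fun r => G (r, y)) _
  rw [step2, intervalIntegral.integral_of_le zero_le_one, ← integral_indicator measurableSet_Ioc]
  have hae : ∀ᵐ r : ℝ, r ≠ 0 := by
    rw [ae_iff]; simp
  refine integral_congr_ae (hae.mono fun r hr => ?_)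
  by_cases hmem : r ∈ Set.Ioc (0 : ℝ) 1
  · rw [Set.indicator_of_mem hmem, simplexIntegral_eq]
    -- the slice at `r` is `r` times the standard simplex; this scaling produces the factor `r ^ n`
    have hsc := Measure.integral_comp_smul (volume : Measure (Fin n → ℝ)) (fun y => G (r, y)) r
    have hrn : |(r ^ n)⁻¹| = (r ^ n)⁻¹ := abs_of_pos (by have := hmem.1; positivity)
    rw [Module.finrank_fin_fun, hrn] at hsc
    have : ∫ y, G (r, y) = r ^ n • ∫ z, G (r, r • z) := by
      rw [hsc, smul_smul, mul_inv_cancel₀ (pow_ne_zero _ hr), one_smul]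
    simp only [this]
    congr 1
    refine integral_congr_ae (Eventually.of_forall fun z => ?_)
    simp only [hG]
    have hiff : (r, r • z) ∈ sliceRegion n ↔ z ∈ corner n := by
      simp only [corner, sliceRegion, Set.mem_ofPred_eq, Pi.smul_apply, smul_eq_mul,
        ← Finset.mul_sum, hmem.2, and_true]
      refine and_congr (forall_congr' fun i => ?_) ?_
      · exact mul_nonneg_iff_of_pos_left hmem.1
      · exact mul_le_iff_le_one_right hmem.1
    by_cases h : z ∈ corner n
    · rw [Set.indicator_of_mem h, Set.indicator_of_mem (hiff.2 h)]
      congr 2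
      funext i
      refine Fin.cases ?_ (fun j => ?_) i
      · simp [← Finset.mul_sum, mul_sub]
      · simp
    · rw [Set.indicator_of_notMem h, Set.indicator_of_notMem (fun h' => h (hiff.1 h'))]
  · rw [Set.indicator_of_notMem hmem]
    have : ∀ y, G (r, y) = 0 := by
      intro y
      refine Set.indicator_of_notMem (fun h => hmem ?_) _
      obtain ⟨h0, h1, h2⟩ := h
      have hs : 0 ≤ ∑ i, y i := Finset.sum_nonneg fun i _ => h0 i
      exact ⟨lt_of_le_of_ne (hs.trans h1) (Ne.symm hr), h2⟩
    simp [this]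

end Slicing

section Expansional

variable {D : H →ₗ.[ℂ] H} {U : ℝ → H →L[ℂ] H} {R : H →L[ℂ] H}

lemma continuous_alternatingProduct (hU : IsUnitaryGroup D U) (R : H →L[ℂ] H) (n : ℕ)
    {X : Type*} [TopologicalSpace X] {a : X → Fin (n + 1) → ℝ} (ha : Continuous a) (v : H) :
    Continuous fun x => alternatingProduct U R n (a x) v := by
  induction n with
  | zero => exact (hU.continuous v).comp ((continuous_apply 0).comp ha)
  | succ n ih =>
    simp only [alternatingProduct, mul_apply_eq_comp]
    refine hU.continuous_apply ((continuous_apply 0).comp ha) (R.continuous.comp (ih ?_))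
    exact continuous_pi fun i => (continuous_apply i.succ).comp ha

lemma continuousLinearMap_simplexIntegral (n : ℕ) {F : (Fin (n + 1) → ℝ) → H} (hF : Continuous F)
    (A : H →L[ℂ] H) : A (simplexIntegral n F) = simplexIntegral n fun s => A (F s) := by
  refine (A.integral_comp_comm (μ := volume.restrict (corner n)) (φ := fun s =>
    F (Fin.cons (1 - ∑ i, s i) s)) ?_).symm
  refine ContinuousOn.integrableOn_compact (isCompact_corner _) (Continuous.continuousOn ?_)
  exact hF.comp (Continuous.finCons (by fun_prop) (by fun_prop))

/-- The simplex integrals of the expansional satisfy Duhamel's recursion. -/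
lemma smul_simplexIntegral_alternatingProduct (hU : IsUnitaryGroup D U) (R : H →L[ℂ] H) (n : ℕ)
    (v : H) (ξ : ℝ) :
    (Complex.I * ξ) ^ n • simplexIntegral n (fun s => alternatingProduct U R n (ξ • s) v)
      = duhamel U R n v ξ := by
  induction n generalizing ξ with
  | zero => simp [simplexIntegral_zero, alternatingProduct, duhamel_zero]
  | succ n ih =>
    have hc : Continuous fun s : Fin (n + 2) → ℝ => alternatingProduct U R (n + 1) (ξ • s) v :=
      continuous_alternatingProduct hU R (n + 1) (continuous_id.const_smul ξ) v
    rw [duhamel_succ_unit, simplexIntegral_succ n hc, pow_succ', mul_smul]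
    congr 1
    rw [← intervalIntegral.integral_smul]
    refine intervalIntegral.integral_congr fun r _ => ?_
    have hc' : Continuous fun s : Fin (n + 1) → ℝ => alternatingProduct U R n ((r * ξ) • s) v :=
      continuous_alternatingProduct hU R n (continuous_id.const_smul (r * ξ)) v
    have hRc : Continuous fun s : Fin (n + 1) → ℝ =>
        R (alternatingProduct U R n ((r * ξ) • s) v) := R.continuous.comp hc'
    rw [← ih, map_smul, map_smul, continuousLinearMap_simplexIntegral n hc',
      continuousLinearMap_simplexIntegral n hRc, ← Complex.coe_smul, smul_smul]
    congr 1
    · push_cast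
      ring
    · congr 1
      funext s
      simp only [alternatingProduct, mul_apply_eq_comp]
      congr 2
      · simp [mul_comm]
      · congr 2
        funext i
        simp [Fin.tail]
        ring

lemma expansionalTerm_eq (hU : IsUnitaryGroup D (unitaryGroup D)) (R : H →L[ℂ] H) (t ξ : ℝ)
    (v : H) (n : ℕ) :
    expansionalTerm D R t ξ v n = (t : ℂ) ^ n • duhamel (unitaryGroup D) R n v ξ := by
  rw [expansionalTerm, ← smul_simplexIntegral_alternatingProduct hU, smul_smul, ← mul_pow]
  congr 2
  ring

end Expansional

end

/-! ### Superpositions of the expansional -/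

section

open scoped Convolution

/-- `φ` has an exponential moment: `exp (ρ |ξ|) φ ξ` is integrable. -/
def ExpIntegrable (ρ : ℝ) (φ : ℝ → ℂ) : Prop :=
  Integrable fun ξ : ℝ => (Real.exp (ρ * |ξ|) : ℂ) * φ ξ

/-- The weighted `L¹`-norm that belongs to `ExpIntegrable`. -/
def expNorm (ρ : ℝ) (φ : ℝ → ℂ) : ℝ := ∫ ξ : ℝ, Real.exp (ρ * |ξ|) * ‖φ ξ‖

lemma expNorm_nonneg (ρ : ℝ) (φ : ℝ → ℂ) : 0 ≤ expNorm ρ φ :=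
  integral_nonneg fun ξ => by positivity

namespace ExpIntegrable

variable {ρ : ℝ} {φ ψ : ℝ → ℂ}

lemma aestronglyMeasurable (h : ExpIntegrable ρ φ) : AEStronglyMeasurable φ := by
  have h1 : AEStronglyMeasurable fun ξ : ℝ => (Real.exp (-(ρ * |ξ|)) : ℂ) :=
    (by fun_prop : Continuous fun ξ : ℝ => (Real.exp (-(ρ * |ξ|)) : ℂ)).aestronglyMeasurable
  refine (h1.mul h.1).congr (Eventually.of_forall fun ξ => ?_)
  simp only [Pi.mul_apply]
  rw [← mul_assoc, ← Complex.ofReal_mul, ← Real.exp_add]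
  simp

lemma integrable_exp_mul_norm (h : ExpIntegrable ρ φ) :
    Integrable fun ξ : ℝ => Real.exp (ρ * |ξ|) * ‖φ ξ‖ := by
  refine h.norm.congr (Eventually.of_forall fun ξ => ?_)
  simp only [norm_mul, Complex.norm_real, Real.norm_eq_abs, Real.abs_exp]

lemma of_norm (hm : AEStronglyMeasurable φ)
    (h : Integrable fun ξ : ℝ => Real.exp (ρ * |ξ|) * ‖φ ξ‖) : ExpIntegrable ρ φ := by
  have h1 : AEStronglyMeasurable fun ξ : ℝ => (Real.exp (ρ * |ξ|) : ℂ) :=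
    (by fun_prop : Continuous fun ξ : ℝ => (Real.exp (ρ * |ξ|) : ℂ)).aestronglyMeasurable
  refine h.mono' (h1.mul hm) (Eventually.of_forall fun ξ => ?_)
  simp only [norm_mul, Complex.norm_real, Real.norm_eq_abs, Real.abs_exp, le_refl]

lemma mono {ρ' : ℝ} (h : ExpIntegrable ρ φ) (hρ : ρ' ≤ ρ) : ExpIntegrable ρ' φ := by
  refine of_norm h.aestronglyMeasurable (h.integrable_exp_mul_norm.mono' ?_ ?_)
  · exact (by fun_prop : Continuous fun ξ : ℝ => Real.exp (ρ' * |ξ|)).aestronglyMeasurable.mul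
      h.aestronglyMeasurable.norm
  · refine Eventually.of_forall fun ξ => ?_
    rw [Real.norm_of_nonneg (by positivity)]
    gcongr

lemma const_mul (h : ExpIntegrable ρ φ) (c : ℂ) : ExpIntegrable ρ fun ξ => c * φ ξ := by
  refine (Integrable.const_mul h c).congr (Eventually.of_forall fun ξ => ?_)
  simp only
  ring

lemma integrable (h : ExpIntegrable ρ φ) (hρ : 0 ≤ ρ) : Integrable φ := by
  have := h.mono hρ
  refine Integrable.congr this (Eventually.of_forall fun ξ => by simp)

section Smul

variable {E : Type*} [NormedAddCommGroup E] [NormedSpace ℂ E] {G : ℝ → E} {C : ℝ}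

lemma integrable_smul (h : ExpIntegrable ρ φ) (hG : AEStronglyMeasurable G)
    (hb : ∀ ξ, ‖G ξ‖ ≤ C * Real.exp (ρ * |ξ|)) : Integrable fun ξ => φ ξ • G ξ := by
  refine (h.integrable_exp_mul_norm.const_mul C).mono' (h.aestronglyMeasurable.smul hG)
    (Eventually.of_forall fun ξ => ?_)
  simp only [norm_smul]
  calc ‖φ ξ‖ * ‖G ξ‖ ≤ ‖φ ξ‖ * (C * Real.exp (ρ * |ξ|)) :=
        mul_le_mul_of_nonneg_left (hb ξ) (norm_nonneg _)
    _ = _ := by ring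

lemma norm_integral_smul_le (h : ExpIntegrable ρ φ)
    (hb : ∀ ξ, ‖G ξ‖ ≤ C * Real.exp (ρ * |ξ|)) :
    ‖∫ ξ, φ ξ • G ξ‖ ≤ C * expNorm ρ φ := by
  rw [expNorm, ← integral_const_mul]
  refine norm_integral_le_of_norm_le (h.integrable_exp_mul_norm.const_mul C)
    (Eventually.of_forall fun ξ => ?_)
  rw [norm_smul]
  calc ‖φ ξ‖ * ‖G ξ‖ ≤ ‖φ ξ‖ * (C * Real.exp (ρ * |ξ|)) :=
        mul_le_mul_of_nonneg_left (hb ξ) (norm_nonneg _)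
    _ = _ := by ring

end Smul

lemma exp_abs_le (hρ : 0 ≤ ρ) (ξ ζ : ℝ) :
    Real.exp (ρ * |ζ|) ≤ Real.exp (ρ * |ξ|) * Real.exp (ρ * |ζ - ξ|) := by
  rw [← Real.exp_add, ← mul_add]
  gcongr
  calc |ζ| = |ξ + (ζ - ξ)| := by ring_nf
    _ ≤ _ := abs_add_le _ _

/-- Exponential moments are submultiplicative because `|ξ + ζ| ≤ |ξ| + |ζ|`. -/
lemma convolution (hρ : 0 ≤ ρ) (hφ : ExpIntegrable ρ φ) (hψ : ExpIntegrable ρ ψ) :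
    ExpIntegrable ρ (φ ⋆[ContinuousLinearMap.mul ℂ ℂ] ψ) := by
  have hconv := hφ.integrable_exp_mul_norm.integrable_convolution
    (ContinuousLinearMap.mul ℝ ℝ) hψ.integrable_exp_mul_norm
  have hex := hφ.integrable_exp_mul_norm.ae_convolution_exists
    (ContinuousLinearMap.mul ℝ ℝ) hψ.integrable_exp_mul_norm
  have hm := ((hφ.integrable hρ).integrable_convolution
    (ContinuousLinearMap.mul ℂ ℂ) (hψ.integrable hρ)).aestronglyMeasurable
  refine of_norm hm (hconv.mono' ?_ ?_)
  · exact (by fun_prop : Continuous fun ξ : ℝ => Real.exp (ρ * |ξ|)).aestronglyMeasurable.mul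
      hm.norm
  · filter_upwards [hex] with ζ hζ
    rw [Real.norm_of_nonneg (by positivity), convolution_def, convolution_def]
    calc _ ≤ Real.exp (ρ * |ζ|) * ∫ ξ, ‖φ ξ‖ * ‖ψ (ζ - ξ)‖ := by
          gcongr
          refine (norm_integral_le_integral_norm _).trans (le_of_eq ?_)
          simp
      _ = ∫ ξ, Real.exp (ρ * |ζ|) * (‖φ ξ‖ * ‖ψ (ζ - ξ)‖) := by rw [integral_const_mul]
      _ ≤ _ := by
          refine integral_mono_of_nonneg (Eventually.of_forall fun ξ => by positivity) hζ
            (Eventually.of_forall fun ξ => ?_)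
          simp only [ContinuousLinearMap.mul_apply']
          calc _ ≤ (Real.exp (ρ * |ξ|) * Real.exp (ρ * |ζ - ξ|)) * (‖φ ξ‖ * ‖ψ (ζ - ξ)‖) := by
                gcongr
                exact exp_abs_le hρ ξ ζ
            _ = _ := by ring

/-- Fubini's theorem for a convolution integrated against a function of exponential growth. -/
lemma integral_convolution_smul {E : Type*} [NormedAddCommGroup E] [NormedSpace ℂ E]
    [CompleteSpace E]     {G : ℝ → E} {C : ℝ} (hρ : 0 ≤ ρ) (hφ : ExpIntegrable ρ φ) (hψ : ExpIntegrable ρ ψ)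
    (hG : Continuous G) (hb : ∀ ξ, ‖G ξ‖ ≤ C * Real.exp (ρ * |ξ|)) :
    ∫ ζ, (φ ⋆[ContinuousLinearMap.mul ℂ ℂ] ψ) ζ • G ζ
      = ∫ ξ, φ ξ • ∫ η, ψ η • G (ξ + η) := by
  have hC : 0 ≤ C := by
    have := (norm_nonneg _).trans (hb 0)
    simpa using this
  have hint : Integrable (fun p : ℝ × ℝ => (φ p.2 * ψ (p.1 - p.2)) • G p.1)
      (volume.prod volume) := by
    have h1 := (hφ.integrable_exp_mul_norm.convolution_integrand
      (ContinuousLinearMap.mul ℝ ℝ) hψ.integrable_exp_mul_norm).const_mul C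
    have h2 := ((hφ.integrable hρ).convolution_integrand
      (ContinuousLinearMap.mul ℂ ℂ) (hψ.integrable hρ)).aestronglyMeasurable
    refine h1.mono' (h2.smul (hG.comp continuous_fst).aestronglyMeasurable)
      (Eventually.of_forall fun p => ?_)
    simp only [norm_smul, norm_mul, ContinuousLinearMap.mul_apply']
    calc ‖φ p.2‖ * ‖ψ (p.1 - p.2)‖ * ‖G p.1‖
        ≤ ‖φ p.2‖ * ‖ψ (p.1 - p.2)‖ *
          (C * (Real.exp (ρ * |p.2|) * Real.exp (ρ * |p.1 - p.2|))) := by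
          gcongr
          exact (hb _).trans (mul_le_mul_of_nonneg_left (exp_abs_le hρ _ _) hC)
      _ = _ := by ring
  calc _ = ∫ ζ, ∫ ξ, (φ ξ * ψ (ζ - ξ)) • G ζ := by
        refine integral_congr_ae (Eventually.of_forall fun ζ => ?_)
        simp only [convolution_def, ContinuousLinearMap.mul_apply']
        rw [integral_smul_const]
    _ = ∫ ξ, ∫ ζ, (φ ξ * ψ (ζ - ξ)) • G ζ := integral_integral_swap hint
    _ = _ := by
        refine integral_congr_ae (Eventually.of_forall fun ξ => ?_)
        simp only
        rw [← integral_smul, ← integral_add_left_eq_self _ ξ]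
        simp only [add_sub_cancel_left, mul_smul]

end ExpIntegrable

section FourierSeries

variable {D : H →ₗ.[ℂ] H} {U : ℝ → H →L[ℂ] H} {ρ : ℝ} {φ ψ : ℝ → ℂ}

lemma norm_duhamel_le_exp (hU : IsUnitaryGroup D U) (R : H →L[ℂ] H) (hρ : 0 < ρ) (n : ℕ) (v : H)
    (ξ : ℝ) : ‖duhamel U R n v ξ‖ ≤ ((‖R‖ / ρ) ^ n * ‖v‖) * Real.exp (ρ * |ξ|) := by
  refine (norm_duhamel_le hU R n v ξ).trans ?_
  have h := Real.pow_div_factorial_le_exp (ρ * |ξ|) (by positivity) n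
  calc (|ξ| * ‖R‖) ^ n / n.factorial * ‖v‖
      = (‖R‖ / ρ) ^ n * ‖v‖ * ((ρ * |ξ|) ^ n / n.factorial) := by
        rw [mul_pow, mul_pow, div_pow]; field_simp
    _ ≤ _ := by gcongr

lemma integrable_smul_duhamel (hU : IsUnitaryGroup D U) (R : H →L[ℂ] H) (hρ : 0 < ρ)
    (hφ : ExpIntegrable ρ φ) (n : ℕ) (v : H) :
    Integrable fun ξ => φ ξ • duhamel U R n v ξ :=
  hφ.integrable_smul (continuous_duhamel hU R n v).aestronglyMeasurable
    (norm_duhamel_le_exp hU R hρ n v)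

/-- The power series in `t` of `∫ φ(ξ) exp (i ξ (D + t R)) dξ`, with bounded operators as
coefficients. -/
def fourierSeries (hU : IsUnitaryGroup D U) (R : H →L[ℂ] H) (hρ : 0 < ρ)
    (hφ : ExpIntegrable ρ φ) : PowerSeries (H →L[ℂ] H) :=
  PowerSeries.mk fun n => LinearMap.mkContinuous
    { toFun := fun v => ∫ ξ, φ ξ • duhamel U R n v ξ
      map_add' := fun v w => by
        simp_rw [duhamel_add_vec hU, smul_add]
        exact integral_add (integrable_smul_duhamel hU R hρ hφ n v)
          (integrable_smul_duhamel hU R hρ hφ n w)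
      map_smul' := fun c v => by
        simp_rw [duhamel_smul_vec, smul_comm _ c]
        exact integral_smul c _ }
    ((‖R‖ / ρ) ^ n * expNorm ρ φ) fun v => by
      refine (hφ.norm_integral_smul_le (norm_duhamel_le_exp hU R hρ n v)).trans (le_of_eq ?_)
      ring

lemma coeff_fourierSeries_apply (hU : IsUnitaryGroup D U) (R : H →L[ℂ] H) (hρ : 0 < ρ)
    (hφ : ExpIntegrable ρ φ) (n : ℕ) (v : H) :
    PowerSeries.coeff n (fourierSeries hU R hρ hφ) v = ∫ ξ, φ ξ • duhamel U R n v ξ := by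
  rw [fourierSeries, PowerSeries.coeff_mk]
  rfl

lemma norm_coeff_fourierSeries_le (hU : IsUnitaryGroup D U) (R : H →L[ℂ] H) (hρ : 0 < ρ)
    (hφ : ExpIntegrable ρ φ) (n : ℕ) :
    ‖PowerSeries.coeff n (fourierSeries hU R hρ hφ)‖ ≤ expNorm ρ φ * (‖R‖ / ρ) ^ n := by
  rw [mul_comm (expNorm ρ φ), fourierSeries, PowerSeries.coeff_mk]
  exact LinearMap.mkContinuous_norm_le _
    (mul_nonneg (by positivity) (expNorm_nonneg _ _)) _

lemma fourierSeries_congr (hU : IsUnitaryGroup D U) (R : H →L[ℂ] H) {ρ' : ℝ} (hρ : 0 < ρ)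
    (hρ' : 0 < ρ') (hφ : ExpIntegrable ρ φ) (hψ : ExpIntegrable ρ' ψ) (h : φ =ᵐ[volume] ψ) :
    fourierSeries hU R hρ hφ = fourierSeries hU R hρ' hψ := by
  ext n v
  rw [coeff_fourierSeries_apply, coeff_fourierSeries_apply]
  exact integral_congr_ae (h.mono fun ξ hξ => by simp only [hξ])

/-- The functional calculus is multiplicative: convolution of Fourier transforms becomes the
product of power series. It rests on the group law `duhamel_add`. -/
lemma fourierSeries_convolution (hU : IsUnitaryGroup D U) (R : H →L[ℂ] H) (hρ : 0 < ρ)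
    (hφ : ExpIntegrable ρ φ) (hψ : ExpIntegrable ρ ψ) :
    fourierSeries hU R hρ (hφ.convolution hρ.le hψ)
      = fourierSeries hU R hρ hφ * fourierSeries hU R hρ hψ := by
  ext n v
  rw [coeff_fourierSeries_apply, PowerSeries.coeff_mul,
    hφ.integral_convolution_smul hρ.le hψ (continuous_duhamel hU R n v)
      (norm_duhamel_le_exp hU R hρ n v), sum_apply]
  have key : ∀ ξ, ∫ η, ψ η • duhamel U R n v (ξ + η)
      = ∑ p ∈ Finset.HasAntidiagonal.antidiagonal n,
        duhamel U R p.1 (PowerSeries.coeff p.2 (fourierSeries hU R hρ hψ) v) ξ := by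
    intro ξ
    simp_rw [duhamel_add hU, Finset.smul_sum]
    have hc : ∀ p : ℕ × ℕ, ∀ η, ψ η • duhamel U R p.1 (duhamel U R p.2 v η) ξ
        = duhamelCLM hU R p.1 ξ (ψ η • duhamel U R p.2 v η) := by
      intro p η
      rw [map_smul, duhamelCLM_apply]
    simp_rw [hc]
    rw [integral_finsetSum]
    · refine Finset.sum_congr rfl fun p _ => ?_
      rw [ContinuousLinearMap.integral_comp_comm _ (integrable_smul_duhamel hU R hρ hψ p.2 v),
        coeff_fourierSeries_apply, duhamelCLM_apply]
    · intro p _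
      exact (duhamelCLM hU R p.1 ξ).integrable_comp (integrable_smul_duhamel hU R hρ hψ p.2 v)
  simp_rw [key, Finset.smul_sum]
  rw [integral_finsetSum]
  · refine Finset.sum_congr rfl fun p _ => ?_
    rw [mul_apply_eq_comp, coeff_fourierSeries_apply hU R hρ hφ]
  · intro p _
    exact integrable_smul_duhamel hU R hρ hφ p.1 _

end FourierSeries

end

/-! ### Nuclear operators and the trace -/

section

/-- `T` is nuclear with nuclear norm at most `b`, as witnessed by one representation. -/
def NuclearBound (T : H →L[ℂ] H) (b : ℝ) : Prop :=
  ∃ x y : ℕ → H, (Summable fun k => ‖x k‖ * ‖y k‖) ∧ ∑' k, ‖x k‖ * ‖y k‖ ≤ b ∧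
    ∀ v, HasSum (fun k => inner ℂ (x k) v • y k) (T v)

lemma NuclearBound.isTraceClass {T : H →L[ℂ] H} {b : ℝ} (h : NuclearBound T b) :
    IsTraceClass T := by
  obtain ⟨x, y, h1, -, h2⟩ := h
  exact ⟨x, y, h1, h2⟩

lemma NuclearBound.mono {T : H →L[ℂ] H} {b c : ℝ} (h : NuclearBound T b) (hbc : b ≤ c) :
    NuclearBound T c := by
  obtain ⟨x, y, h1, h2, h3⟩ := h
  exact ⟨x, y, h1, h2.trans hbc, h3⟩

lemma NuclearBound.norm_le {T : H →L[ℂ] H} {b : ℝ} (h : NuclearBound T b) : ‖T‖ ≤ b := by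
  obtain ⟨x, y, h1, h2, h3⟩ := h
  have hb : 0 ≤ b := le_trans (tsum_nonneg fun k => by positivity) h2
  refine T.opNorm_le_bound hb fun v => ?_
  have hle : ∀ k, ‖inner ℂ (x k) v • y k‖ ≤ ‖x k‖ * ‖y k‖ * ‖v‖ := fun k => by
    rw [norm_smul]
    calc _ ≤ (‖x k‖ * ‖v‖) * ‖y k‖ := by gcongr; exact norm_inner_le_norm _ _
      _ = _ := by ring
  rw [← (h3 v).tsum_eq]
  calc _ ≤ ∑' k, ‖x k‖ * ‖y k‖ * ‖v‖ := tsum_of_norm_bounded (h1.mul_right _).hasSum hle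
    _ = (∑' k, ‖x k‖ * ‖y k‖) * ‖v‖ := tsum_mul_right
    _ ≤ _ := by gcongr

section Bessel

variable {ι : Type*} (e : HilbertBasis ι ℂ H)

lemma sum_norm_inner_mul_inner_le (x y : H) (s : Finset ι) :
    ∑ i ∈ s, ‖inner ℂ x (e i) * inner ℂ (e i) y‖ ≤ ‖x‖ * ‖y‖ := by
  have hx : ∑ i ∈ s, ‖inner ℂ x (e i)‖ ^ 2 ≤ ‖x‖ ^ 2 := by
    simp_rw [norm_inner_symm x]
    exact e.orthonormal.sum_inner_products_le x
  have hy : ∑ i ∈ s, ‖inner ℂ (e i) y‖ ^ 2 ≤ ‖y‖ ^ 2 := e.orthonormal.sum_inner_products_le y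
  simp_rw [norm_mul]
  calc _ ≤ √(∑ i ∈ s, ‖inner ℂ x (e i)‖ ^ 2) * √(∑ i ∈ s, ‖inner ℂ (e i) y‖ ^ 2) :=
        Real.sum_mul_le_sqrt_mul_sqrt _ _ _
    _ ≤ √(‖x‖ ^ 2) * √(‖y‖ ^ 2) := by gcongr
    _ = _ := by rw [Real.sqrt_sq (norm_nonneg _), Real.sqrt_sq (norm_nonneg _)]

/-- The double family behind the independence of the trace from the basis is summable. -/
lemma summable_inner_mul_inner_prod {x y : ℕ → H} (h : Summable fun k => ‖x k‖ * ‖y k‖) :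
    Summable fun p : ℕ × ι => inner ℂ (x p.1) (e p.2) * inner ℂ (e p.2) (y p.1) := by
  refine Summable.of_norm ((summable_prod_of_nonneg fun p => norm_nonneg _).2 ⟨fun k => ?_, ?_⟩)
  · exact summable_of_sum_le (fun i => norm_nonneg _) (sum_norm_inner_mul_inner_le e (x k) (y k))
  · refine Summable.of_nonneg_of_le (fun k => tsum_nonneg fun i => norm_nonneg _) (fun k => ?_) h
    exact Real.tsum_le_of_sum_le (fun i => norm_nonneg _)
      (sum_norm_inner_mul_inner_le e (x k) (y k))

lemma hasSum_inner_apply_of_rep {T : H →L[ℂ] H} {x y : ℕ → H}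
    (h : Summable fun k => ‖x k‖ * ‖y k‖)
    (hT : ∀ v, HasSum (fun k => inner ℂ (x k) v • y k) (T v)) :
    HasSum (fun i => inner ℂ (e i) (T (e i))) (∑' k, inner ℂ (x k) (y k)) := by
  have hs := summable_inner_mul_inner_prod e h
  have h1 := hs.hasSum.prod_fiberwise fun k => e.hasSum_inner_mul_inner (x k) (y k)
  rw [h1.tsum_eq]
  have h2 := ((Equiv.prodComm ι ℕ).hasSum_iff.2 hs.hasSum).prod_fiberwise
    (g := fun i => inner ℂ (e i) (T (e i))) fun i => by
      have := (hT (e i)).mapL (innerSL ℂ (e i))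
      simpa [inner_smul_right] using this
  exact h2

end Bessel

lemma trace_eq_tsum {T : H →L[ℂ] H} {x y : ℕ → H} (h : Summable fun k => ‖x k‖ * ‖y k‖)
    (hT : ∀ v, HasSum (fun k => inner ℂ (x k) v • y k) (T v)) :
    trace T = ∑' k, inner ℂ (x k) (y k) :=
  (hasSum_inner_apply_of_rep _ h hT).tsum_eq

/-- The trace of a trace class operator may be computed in any orthonormal basis. -/
lemma IsTraceClass.hasSum_trace {T : H →L[ℂ] H} (hT : IsTraceClass T) {ι : Type*}
    (e : HilbertBasis ι ℂ H) : HasSum (fun i => inner ℂ (e i) (T (e i))) (trace T) := by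
  obtain ⟨x, y, h1, h2⟩ := hT
  rw [trace_eq_tsum h1 h2]
  exact hasSum_inner_apply_of_rep e h1 h2

lemma summable_inner_of_rep {α : Type*} {x y : α → H} (h : Summable fun k => ‖x k‖ * ‖y k‖) :
    Summable fun k => inner ℂ (x k) (y k) :=
  Summable.of_norm_bounded h fun _ => norm_inner_le_norm _ _

lemma NuclearBound.norm_trace_le {T : H →L[ℂ] H} {b : ℝ} (h : NuclearBound T b) :
    ‖trace T‖ ≤ b := by
  obtain ⟨x, y, h1, h2, h3⟩ := h
  rw [trace_eq_tsum h1 h3]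
  exact (tsum_of_norm_bounded h1.hasSum fun k => norm_inner_le_norm _ _).trans h2

/-- A representation indexed by any countable type may be reindexed by `ℕ`. -/
lemma nuclearBound_of_countable {α : Type*} [Countable α] {T : H →L[ℂ] H} {x y : α → H}
    (h : Summable fun k => ‖x k‖ * ‖y k‖)
    (hT : ∀ v, HasSum (fun k => inner ℂ (x k) v • y k) (T v)) :
    NuclearBound T (∑' k, ‖x k‖ * ‖y k‖) ∧ trace T = ∑' k, inner ℂ (x k) (y k) := by
  obtain ⟨f, hf⟩ := exists_injective_nat α
  have hext : ∀ {β : Type} [Zero β] (F : H → H → β), (F 0 0 = 0) → ∀ n,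
      F (Function.extend f x 0 n) (Function.extend f y 0 n)
        = Function.extend f (fun k => F (x k) (y k)) 0 n := by
    intro β _ F h0 n
    by_cases hn : ∃ a, f a = n
    · obtain ⟨a, rfl⟩ := hn
      simp only [hf.extend_apply]
    · simp only [Function.extend_apply' _ _ _ hn, Pi.zero_apply, h0]
  have hext' : ∀ v, ∀ n,
      inner ℂ (Function.extend f x 0 n) v • Function.extend f y 0 n
        = Function.extend f (fun k => inner ℂ (x k) v • y k) 0 n := by
    intro v n
    by_cases hn : ∃ a, f a = n
    · obtain ⟨a, rfl⟩ := hn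
      simp only [hf.extend_apply]
    · simp only [Function.extend_apply' _ _ _ hn, Pi.zero_apply, smul_zero]
  have e1 := funext (hext (fun a b => ‖a‖ * ‖b‖) (by simp))
  have e2 := funext (hext (fun a b => inner ℂ a b) (by simp))
  have s1 : HasSum (fun n => ‖Function.extend f x 0 n‖ * ‖Function.extend f y 0 n‖)
      (∑' k, ‖x k‖ * ‖y k‖) := by
    rw [e1]
    exact (hasSum_extend_zero hf).2 h.hasSum
  have s2 : ∀ v, HasSum (fun n => inner ℂ (Function.extend f x 0 n) v • Function.extend f y 0 n)
      (T v) := by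
    intro v
    rw [funext (hext' v)]
    exact (hasSum_extend_zero hf).2 (hT v)
  refine ⟨⟨_, _, s1.summable, s1.tsum_eq.le, s2⟩, ?_⟩
  rw [trace_eq_tsum s1.summable s2, e2]
  exact ((hasSum_extend_zero hf).2 (summable_inner_of_rep h).hasSum).tsum_eq

/-- Countable sums of nuclear operators: the trace is countably additive. -/
lemma nuclearBound_of_hasSum {α : Type*} [Countable α] {T : H →L[ℂ] H} {S : α → H →L[ℂ] H}
    {b : α → ℝ} (hS : ∀ a, NuclearBound (S a) (b a)) (hb : Summable b)
    (hT : ∀ v, HasSum (fun a => S a v) (T v)) :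
    NuclearBound T (∑' a, b a) ∧ HasSum (fun a => trace (S a)) (trace T) := by
  choose x y h1 h2 h3 using hS
  have hn : Summable fun p : α × ℕ => ‖x p.1 p.2‖ * ‖y p.1 p.2‖ := by
    refine (summable_prod_of_nonneg fun p => by positivity).2 ⟨h1, ?_⟩
    exact Summable.of_nonneg_of_le (fun a => tsum_nonneg fun k => by positivity) h2 hb
  have hsum : ∀ v, HasSum (fun p : α × ℕ => inner ℂ (x p.1 p.2) v • y p.1 p.2) (T v) := by
    intro v
    have hs : Summable fun p : α × ℕ => inner ℂ (x p.1 p.2) v • y p.1 p.2 := by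
      refine Summable.of_norm_bounded (hn.mul_right ‖v‖) fun p => ?_
      rw [norm_smul]
      calc _ ≤ (‖x p.1 p.2‖ * ‖v‖) * ‖y p.1 p.2‖ := by gcongr; exact norm_inner_le_norm _ _
        _ = _ := by ring
    have h := hs.hasSum.prod_fiberwise (g := fun a => S a v) fun a => h3 a v
    rw [(hT v).unique h]
    exact hs.hasSum
  obtain ⟨hN, htr⟩ := nuclearBound_of_countable (x := fun p : α × ℕ => x p.1 p.2)
    (y := fun p => y p.1 p.2) hn hsum
  constructor
  · refine hN.mono ?_
    rw [hn.tsum_prod' h1]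
    exact Summable.tsum_le_tsum h2 hn.prod hb
  · rw [htr]
    refine (summable_inner_of_rep hn).hasSum.prod_fiberwise fun a => ?_
    rw [trace_eq_tsum (h1 a) (h3 a)]
    exact (summable_inner_of_rep (h1 a)).hasSum

lemma NuclearBound.sum {α : Type*} {S : α → H →L[ℂ] H} {b : α → ℝ} (s : Finset α)
    (hS : ∀ a ∈ s, NuclearBound (S a) (b a)) :
    NuclearBound (∑ a ∈ s, S a) (∑ a ∈ s, b a) ∧ trace (∑ a ∈ s, S a) = ∑ a ∈ s, trace (S a) := by
  have := nuclearBound_of_hasSum (α := s) (T := ∑ a ∈ s, S a) (S := fun a => S a)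
    (b := fun a => b a) (fun a => hS a a.2) (Summable.of_finite) fun v => by
      have := hasSum_fintype fun a : s => S a v
      rwa [Finset.sum_coe_sort s (fun a => S a v), ← sum_apply] at this
  rw [tsum_fintype, Finset.sum_coe_sort s b] at this
  refine ⟨this.1, ?_⟩
  rw [← this.2.tsum_eq, tsum_fintype, Finset.sum_coe_sort s fun a => trace (S a)]

/-- The orthogonal projection onto the span of finitely many basis vectors. -/
def finProj {ι : Type*} (e : HilbertBasis ι ℂ H) (s : Finset ι) : H →L[ℂ] H :=
  ∑ i ∈ s, InnerProductSpace.rankOne ℂ (e i) (e i)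

lemma finProj_apply {ι : Type*} (e : HilbertBasis ι ℂ H) (s : Finset ι) (v : H) :
    finProj e s v = ∑ i ∈ s, inner ℂ (e i) v • e i := by
  simp [finProj, sum_apply]

lemma nuclearBound_mul_rankOne_mul (A B : H →L[ℂ] H) {x : H} (hx : ‖x‖ = 1) :
    NuclearBound (A * InnerProductSpace.rankOne ℂ x x * B) (‖A‖ * ‖B‖) ∧
      trace (A * InnerProductSpace.rankOne ℂ x x * B) = inner ℂ x (B (A x)) := by
  have h := nuclearBound_of_countable (α := Unit)
    (T := A * InnerProductSpace.rankOne ℂ x x * B) (x := fun _ => (ContinuousLinearMap.adjoint B) x)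
    (y := fun _ => A x) Summable.of_finite fun v => by
      simp [ContinuousLinearMap.adjoint_inner_left]
  simp only [tsum_fintype, Finset.univ_unique, Finset.sum_singleton] at h
  refine ⟨h.1.mono ?_, h.2.trans ?_⟩
  · rw [mul_comm]
    refine mul_le_mul ?_ ?_ (norm_nonneg _) (norm_nonneg _)
    · simpa [hx] using A.le_opNorm x
    · have := (ContinuousLinearMap.adjoint B).le_opNorm x
      rwa [hx, mul_one, LinearIsometryEquiv.norm_map] at this
  · rw [ContinuousLinearMap.adjoint_inner_left]

lemma nuclearBound_mul_finProj_mul {ι : Type*} (e : HilbertBasis ι ℂ H) (s : Finset ι)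
    (A B : H →L[ℂ] H) :
    NuclearBound (A * finProj e s * B) (s.card * (‖A‖ * ‖B‖)) ∧
      trace (A * finProj e s * B) = ∑ i ∈ s, inner ℂ (e i) (B (A (e i))) := by
  have h := NuclearBound.sum s fun i _ =>
    (nuclearBound_mul_rankOne_mul A B (e.orthonormal.1 i)).1
  rw [← Finset.sum_mul, ← Finset.mul_sum, Finset.sum_const, nsmul_eq_mul] at h
  refine ⟨h.1, h.2.trans (Finset.sum_congr rfl fun i _ => ?_)⟩
  exact (nuclearBound_mul_rankOne_mul A B (e.orthonormal.1 i)).2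

end

/-! ### Power series with operator coefficients -/

section

section PowerSeriesBounds

/-- The coefficients of `Z` grow at most geometrically: `‖Zₙ‖ ≤ z Kⁿ`. -/
def GeomBound (Z : PowerSeries (H →L[ℂ] H)) (z K : ℝ) : Prop :=
  ∀ n, ‖PowerSeries.coeff n Z‖ ≤ z * K ^ n

namespace GeomBound

variable {Z W : PowerSeries (H →L[ℂ] H)} {z w K K' : ℝ}

lemma nonneg (h : GeomBound Z z K) : 0 ≤ z := by
  simpa using (norm_nonneg _).trans (h 0)

lemma mono (h : GeomBound Z z K) (hK : 0 ≤ K) (hzw : z ≤ w) (hKK : K ≤ K') :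
    GeomBound Z w K' := fun n =>
  (h n).trans (mul_le_mul hzw (pow_le_pow_left₀ hK hKK n) (by positivity) (h.nonneg.trans hzw))

lemma sum_antidiagonal_le (hK : 0 ≤ K) {c : ℝ} (hc : 0 ≤ c) (n : ℕ) :
    ∑ p ∈ Finset.HasAntidiagonal.antidiagonal n, c * (K ^ p.1 * K ^ p.2) ≤ c * (2 * K) ^ n := by
  have h1 : ∀ p ∈ Finset.HasAntidiagonal.antidiagonal n, c * (K ^ p.1 * K ^ p.2) = c * K ^ n := by
    intro p hp
    rw [← pow_add, Finset.HasAntidiagonal.mem_antidiagonal.1 hp]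
  rw [Finset.sum_congr rfl h1, Finset.sum_const, Finset.Nat.card_antidiagonal, nsmul_eq_mul,
    mul_pow, mul_left_comm]
  have h2 : ((n + 1 : ℕ) : ℝ) ≤ 2 ^ n := by exact_mod_cast Nat.lt_two_pow_self
  gcongr

lemma mul (hZ : GeomBound Z z K) (hW : GeomBound W w K) (hK : 0 ≤ K) :
    GeomBound (Z * W) (z * w) (2 * K) := by
  intro n
  rw [PowerSeries.coeff_mul]
  refine (norm_sum_le _ _).trans (le_trans (Finset.sum_le_sum fun p _ => ?_)
    (sum_antidiagonal_le hK (mul_nonneg hZ.nonneg hW.nonneg) n))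
  calc _ ≤ ‖PowerSeries.coeff p.1 Z‖ * ‖PowerSeries.coeff p.2 W‖ := norm_mul_le _ _
    _ ≤ (z * K ^ p.1) * (w * K ^ p.2) :=
      mul_le_mul (hZ _) (hW _) (norm_nonneg _) (mul_nonneg hZ.nonneg (by positivity))
    _ = _ := by ring

lemma one (hK : 0 ≤ K) : GeomBound (1 : PowerSeries (H →L[ℂ] H)) 1 K := by
  intro n
  rw [PowerSeries.coeff_one]
  split_ifs with h
  · subst h
    rw [pow_zero, mul_one]
    exact ContinuousLinearMap.norm_id_le
  · rw [norm_zero]; positivity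

lemma pow (hZ : GeomBound Z z K) (hK : 0 ≤ K) (k : ℕ) : GeomBound (Z ^ k) (z ^ k) (2 ^ k * K) := by
  induction k with
  | zero => simpa using one hK
  | succ k ih =>
    rw [pow_succ, pow_succ, pow_succ', mul_assoc]
    have h1 : (1 : ℝ) ≤ 2 ^ k := one_le_pow₀ one_le_two
    exact ih.mul (hZ.mono hK le_rfl (le_mul_of_one_le_left hK h1)) (by positivity)

end GeomBound

/-- Strong convergence of all coefficients. -/
def StrongTendsto {α : Type*} (l : Filter α) (Z : α → PowerSeries (H →L[ℂ] H))
    (Z₀ : PowerSeries (H →L[ℂ] H)) : Prop :=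
  ∀ n v, Tendsto (fun a => PowerSeries.coeff n (Z a) v) l (𝓝 (PowerSeries.coeff n Z₀ v))

/-- Products of uniformly bounded strongly convergent nets of operators converge. -/
lemma tendsto_apply_of_bounded {α : Type*} {l : Filter α} {A : α → H →L[ℂ] H} {A₀ : H →L[ℂ] H}
    {x : α → H} {x₀ : H} {c : ℝ} (hb : ∀ a, ‖A a‖ ≤ c)
    (hA : ∀ v, Tendsto (fun a => A a v) l (𝓝 (A₀ v))) (hx : Tendsto x l (𝓝 x₀)) :
    Tendsto (fun a => A a (x a)) l (𝓝 (A₀ x₀)) := by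
  have h1 : Tendsto (fun a => A a (x a - x₀)) l (𝓝 0) := by
    rw [tendsto_zero_iff_norm_tendsto_zero]
    have h2 : Tendsto (fun a => c * ‖x a - x₀‖) l (𝓝 0) := by
      simpa using ((hx.sub_const x₀).norm).const_mul c
    refine squeeze_zero (fun a => norm_nonneg _) (fun a => ?_) h2
    exact ((A a).le_opNorm _).trans (mul_le_mul_of_nonneg_right (hb a) (norm_nonneg _))
  simpa using h1.add (hA x₀)

namespace StrongTendsto

variable {α : Type*} {l : Filter α} {Z W : α → PowerSeries (H →L[ℂ] H)}
  {Z₀ W₀ : PowerSeries (H →L[ℂ] H)} {z K : ℝ}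

lemma mul (hZ : StrongTendsto l Z Z₀) (hW : StrongTendsto l W W₀)
    (hb : ∀ a, GeomBound (Z a) z K) : StrongTendsto l (fun a => Z a * W a) (Z₀ * W₀) := by
  intro n v
  simp only [PowerSeries.coeff_mul, sum_apply, mul_apply_eq_comp]
  exact tendsto_finsetSum _ fun p _ =>
    tendsto_apply_of_bounded (fun a => hb a p.1) (hZ p.1) (hW p.2 v)

lemma const (Z₀ : PowerSeries (H →L[ℂ] H)) : StrongTendsto l (fun _ => Z₀) Z₀ :=
  fun _ _ => tendsto_const_nhds

lemma pow (hZ : StrongTendsto l Z Z₀) (hb : ∀ a, GeomBound (Z a) z K) (k : ℕ) :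
    StrongTendsto l (fun a => Z a ^ k) (Z₀ ^ k) := by
  induction k with
  | zero => simpa using const 1
  | succ k ih =>
    simp only [pow_succ']
    exact hZ.mul ih hb

end StrongTendsto

/-- The noncommutative geometric sum. -/
lemma pow_sub_pow_eq_sum {A : Type*} [Ring A] (x y : A) (k : ℕ) :
    x ^ k - y ^ k = ∑ l ∈ Finset.range k, y ^ l * (x - y) * x ^ (k - 1 - l) := by
  induction k with
  | zero => simp
  | succ k ih =>
    rw [Finset.sum_range_succ']
    have : ∀ l ∈ Finset.range k, y ^ (l + 1) * (x - y) * x ^ (k + 1 - 1 - (l + 1))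
        = y * (y ^ l * (x - y) * x ^ (k - 1 - l)) := by
      intro l _
      rw [show k + 1 - 1 - (l + 1) = k - 1 - l by omega, pow_succ']
      noncomm_ring
    rw [Finset.sum_congr rfl this, ← Finset.mul_sum, ← ih]
    simp only [pow_succ', pow_zero, one_mul, Nat.add_sub_cancel, Nat.sub_zero]
    noncomm_ring

end PowerSeriesBounds

/-! ### Trace norm estimates by spectral cutoffs -/

section Cutoff

variable {ι : Type*} (e : HilbertBasis ι ℂ H)

/-- The spectral cutoff: the projection onto the span of the basis vectors of level below `j`. -/
def cutoff (L : ℕ → Finset ι) (j : ℕ) : H →L[ℂ] H := ∑ m ∈ Finset.range j, finProj e (L m)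

lemma finProj_mul_finProj_of_disjoint {s t : Finset ι} (h : Disjoint s t) :
    finProj e s * finProj e t = 0 := by
  classical
  ext v
  simp only [mul_apply_eq_comp, finProj_apply, inner_sum, inner_smul_right, zero_apply]
  refine Finset.sum_eq_zero fun i hi => ?_
  rw [Finset.sum_eq_zero, zero_smul]
  intro j hj
  have hij : i ≠ j := fun hij => Finset.disjoint_left.1 h hi (hij ▸ hj)
  rw [e.orthonormal.inner_eq_zero hij, mul_zero]

lemma finProj_mul_cutoff {L : ℕ → Finset ι} (hL : Pairwise fun i j => Disjoint (L i) (L j))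
    (j : ℕ) : finProj e (L j) * cutoff e L j = 0 := by
  rw [cutoff, Finset.mul_sum]
  refine Finset.sum_eq_zero fun m hm => finProj_mul_finProj_of_disjoint e (hL ?_)
  exact (Finset.mem_range.1 hm).ne'

variable {e} {A B Z X Y V : PowerSeries (H →L[ℂ] H)} {s : Finset ι} {a b x z K : ℝ}

lemma coeff_mul_C_mul (A B : PowerSeries (H →L[ℂ] H)) (Q : H →L[ℂ] H) (n : ℕ) :
    PowerSeries.coeff n (A * PowerSeries.C Q * B)
      = ∑ p ∈ Finset.HasAntidiagonal.antidiagonal n,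
        PowerSeries.coeff p.1 A * Q * PowerSeries.coeff p.2 B := by
  rw [PowerSeries.coeff_mul]
  exact Finset.sum_congr rfl fun p _ => by rw [PowerSeries.coeff_mul_C]

/-- A product with a finite rank projection in the middle is nuclear, with a bound that is
geometric in the order; the antidiagonal sum costs the factor `2 ^ n`. -/
lemma nuclearBound_coeff_mul_finProj_mul (hA : GeomBound A a K) (hB : GeomBound B b K)
    (hK : 0 ≤ K) (s : Finset ι) (n : ℕ) :
    NuclearBound (PowerSeries.coeff n (A * PowerSeries.C (finProj e s) * B))
      (s.card * (a * b) * (2 * K) ^ n) ∧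
    trace (PowerSeries.coeff n (A * PowerSeries.C (finProj e s) * B))
      = ∑ p ∈ Finset.HasAntidiagonal.antidiagonal n, ∑ i ∈ s,
        inner ℂ (e i) (PowerSeries.coeff p.2 B (PowerSeries.coeff p.1 A (e i))) := by
  rw [coeff_mul_C_mul]
  have h := NuclearBound.sum (Finset.HasAntidiagonal.antidiagonal n) fun p _ =>
    (nuclearBound_mul_finProj_mul e s (PowerSeries.coeff p.1 A) (PowerSeries.coeff p.2 B)).1
  refine ⟨h.1.mono ?_, h.2.trans (Finset.sum_congr rfl fun p _ =>
    (nuclearBound_mul_finProj_mul e s _ _).2)⟩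
  have ha := hA.nonneg
  have hb := hB.nonneg
  refine le_trans (Finset.sum_le_sum fun p _ => ?_)
    (GeomBound.sum_antidiagonal_le hK (c := s.card * (a * b)) (by positivity) n)
  calc _ ≤ s.card * ((a * K ^ p.1) * (b * K ^ p.2)) := by
        gcongr
        · exact hA _
        · exact hB _
    _ = _ := by ring

/-- The trace of the `n`-th coefficient of `Z (X ^ k - Y ^ k)` when `X - Y = Q X` with `Q` the
projection onto the span of the `eᵢ`, `i ∈ s`. -/
def telescopeTrace (e : HilbertBasis ι ℂ H) (s : Finset ι) (Z X Y : PowerSeries (H →L[ℂ] H))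
    (k n : ℕ) : ℂ :=
  ∑ l ∈ Finset.range k, ∑ p ∈ Finset.HasAntidiagonal.antidiagonal n, ∑ i ∈ s,
    inner ℂ (e i) (PowerSeries.coeff p.2 (X ^ (k - l)) (PowerSeries.coeff p.1 (Z * Y ^ l) (e i)))

/-- The difference `X ^ k - Y ^ k` telescopes into products that contain the factor `X - Y`, whose
rank is at most the number of elements of `s`. -/
lemma nuclearBound_telescope (hZ : GeomBound Z z K) (hX : GeomBound X x K) (hY : GeomBound Y x K)
    (hK : 0 ≤ K) (hXY : X - Y = PowerSeries.C (finProj e s) * X) (k n : ℕ) :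
    NuclearBound (PowerSeries.coeff n (Z * (X ^ k - Y ^ k)))
      (k * s.card * (z * x ^ k) * (2 ^ (k + 2) * K) ^ n) ∧
    trace (PowerSeries.coeff n (Z * (X ^ k - Y ^ k))) = telescopeTrace e s Z X Y k n := by
  have hexp : Z * (X ^ k - Y ^ k) = ∑ l ∈ Finset.range k,
      (Z * Y ^ l) * PowerSeries.C (finProj e s) * X ^ (k - l) := by
    rw [pow_sub_pow_eq_sum, Finset.mul_sum]
    refine Finset.sum_congr rfl fun l hl => ?_
    have hl' := Finset.mem_range.1 hl
    rw [show k - l = (k - 1 - l) + 1 by omega, pow_succ', hXY]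
    noncomm_ring
  have hz := hZ.nonneg
  have hx := hX.nonneg
  have hterm : ∀ l ∈ Finset.range k,
      NuclearBound (PowerSeries.coeff n ((Z * Y ^ l) * PowerSeries.C (finProj e s) * X ^ (k - l)))
        (s.card * (z * x ^ k) * (2 ^ (k + 2) * K) ^ n) ∧
      trace (PowerSeries.coeff n ((Z * Y ^ l) * PowerSeries.C (finProj e s) * X ^ (k - l)))
        = ∑ p ∈ Finset.HasAntidiagonal.antidiagonal n, ∑ i ∈ s, inner ℂ (e i)
          (PowerSeries.coeff p.2 (X ^ (k - l)) (PowerSeries.coeff p.1 (Z * Y ^ l) (e i))) := by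
    intro l hl
    have hl' := Finset.mem_range.1 hl
    have hp : ∀ m ≤ k, (2 : ℝ) ^ m * K ≤ 2 ^ k * K := fun m hm => by gcongr; norm_num
    have h1 : (1 : ℝ) ≤ 2 ^ k := one_le_pow₀ one_le_two
    have hA : GeomBound (Z * Y ^ l) (z * x ^ l) (2 ^ (k + 1) * K) := by
      rw [pow_succ', mul_assoc]
      exact (hZ.mono hK le_rfl (le_mul_of_one_le_left hK h1)).mul
        ((hY.pow hK l).mono (by positivity) le_rfl (hp l hl'.le)) (by positivity)
    have hB : GeomBound (X ^ (k - l)) (x ^ (k - l)) (2 ^ (k + 1) * K) := by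
      refine (hX.pow hK _).mono (by positivity) le_rfl ?_
      gcongr
      · norm_num
      · omega
    have h := nuclearBound_coeff_mul_finProj_mul (e := e) hA hB (by positivity) s n
    refine ⟨h.1.mono (le_of_eq ?_), h.2⟩
    have : x ^ k = x ^ l * x ^ (k - l) := by rw [← pow_add, Nat.add_sub_cancel' hl'.le]
    rw [this]
    ring
  have h := NuclearBound.sum (Finset.range k) fun l hl => (hterm l hl).1
  rw [hexp, map_sum]
  refine ⟨h.1.mono (le_of_eq ?_), h.2.trans (Finset.sum_congr rfl fun l hl => (hterm l hl).2)⟩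
  rw [Finset.sum_const, Finset.card_range, nsmul_eq_mul]
  ring

/-- Decay of `V` beyond the spectral cutoffs, uniformly geometric in the coefficients. -/
def CutoffDecay (e : HilbertBasis ι ℂ H) (L : ℕ → Finset ι) (V : PowerSeries (H →L[ℂ] H))
    (b r K : ℝ) : Prop :=
  ∀ j, GeomBound (PowerSeries.C (1 - cutoff e L j) * V) (b * r ^ j) K

variable {L : ℕ → Finset ι} {r : ℝ} {k : ℕ}

lemma cutoff_sub (hL : Pairwise fun i j => Disjoint (L i) (L j)) (j : ℕ) :
    PowerSeries.C (1 - cutoff e L j) * V - PowerSeries.C (1 - cutoff e L (j + 1)) * V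
      = PowerSeries.C (finProj e (L j)) * (PowerSeries.C (1 - cutoff e L j) * V) := by
  rw [← sub_mul, ← mul_assoc, ← map_sub, ← map_mul]
  congr 2
  rw [mul_sub, mul_one, finProj_mul_cutoff e hL, cutoff, cutoff, Finset.sum_range_succ]
  abel

/-- The trace of the `j`-th layer of `Z V ^ k` in its decomposition along the spectral cutoffs. -/
def layerTrace (e : HilbertBasis ι ℂ H) (L : ℕ → Finset ι) (Z V : PowerSeries (H →L[ℂ] H))
    (k n j : ℕ) : ℂ :=
  telescopeTrace e (L j) Z (PowerSeries.C (1 - cutoff e L j) * V)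
    (PowerSeries.C (1 - cutoff e L (j + 1)) * V) k n

/-- The layer between two consecutive cutoffs: the rank of the level times the `k`-th power of the
decay. -/
lemma nuclearBound_layer (hL : Pairwise fun i j => Disjoint (L i) (L j)) (hK : 0 ≤ K)
    (hr : 0 ≤ r) (hr1 : r < 1) (hZ : GeomBound Z z K) (hV : CutoffDecay e L V b r K) (n j : ℕ) :
    NuclearBound (PowerSeries.coeff n (Z * ((PowerSeries.C (1 - cutoff e L j) * V) ^ k
      - (PowerSeries.C (1 - cutoff e L (j + 1)) * V) ^ k)))
      (k * z * b ^ k * (2 ^ (k + 2) * K) ^ n * ((L j).card * r ^ (j * k))) ∧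
    trace (PowerSeries.coeff n (Z * ((PowerSeries.C (1 - cutoff e L j) * V) ^ k
      - (PowerSeries.C (1 - cutoff e L (j + 1)) * V) ^ k))) = layerTrace e L Z V k n j := by
  have hb : 0 ≤ b := by simpa using (hV 0).nonneg
  have hY := (hV (j + 1)).mono hK (w := b * r ^ j) (by
    rw [pow_succ]
    exact mul_le_mul_of_nonneg_left (mul_le_of_le_one_right (by positivity) hr1.le) hb) le_rfl
  have h := nuclearBound_telescope hZ (hV j) hY hK (cutoff_sub hL j) k n
  refine ⟨h.1.mono (le_of_eq ?_), h.2⟩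
  rw [mul_pow b, ← pow_mul]
  ring

/-- If `V` decays like `r ^ j` beyond the `j`-th cutoff and `∑ⱼ |Lⱼ| r ^ (j k)` converges, then the
coefficients of `Z V ^ k` are nuclear: a Hölder inequality without Schatten classes. -/
lemma nuclearBound_mul_pow (hL : Pairwise fun i j => Disjoint (L i) (L j)) (hK : 0 ≤ K)
    (hr : 0 ≤ r) (hr1 : r < 1) (hk : k ≠ 0) (hsum : Summable fun j => (L j).card * r ^ (j * k))
    (hZ : GeomBound Z z K) (hV : CutoffDecay e L V b r K) (n : ℕ) :
    NuclearBound (PowerSeries.coeff n (Z * V ^ k))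
      (k * z * b ^ k * (∑' j, (L j).card * r ^ (j * k)) * (2 ^ (k + 2) * K) ^ n) ∧
    HasSum (fun j => layerTrace e L Z V k n j) (trace (PowerSeries.coeff n (Z * V ^ k))) := by
  set X : ℕ → PowerSeries (H →L[ℂ] H) := fun j => PowerSeries.C (1 - cutoff e L j) * V with hX
  set S : ℕ → H →L[ℂ] H := fun j => PowerSeries.coeff n (Z * (X j ^ k - X (j + 1) ^ k)) with hS
  have hlayer := fun j => nuclearBound_layer (k := k) hL hK hr hr1 hZ hV n j
  have hsum' : Summable fun j => k * z * b ^ k * (2 ^ (k + 2) * K) ^ n *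
      ((L j).card * r ^ (j * k)) := hsum.mul_left _
  have hSs : Summable S := Summable.of_norm_bounded hsum' fun j => (hlayer j).1.norm_le
  -- the layers telescope, from `V = (1 - P₀) V` on; the remainder tends to zero in operator norm
  have hpart : ∀ N, ∑ j ∈ Finset.range N, S j
      = PowerSeries.coeff n (Z * V ^ k) - PowerSeries.coeff n (Z * X N ^ k) := by
    intro N
    have h0 : X 0 = V := by simp [hX, cutoff]
    simp only [hS, mul_sub, map_sub]
    rw [Finset.sum_range_sub' (fun j => PowerSeries.coeff n (Z * X j ^ k)) N, h0]
  have hlim : Tendsto (fun N => PowerSeries.coeff n (Z * X N ^ k)) atTop (𝓝 0) := by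
    have hb : 0 ≤ b := by simpa using (hV 0).nonneg
    have h1 : (1 : ℝ) ≤ 2 ^ k := one_le_pow₀ one_le_two
    have hbd : ∀ N, ‖PowerSeries.coeff n (Z * X N ^ k)‖
        ≤ (z * b ^ k * (2 * (2 ^ k * K)) ^ n) * (r ^ k) ^ N := by
      intro N
      refine (((hZ.mono hK le_rfl (le_mul_of_one_le_left hK h1)).mul ((hV N).pow hK k)
        (by positivity)) n).trans (le_of_eq ?_)
      rw [mul_pow b, ← pow_mul, ← pow_mul, mul_comm N k]
      ring
    refine squeeze_zero_norm hbd ?_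
    have := tendsto_pow_atTop_nhds_zero_of_lt_one (pow_nonneg hr k) (pow_lt_one₀ hr hr1 hk)
    simpa using this.const_mul (z * b ^ k * (2 * (2 ^ k * K)) ^ n)
  have hST : HasSum S (PowerSeries.coeff n (Z * V ^ k)) := by
    have h1 := hSs.hasSum.tendsto_sum_nat
    simp_rw [hpart] at h1
    have h2 := hlim.const_sub (PowerSeries.coeff n (Z * V ^ k))
    rw [sub_zero] at h2
    rw [← tendsto_nhds_unique h1 h2]
    exact hSs.hasSum
  have h := nuclearBound_of_hasSum (T := PowerSeries.coeff n (Z * V ^ k)) (S := S)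
    (fun j => (hlayer j).1) hsum' fun v => hST.mapL (ContinuousLinearMap.apply ℂ H v)
  refine ⟨h.1.mono (le_of_eq ?_), ?_⟩
  · rw [tsum_mul_left]
    ring
  · have h2 : (fun j => trace (S j)) = fun j => layerTrace e L Z V k n j :=
      funext fun j => (hlayer j).2
    rw [← h2]
    exact h.2

/-- The traces of the coefficients of `Z V ^ k` are continuous under strong convergence with
uniform bounds, by dominated convergence over the layers. -/
lemma tendsto_trace_mul_pow {α : Type*} {F : Filter α} {Zf Vf : α → PowerSeries (H →L[ℂ] H)}
    (hL : Pairwise fun i j => Disjoint (L i) (L j)) (hK : 0 ≤ K)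
    (hr : 0 ≤ r) (hr1 : r < 1) (hk : k ≠ 0) (hsum : Summable fun j => (L j).card * r ^ (j * k))
    (hZ : GeomBound Z z K) (hV : CutoffDecay e L V b r K)
    (hZf : ∀ a, GeomBound (Zf a) z K) (hVf : ∀ a, CutoffDecay e L (Vf a) b r K)
    (hZl : StrongTendsto F Zf Z) (hVl : StrongTendsto F Vf V) (n : ℕ) :
    Tendsto (fun a => trace (PowerSeries.coeff n (Zf a * Vf a ^ k))) F
      (𝓝 (trace (PowerSeries.coeff n (Z * V ^ k)))) := by
  rw [← (nuclearBound_mul_pow hL hK hr hr1 hk hsum hZ hV n).2.tsum_eq]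
  have heq : ∀ a, trace (PowerSeries.coeff n (Zf a * Vf a ^ k))
      = ∑' j, layerTrace e L (Zf a) (Vf a) k n j := fun a =>
    (nuclearBound_mul_pow hL hK hr hr1 hk hsum (hZf a) (hVf a) n).2.tsum_eq.symm
  simp_rw [heq]
  refine tendsto_tsum_of_dominated_convergence
    (bound := fun j => k * z * b ^ k * (2 ^ (k + 2) * K) ^ n * ((L j).card * r ^ (j * k)))
    (hsum.mul_left _) (fun j => ?_) (Eventually.of_forall fun a j => ?_)
  · have hX : ∀ m, StrongTendsto F (fun a => PowerSeries.C (1 - cutoff e L m) * Vf a)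
        (PowerSeries.C (1 - cutoff e L m) * V) := by
      intro m n v
      simp only [PowerSeries.coeff_C_mul, mul_apply_eq_comp]
      exact ((1 - cutoff e L m).continuous.tendsto _).comp (hVl n v)
    simp only [layerTrace, telescopeTrace]
    refine tendsto_finsetSum _ fun l _ => tendsto_finsetSum _ fun p _ =>
      tendsto_finsetSum _ fun i _ => ?_
    refine Tendsto.inner tendsto_const_nhds ?_
    have h1 := (hX j).pow (fun a => hVf a j) (k - l)
    have h2 := hZl.mul ((hX (j + 1)).pow (fun a => hVf a (j + 1)) l) hZf
    exact tendsto_apply_of_bounded (fun a => ((hVf a j).pow hK (k - l)) p.2) (h1 p.2)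
      (h2 p.1 (e i))
  · rw [← (nuclearBound_layer hL hK hr hr1 (hZf a) (hVf a) n j).2]
    exact (nuclearBound_layer hL hK hr hr1 (hZf a) (hVf a) n j).1.norm_trace_le

end Cutoff

end

/-! ### Integrable Fourier transforms -/

section

section Fourier

open scoped FourierTransform SchwartzMap

lemma continuous_fourierKernel (x : ℝ) :
    Continuous fun ξ : ℝ => Complex.exp (Complex.I * ξ * x) := by fun_prop

lemma norm_fourierKernel (ξ x : ℝ) : ‖Complex.exp (Complex.I * ξ * x)‖ = 1 := by
  rw [mul_assoc, ← Complex.ofReal_mul, mul_comm, Complex.norm_exp_ofReal_mul_I]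

lemma integrable_mul_fourierKernel {φ : ℝ → ℂ} (hφ : Integrable φ) (x : ℝ) :
    Integrable fun ξ : ℝ => φ ξ * Complex.exp (Complex.I * ξ * x) := by
  refine hφ.mono (hφ.1.mul (continuous_fourierKernel x).aestronglyMeasurable)
    (Eventually.of_forall fun ξ => ?_)
  rw [norm_mul, norm_fourierKernel, mul_one]

/-- An integrable function with vanishing Fourier transform vanishes almost everywhere. -/
lemma ae_eq_zero_of_fourier_eq_zero {χ : ℝ → ℂ} (hχ : Integrable χ)
    (h0 : ∀ x : ℝ, ∫ ξ : ℝ, χ ξ * Complex.exp (Complex.I * ξ * x) = 0) : χ =ᵐ[volume] 0 := by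
  have hF : ∀ x, 𝓕 χ x = 0 := by
    intro x
    rw [Real.fourier_real_eq_integral_exp_smul, ← h0 (-2 * Real.pi * x)]
    refine integral_congr_ae (Eventually.of_forall fun ξ => ?_)
    simp only [smul_eq_mul]
    rw [mul_comm]
    congr 2
    push_cast
    ring
  refine ae_eq_zero_of_integral_contDiff_smul_eq_zero hχ.locallyIntegrable fun g hg hgs => ?_
  have hgs' : HasCompactSupport fun x => (g x : ℂ) := hgs.comp_left Complex.ofReal_zero
  have hg' : ContDiff ℝ ∞ fun x => (g x : ℂ) := Complex.ofRealCLM.contDiff.comp hg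
  set k : 𝓢(ℝ, ℂ) := hgs'.toSchwartzMap hg' with hk
  set k' : 𝓢(ℝ, ℂ) := 𝓕⁻ k with hk'
  have hkF : 𝓕 k' = k := FourierTransform.fourier_fourierInv_eq k
  have hval : ∀ x, (g x : ℂ) = 𝓕 (⇑k') x := by
    intro x
    rw [← SchwartzMap.fourier_coe, hkF]
    rfl
  have hflip := VectorFourier.integral_fourierIntegral_smul_eq_flip (μ := volume) (ν := volume)
    (L := innerₗ ℝ) (f := ⇑k') (g := χ) Real.continuous_fourierChar continuous_inner
    k'.integrable hχ
  calc ∫ x, g x • χ x = ∫ x, 𝓕 (⇑k') x • χ x := by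
        refine integral_congr_ae (Eventually.of_forall fun x => ?_)
        simp only
        rw [← hval, Complex.coe_smul]
    _ = ∫ x, k' x • 𝓕 χ x := by
        rw [flip_innerₗ] at hflip
        exact hflip
    _ = 0 := by simp [hF]

lemma HasIntegrableFourier.ae_unique {g φ ψ : ℝ → ℂ} (hφ : HasIntegrableFourier g φ)
    (hψ : HasIntegrableFourier g ψ) : φ =ᵐ[volume] ψ := by
  have h := ae_eq_zero_of_fourier_eq_zero (hφ.1.sub hψ.1) fun x => by
    simp only [Pi.sub_apply, sub_mul]
    rw [integral_sub (integrable_mul_fourierKernel hφ.1 x) (integrable_mul_fourierKernel hψ.1 x),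
      ← hφ.2, ← hψ.2, sub_self]
  filter_upwards [h] with ξ hξ
  simpa [sub_eq_zero] using hξ

/-- The Fourier transform of a derivative. The difference `g(x + 1) - g(x)` is expressed both
through `g` and through `g'`; the kernel `∫₀¹ exp (i τ ξ) dτ` that appears vanishes only on a null
set. -/
lemma HasIntegrableFourier.deriv_ae {g φ ψ : ℝ → ℂ} (hg : ContDiff ℝ 1 g)
    (hφ : HasIntegrableFourier g φ) (hψ : HasIntegrableFourier (deriv g) ψ) :
    ψ =ᵐ[volume] fun ξ => Complex.I * ξ * φ ξ := by
  set k : ℝ → ℂ := fun ξ => ∫ τ in (0 : ℝ)..1, Complex.exp (Complex.I * ξ * τ) with hk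
  have hkc : Continuous k :=
    intervalIntegral.continuous_parametric_intervalIntegral_of_continuous' (by fun_prop) 0 1
  have hkn : ∀ ξ, ‖k ξ‖ ≤ 1 := by
    intro ξ
    have := intervalIntegral.norm_integral_le_of_norm_le_const (a := 0) (b := 1) (C := 1)
      (f := fun τ : ℝ => Complex.exp (Complex.I * ξ * τ)) fun τ _ => (norm_fourierKernel ξ τ).le
    simpa using this
  have hkm : ∀ ξ : ℝ, Complex.I * ξ * k ξ = Complex.exp (Complex.I * ξ) - 1 := by
    intro ξ
    by_cases hξ : ξ = 0
    · simp [hξ]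
    · have h0 : Complex.I * (ξ : ℂ) ≠ 0 :=
        mul_ne_zero Complex.I_ne_zero (Complex.ofReal_ne_zero.2 hξ)
      simp only [hk]
      rw [integral_exp_mul_complex h0]
      simp only [Complex.ofReal_one, mul_one, Complex.ofReal_zero, mul_zero, Complex.exp_zero]
      rw [mul_div_cancel₀ _ h0]
  have hψk : Integrable fun ξ => ψ ξ * k ξ := by
    refine hψ.1.mono (hψ.1.1.mul hkc.aestronglyMeasurable) (Eventually.of_forall fun ξ => ?_)
    rw [norm_mul]
    exact mul_le_of_le_one_right (norm_nonneg _) (hkn ξ)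
  have hφk : Integrable fun ξ : ℝ => φ ξ * (Complex.exp (Complex.I * ξ) - 1) := by
    have := (integrable_mul_fourierKernel hφ.1 1).sub hφ.1
    refine this.congr (Eventually.of_forall fun ξ => ?_)
    simp only [Pi.sub_apply, Complex.ofReal_one, mul_one]
    ring
  -- the difference `g(x + 1) - g(x)` through the transform of `g`
  have h1 : HasIntegrableFourier (fun x => g (x + 1) - g x)
      fun ξ : ℝ => φ ξ * (Complex.exp (Complex.I * ξ) - 1) := by
    refine ⟨hφk, fun x => ?_⟩
    beta_reduce
    rw [hφ.2, hφ.2, ← integral_sub (integrable_mul_fourierKernel hφ.1 _)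
      (integrable_mul_fourierKernel hφ.1 _)]
    refine integral_congr_ae (Eventually.of_forall fun ξ => ?_)
    simp only
    push_cast
    rw [mul_add, Complex.exp_add, mul_one]
    ring
  -- the same difference as the integral of `deriv g` over `[x, x + 1]`, through the transform of
  -- the derivative
  have h2 : HasIntegrableFourier (fun x => g (x + 1) - g x) fun ξ => ψ ξ * k ξ := by
    refine ⟨hψk, fun x => ?_⟩
    have hftc : ∫ τ in (0 : ℝ)..1, deriv g (x + τ) = g (x + 1) - g x := by
      rw [intervalIntegral.integral_comp_add_left (fun y => deriv g y) x, add_zero]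
      exact intervalIntegral.integral_deriv_eq_sub
        (fun y _ => (hg.differentiable one_ne_zero) y)
        ((hg.continuous_deriv le_rfl).intervalIntegrable _ _)
    beta_reduce
    rw [← hftc, intervalIntegral.integral_of_le zero_le_one]
    simp_rw [hψ.2]
    rw [integral_integral_swap]
    · refine integral_congr_ae (Eventually.of_forall fun ξ => ?_)
      simp only [hk]
      rw [intervalIntegral.integral_of_le zero_le_one, ← integral_const_mul, ← integral_mul_const]
      refine integral_congr_ae (Eventually.of_forall fun τ => ?_)
      simp only
      push_cast
      rw [mul_add, Complex.exp_add]
      ring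
    · have hfin : Integrable (fun _ : ℝ => (1 : ℂ)) (volume.restrict (Set.Ioc (0 : ℝ) 1)) :=
        integrable_const _
      refine (hfin.mul_prod hψ.1).mono ?_ (Eventually.of_forall fun p => ?_)
      · refine AEStronglyMeasurable.mul hψ.1.1.comp_snd ?_
        exact (by fun_prop : Continuous fun p : ℝ × ℝ =>
          Complex.exp (Complex.I * (p.2 : ℂ) * ((x + p.1 : ℝ) : ℂ))).aestronglyMeasurable
      · simp only [Function.uncurry, norm_mul, norm_fourierKernel]
        simp
  have hae := h1.ae_unique h2
  have hnull : ∀ᵐ ξ : ℝ, Complex.exp (Complex.I * ξ) ≠ 1 := by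
    have hc : Set.Countable {ξ : ℝ | Complex.exp (Complex.I * ξ) = 1} := by
      refine (Set.countable_range fun n : ℤ => (n : ℝ) * (2 * Real.pi)).mono fun ξ hξ => ?_
      obtain ⟨n, hn⟩ := Complex.exp_eq_one_iff.1 hξ
      refine ⟨n, ?_⟩
      have h3 : (ξ : ℂ) = n * (2 * Real.pi) := by
        have h4 : Complex.I * ((ξ : ℂ) - n * (2 * Real.pi)) = 0 := by
          rw [mul_sub, hn]; ring
        simpa [Complex.I_ne_zero, sub_eq_zero] using h4
      exact_mod_cast h3.symm
    exact measure_eq_zero_iff_ae_notMem.1 (hc.measure_zero volume)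
  filter_upwards [hae, hnull] with ξ h3 h4
  have hk0 : k ξ ≠ 0 := by
    intro h5
    apply h4
    have := hkm ξ
    rw [h5, mul_zero] at this
    exact (sub_eq_zero.1 this.symm)
  rw [← hkm] at h3
  apply mul_right_cancel₀ hk0
  rw [← h3]
  ring

lemma HasIntegrableFourier.iteratedDeriv_ae {g φ : ℝ → ℂ} (hg : ContDiff ℝ ∞ g)
    (hφ : HasIntegrableFourier g φ)
    (hex : ∀ n : ℕ, ∃ ψ, HasIntegrableFourier (iteratedDeriv n g) ψ) (n : ℕ) {ψ : ℝ → ℂ}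
    (hψ : HasIntegrableFourier (iteratedDeriv n g) ψ) :
    ψ =ᵐ[volume] fun ξ => (Complex.I * ξ) ^ n * φ ξ := by
  induction n generalizing ψ with
  | zero =>
    rw [iteratedDeriv_zero] at hψ
    simpa using hψ.ae_unique hφ
  | succ n ih =>
    obtain ⟨χ, hχ⟩ := hex n
    rw [iteratedDeriv_succ] at hψ
    have h1 := hχ.deriv_ae (by
      rw [iteratedDeriv_eq_iterate]
      exact (hg.iterate_deriv n).of_le (by simp)) hψ
    filter_upwards [h1, ih hχ] with ξ h2 h3
    rw [h2, h3]
    ring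

/-- Factorial bounds on the derivatives give an exponential moment of the Fourier transform. -/
lemma HasIntegrableFourier.expIntegrable {g φ : ℝ → ℂ} (hg : ContDiff ℝ ∞ g)
    (hφ : HasIntegrableFourier g φ) {C ρ : ℝ} (hC : 0 < C) (hρ : 0 < ρ) (hρC : ρ * C < 1)
    (hb : ∀ n : ℕ, ∃ ψ, HasIntegrableFourier (iteratedDeriv n g) ψ ∧
      ∫ ξ, ‖ψ ξ‖ ≤ C ^ (n + 1) * (n.factorial : ℝ)) : ExpIntegrable ρ φ := by
  -- the bounds on the derivatives are bounds on the absolute moments of `φ`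
  have hmom : ∀ n : ℕ, Integrable (fun ξ : ℝ => |ξ| ^ n * ‖φ ξ‖) ∧
      ∫ ξ : ℝ, |ξ| ^ n * ‖φ ξ‖ ≤ C ^ (n + 1) * (n.factorial : ℝ) := by
    intro n
    obtain ⟨ψ, hψ, hle⟩ := hb n
    have hae := hφ.iteratedDeriv_ae hg (fun n => (hb n).imp fun _ h => h.1) n hψ
    have hae' : (fun ξ => ‖ψ ξ‖) =ᵐ[volume] fun ξ : ℝ => |ξ| ^ n * ‖φ ξ‖ := by
      filter_upwards [hae] with ξ hξ
      rw [hξ, norm_mul, norm_pow, norm_mul, Complex.norm_I, one_mul, Complex.norm_real,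
        Real.norm_eq_abs]
    exact ⟨hψ.1.norm.congr hae', (integral_congr_ae hae').symm.le.trans hle⟩
  refine ExpIntegrable.of_norm hφ.1.1 ⟨?_, ?_⟩
  · exact (by fun_prop : Continuous fun ξ : ℝ => Real.exp (ρ * |ξ|)).aestronglyMeasurable.mul
      hφ.1.1.norm
  · set F : ℕ → ℝ → ℝ := fun n ξ => ρ ^ n / n.factorial * (|ξ| ^ n * ‖φ ξ‖) with hF
    have hF0 : ∀ n ξ, 0 ≤ F n ξ := fun n ξ => by positivity
    have hFs : ∀ ξ, HasSum (fun n => F n ξ) (Real.exp (ρ * |ξ|) * ‖φ ξ‖) := by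
      intro ξ
      have := (NormedSpace.expSeries_div_hasSum_exp (ρ * |ξ|)).mul_right ‖φ ξ‖
      rw [← Real.exp_eq_exp_ℝ] at this
      have hfun : (fun n => F n ξ) = fun n => (ρ * |ξ|) ^ n / n.factorial * ‖φ ξ‖ := by
        funext n
        simp only [hF, mul_pow]
        ring
      rw [hfun]
      exact this
    have hgeo : Summable fun n : ℕ => C * (ρ * C) ^ n :=
      (summable_geometric_of_lt_one (by positivity) hρC).mul_left C
    -- the exponential series against the moments is dominated by a geometric series of ratio `ρ C
    -- < 1`
    rw [hasFiniteIntegral_iff_norm]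
    calc ∫⁻ ξ, ENNReal.ofReal ‖Real.exp (ρ * |ξ|) * ‖φ ξ‖‖
        = ∫⁻ ξ, ∑' n, ENNReal.ofReal (F n ξ) := by
          refine lintegral_congr fun ξ => ?_
          rw [Real.norm_of_nonneg (by positivity), ← (hFs ξ).tsum_eq,
            ENNReal.ofReal_tsum_of_nonneg (fun n => hF0 n ξ) (hFs ξ).summable]
      _ = ∑' n, ∫⁻ ξ, ENNReal.ofReal (F n ξ) :=
          lintegral_tsum fun n => (((hmom n).1.const_mul _).1.aemeasurable).ennreal_ofReal
      _ ≤ ∑' n : ℕ, ENNReal.ofReal (C * (ρ * C) ^ n) := by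
          refine ENNReal.tsum_le_tsum fun n => ?_
          rw [← ofReal_integral_eq_lintegral_ofReal ((hmom n).1.const_mul _)
            (Eventually.of_forall fun ξ => hF0 n ξ)]
          refine ENNReal.ofReal_le_ofReal ?_
          rw [integral_const_mul]
          have hf : (0 : ℝ) < n.factorial := by positivity
          calc _ ≤ ρ ^ n / n.factorial * (C ^ (n + 1) * (n.factorial : ℝ)) := by
                gcongr
                exact (hmom n).2
            _ = _ := by
                field_simp
                ring
      _ < ⊤ := by
          rw [← ENNReal.ofReal_tsum_of_nonneg (fun n => by positivity) hgeo]
          exact ENNReal.ofReal_lt_top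

end Fourier

end

/-! ### Powers of `x - i` and the Gamma kernel -/

section

section GammaKernel

/-- The density `ξ ^ (a - 1) exp (-ξ)` of Euler's integral. -/
def gammaDensity (a ξ : ℝ) : ℝ := ξ ^ (a - 1) * Real.exp (-ξ)

/-- The function on the negative half line whose Fourier transform is `Γ(a) (1 + i x) ^ (-a)`. -/
def gammaKernel (a ξ : ℝ) : ℂ := if ξ < 0 then (gammaDensity a (-ξ) : ℂ) else 0

lemma integral_gammaKernel_smul {E : Type*} [NormedAddCommGroup E] [NormedSpace ℂ E] (a : ℝ)
    (G : ℝ → E) :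
    ∫ ξ, gammaKernel a ξ • G ξ = ∫ ξ in Set.Ioi (0 : ℝ), (gammaDensity a ξ : ℂ) • G (-ξ) := by
  rw [← integral_neg_eq_self, ← integral_indicator measurableSet_Ioi]
  refine integral_congr_ae (Eventually.of_forall fun ξ => ?_)
  by_cases h : 0 < ξ
  · simp [gammaKernel, h]
  · simp [gammaKernel, h]

lemma integrableOn_rpow_mul_exp {a c : ℝ} (ha : -1 < a) (hc : 0 < c) :
    IntegrableOn (fun ξ : ℝ => ξ ^ a * Real.exp (-c * ξ)) (Set.Ioi 0) := by
  simpa using integrableOn_rpow_mul_exp_neg_mul_rpow ha one_pos hc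

lemma integrableOn_gammaDensity {a : ℝ} (ha : 0 < a) :
    IntegrableOn (gammaDensity a) (Set.Ioi 0) := by
  have := integrableOn_rpow_mul_exp (a := a - 1) (by linarith) one_pos
  simp only [neg_mul, one_mul] at this
  exact this

lemma measurable_gammaKernel (a : ℝ) : Measurable (gammaKernel a) := by
  unfold gammaKernel gammaDensity
  refine Measurable.ite measurableSet_Iio ?_ measurable_const
  fun_prop

lemma expIntegrable_gammaKernel {a ρ : ℝ} (ha : 0 < a) (hρ : ρ < 1) :
    ExpIntegrable ρ (gammaKernel a) := by
  refine ExpIntegrable.of_norm (measurable_gammaKernel a).aestronglyMeasurable ?_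
  have h := (integrable_indicator_iff measurableSet_Ioi).2
    (integrableOn_rpow_mul_exp (a := a - 1) (c := 1 - ρ) (by linarith) (by linarith))
  refine h.comp_neg.congr (Eventually.of_forall fun ξ => ?_)
  by_cases hξ : ξ < 0
  · have h0 : 0 < -ξ := by linarith
    simp only [gammaKernel, hξ, if_true, Set.indicator, Set.mem_Ioi, h0]
    rw [Complex.norm_real, Real.norm_of_nonneg (by unfold gammaDensity; positivity), gammaDensity,
      abs_of_neg hξ, mul_left_comm, ← Real.exp_add]
    congr 2
    ring
  · simp [gammaKernel, hξ]

lemma hasDerivAt_cpow_mul_exp (b : ℝ) (z : ℂ) {ξ : ℝ} (hξ : 0 < ξ) :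
    HasDerivAt (fun ξ : ℝ => ((ξ ^ b : ℝ) : ℂ) * Complex.exp (-(z * ξ)))
      (b * ((ξ ^ (b - 1) : ℝ) : ℂ) * Complex.exp (-(z * ξ))
        - z * (((ξ ^ b : ℝ) : ℂ) * Complex.exp (-(z * ξ)))) ξ := by
  have h1 : HasDerivAt (fun ξ : ℝ => ((ξ ^ b : ℝ) : ℂ)) ((b * ξ ^ (b - 1) : ℝ) : ℂ) ξ :=
    (Real.hasDerivAt_rpow_const (Or.inl hξ.ne')).ofReal_comp
  have h2 : HasDerivAt (fun ξ : ℝ => Complex.exp (-(z * ξ))) (Complex.exp (-(z * ξ)) * -(z * 1)) ξ :=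
    ((((hasDerivAt_id (ξ : ℂ)).const_mul z).neg).cexp).comp_ofReal
  refine (h1.mul h2).congr_deriv ?_
  push_cast
  ring

lemma norm_exp_neg_mul (x ξ : ℝ) : ‖Complex.exp (-((1 + Complex.I * x) * ξ))‖ = Real.exp (-ξ) := by
  rw [Complex.norm_exp]
  congr 1
  simp

/-- The integrand of Euler's integral along a ray, for `z = 1 + i x`. -/
lemma integrableOn_rpow_mul_cexp {b : ℝ} (hb : -1 < b) (x : ℝ) :
    IntegrableOn (fun ξ : ℝ => ((ξ ^ b : ℝ) : ℂ) * Complex.exp (-((1 + Complex.I * x) * ξ)))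
      (Set.Ioi 0) := by
  refine Integrable.mono' (integrableOn_rpow_mul_exp hb one_pos) ?_ ?_
  · exact (by fun_prop : Measurable fun ξ : ℝ =>
      ((ξ ^ b : ℝ) : ℂ) * Complex.exp (-((1 + Complex.I * x) * ξ))).aestronglyMeasurable
  · filter_upwards [self_mem_ae_restrict measurableSet_Ioi] with ξ hξ
    have hξ : 0 < ξ := hξ
    rw [norm_mul, norm_exp_neg_mul, Complex.norm_real, Real.norm_of_nonneg (by positivity)]
    simp

lemma tendsto_rpow_mul_cexp (b x : ℝ) :
    Tendsto (fun ξ : ℝ => ((ξ ^ b : ℝ) : ℂ) * Complex.exp (-((1 + Complex.I * x) * ξ))) atTop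
      (𝓝 0) := by
  have h := tendsto_rpow_mul_exp_neg_mul_atTop_nhds_zero b 1 one_pos
  refine squeeze_zero_norm' ?_ h
  filter_upwards [eventually_gt_atTop 0] with ξ hξ
  rw [norm_mul, norm_exp_neg_mul, Complex.norm_real, Real.norm_of_nonneg (by positivity)]
  simp

/-- The functional equation of Euler's integral, by integration by parts. -/
lemma mul_integral_rpow_mul_cexp {a : ℝ} (ha : 0 < a) (x : ℝ) :
    (1 + Complex.I * x) * ∫ ξ in Set.Ioi (0 : ℝ),
        ((ξ ^ a : ℝ) : ℂ) * Complex.exp (-((1 + Complex.I * x) * ξ))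
      = a * ∫ ξ in Set.Ioi (0 : ℝ),
        ((ξ ^ (a - 1) : ℝ) : ℂ) * Complex.exp (-((1 + Complex.I * x) * ξ)) := by
  set z : ℂ := 1 + Complex.I * x with hz
  have i1 := (integrableOn_rpow_mul_cexp (b := a - 1) (by linarith) x).const_mul (a : ℂ)
  have i2 := (integrableOn_rpow_mul_cexp (b := a) (by linarith) x).const_mul z
  have hcont : Continuous fun ξ : ℝ => ((ξ ^ a : ℝ) : ℂ) * Complex.exp (-(z * ξ)) := by
    have : Continuous fun ξ : ℝ => ξ ^ a := Real.continuous_rpow_const ha.le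
    fun_prop
  have h := integral_Ioi_of_hasDerivAt_of_tendsto (a := (0 : ℝ))
    (f := fun ξ : ℝ => ((ξ ^ a : ℝ) : ℂ) * Complex.exp (-(z * ξ)))
    (f' := fun ξ : ℝ => a * (((ξ ^ (a - 1) : ℝ) : ℂ) * Complex.exp (-(z * ξ)))
        - z * (((ξ ^ a : ℝ) : ℂ) * Complex.exp (-(z * ξ)))) hcont.continuousWithinAt
    (fun ξ hξ => by
      have := hasDerivAt_cpow_mul_exp a z hξ
      rwa [mul_assoc] at this)
    (i1.sub i2) (tendsto_rpow_mul_cexp a x)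
  rw [integral_sub i1 i2, integral_const_mul, integral_const_mul] at h
  simp only [Complex.ofReal_zero, mul_zero, neg_zero, Complex.exp_zero, mul_one,
    Real.zero_rpow ha.ne', sub_zero] at h
  exact (sub_eq_zero.1 h).symm

lemma hasDerivAt_integral_rpow_mul_cexp {a : ℝ} (ha : 0 < a) (x : ℝ) :
    HasDerivAt (fun x : ℝ => ∫ ξ in Set.Ioi (0 : ℝ),
        ((ξ ^ (a - 1) : ℝ) : ℂ) * Complex.exp (-((1 + Complex.I * x) * ξ)))
      (-Complex.I * ∫ ξ in Set.Ioi (0 : ℝ),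
        ((ξ ^ a : ℝ) : ℂ) * Complex.exp (-((1 + Complex.I * x) * ξ))) x := by
  have h := (hasDerivAt_integral_of_dominated_loc_of_deriv_le (μ := volume.restrict (Set.Ioi 0))
    (F := fun (x ξ : ℝ) => ((ξ ^ (a - 1) : ℝ) : ℂ) * Complex.exp (-((1 + Complex.I * x) * ξ)))
    (F' := fun (x ξ : ℝ) =>
      -Complex.I * (((ξ ^ a : ℝ) : ℂ) * Complex.exp (-((1 + Complex.I * x) * ξ))))
    (bound := fun ξ : ℝ => ξ ^ a * Real.exp (-1 * ξ)) (x₀ := x) (s := Set.univ) univ_mem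
    (Eventually.of_forall fun y => (integrableOn_rpow_mul_cexp (by linarith) y).1)
    (integrableOn_rpow_mul_cexp (by linarith) x)
    ((integrableOn_rpow_mul_cexp (b := a) (by linarith) x).const_mul _).1 ?_
    (integrableOn_rpow_mul_exp (by linarith) one_pos) ?_).2
  · rwa [integral_const_mul] at h
  · filter_upwards [self_mem_ae_restrict measurableSet_Ioi] with ξ hξ y _
    have hξ : 0 < ξ := hξ
    rw [norm_mul, norm_mul, norm_exp_neg_mul, Complex.norm_real,
      Real.norm_of_nonneg (by positivity), norm_neg, Complex.norm_I]
    simp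
  · filter_upwards [self_mem_ae_restrict measurableSet_Ioi] with ξ hξ y _
    have hξ : 0 < ξ := hξ
    have h1 : HasDerivAt (fun y : ℝ => Complex.exp (-((1 + Complex.I * y) * ξ)))
        (Complex.exp (-((1 + Complex.I * y) * ξ)) * -(Complex.I * 1 * ξ)) y :=
      (((((hasDerivAt_id (y : ℂ)).const_mul Complex.I).const_add 1).mul_const
        (ξ : ℂ)).neg.cexp).comp_ofReal
    refine (h1.const_mul ((ξ ^ (a - 1) : ℝ) : ℂ)).congr_deriv ?_
    have : ξ ^ a = ξ ^ (a - 1) * ξ := by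
      rw [← Real.rpow_add_one hξ.ne', sub_add_cancel]
    rw [this]
    push_cast
    ring

lemma one_add_I_mul_mem_slitPlane (x : ℝ) : 1 + Complex.I * (x : ℂ) ∈ Complex.slitPlane := by
  left; simp

lemma one_add_I_mul_ne_zero (x : ℝ) : 1 + Complex.I * (x : ℂ) ≠ 0 :=
  Complex.slitPlane_ne_zero (one_add_I_mul_mem_slitPlane x)

/-- Euler's integral along a ray: both sides satisfy the same differential equation in `x`. -/
lemma integral_rpow_mul_cexp {a : ℝ} (ha : 0 < a) (x : ℝ) :
    ∫ ξ in Set.Ioi (0 : ℝ), ((ξ ^ (a - 1) : ℝ) : ℂ) * Complex.exp (-((1 + Complex.I * x) * ξ))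
      = Real.Gamma a * (1 + Complex.I * x) ^ (-(a : ℂ)) := by
  set G : ℝ → ℂ := fun x => ∫ ξ in Set.Ioi (0 : ℝ),
    ((ξ ^ (a - 1) : ℝ) : ℂ) * Complex.exp (-((1 + Complex.I * x) * ξ)) with hG
  set h : ℝ → ℂ := fun x => (1 + Complex.I * x) ^ (a : ℂ) * G x with hh
  have hder : ∀ x : ℝ, HasDerivAt h 0 x := by
    intro x
    have h1 : HasDerivAt (fun x : ℝ => (1 + Complex.I * (x : ℂ)) ^ (a : ℂ))
        (a * (1 + Complex.I * x) ^ ((a : ℂ) - 1) * (Complex.I * 1)) x :=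
      ((((hasDerivAt_id (x : ℂ)).const_mul Complex.I).const_add 1).cpow_const
        (one_add_I_mul_mem_slitPlane x)).comp_ofReal
    have h2 := h1.mul (hasDerivAt_integral_rpow_mul_cexp ha x)
    refine h2.congr_deriv ?_
    have h3 := mul_integral_rpow_mul_cexp ha x
    rw [Complex.cpow_sub _ _ (one_add_I_mul_ne_zero x), Complex.cpow_one]
    have hz := one_add_I_mul_ne_zero x
    field_simp
    simp only [mul_assoc] at h3 ⊢
    linear_combination (-Complex.I * (1 + Complex.I * (x : ℂ)) ^ (a : ℂ)) * h3
  have hconst : h x = h 0 := is_const_of_deriv_eq_zero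
    (fun y => (hder y).differentiableAt) (fun y => (hder y).deriv) x 0
  have h0 : h 0 = Real.Gamma a := by
    simp only [hh, hG, Complex.ofReal_zero, mul_zero, add_zero, Complex.one_cpow, one_mul]
    rw [Real.Gamma_eq_integral ha, ← integral_complex_ofReal]
    refine setIntegral_congr_fun measurableSet_Ioi fun ξ _ => ?_
    push_cast
    ring
  rw [Complex.cpow_neg, ← h0, ← hconst]
  simp only [hh]
  have : (1 + Complex.I * (x : ℂ)) ^ (a : ℂ) ≠ 0 := by
    rw [Complex.cpow_ne_zero_iff]
    exact Or.inl (one_add_I_mul_ne_zero x)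
  field_simp
  rfl

lemma hasIntegrableFourier_gammaKernel {a : ℝ} (ha : 0 < a) :
    HasIntegrableFourier (fun x => Real.Gamma a * (1 + Complex.I * x) ^ (-(a : ℂ)))
      (gammaKernel a) := by
  refine ⟨(expIntegrable_gammaKernel ha (ρ := 0) one_pos).integrable le_rfl, fun x => ?_⟩
  beta_reduce
  have h := integral_gammaKernel_smul a fun ξ => Complex.exp (Complex.I * ξ * x)
  simp only [smul_eq_mul] at h
  rw [h, ← integral_rpow_mul_cexp ha]
  refine setIntegral_congr_fun measurableSet_Ioi fun ξ _ => ?_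
  simp only [gammaDensity]
  push_cast
  rw [mul_assoc, ← Complex.exp_add]
  congr 2
  ring

/-- Cancellation in the truncated Gamma integrals: uniformly in the shift `η ≥ 0` they are bounded
by a multiple of `|z| ^ (-a)`. The integral is cut at `1 / |z|`; beyond the cut it is integrated by
parts. -/
lemma norm_integral_shifted_le {a : ℝ} (ha : 0 < a) (ha1 : a < 1) {η : ℝ} (hη : 0 ≤ η) (x : ℝ) :
    ‖∫ ζ in Set.Ioi (0 : ℝ),
        (((η + ζ) ^ (a - 1) : ℝ) : ℂ) * Complex.exp (-((1 + Complex.I * x) * ζ))‖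
      ≤ (1 / a + 2) * ‖1 + Complex.I * (x : ℂ)‖ ^ (-a) := by
  set z : ℂ := 1 + Complex.I * x with hz
  have hz0 : z ≠ 0 := one_add_I_mul_ne_zero x
  set δ : ℝ := ‖z‖⁻¹ with hδ
  have hδ0 : 0 < δ := inv_pos.2 (norm_pos_iff.2 hz0)
  have hδa : ‖z‖ ^ (-a) = δ ^ a := by
    rw [hδ, Real.inv_rpow (norm_nonneg _), Real.rpow_neg (norm_nonneg _)]
  have hexp : ∀ ζ : ℝ, 0 < ζ → ‖Complex.exp (-(z * ζ))‖ ≤ 1 := fun ζ hζ => by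
    rw [norm_exp_neg_mul]; exact Real.exp_le_one_iff.2 (by linarith)
  -- shifted powers are dominated by unshifted ones, since the exponents are negative
  have hmono : ∀ b : ℝ, b ≤ 0 → ∀ ζ : ℝ, 0 < ζ → ‖(((η + ζ) ^ b : ℝ) : ℂ)‖ ≤ ζ ^ b := by
    intro b hb ζ hζ
    rw [Complex.norm_real, Real.norm_of_nonneg (by positivity)]
    exact Real.rpow_le_rpow_of_nonpos hζ (by linarith) hb
  have hle : ∀ b : ℝ, b ≤ 0 → ∀ ζ : ℝ, 0 < ζ →
      ‖(((η + ζ) ^ b : ℝ) : ℂ) * Complex.exp (-(z * ζ))‖ ≤ ζ ^ b := by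
    intro b hb ζ hζ
    rw [norm_mul]
    calc _ ≤ ζ ^ b * 1 :=
          mul_le_mul (hmono b hb ζ hζ) (hexp ζ hζ) (norm_nonneg _) (by positivity)
      _ = _ := mul_one _
  have hmeas : ∀ (b : ℝ) (s : Set ℝ), AEStronglyMeasurable (fun ζ : ℝ =>
      (((η + ζ) ^ b : ℝ) : ℂ) * Complex.exp (-(z * ζ))) (volume.restrict s) := fun b s =>
    (by fun_prop : Measurable fun ζ : ℝ =>
      (((η + ζ) ^ b : ℝ) : ℂ) * Complex.exp (-(z * ζ))).aestronglyMeasurable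
  have hint : IntegrableOn (fun ζ : ℝ =>
      (((η + ζ) ^ (a - 1) : ℝ) : ℂ) * Complex.exp (-(z * ζ))) (Set.Ioi 0) := by
    refine Integrable.mono' (integrableOn_gammaDensity ha) (hmeas _ _) ?_
    filter_upwards [self_mem_ae_restrict measurableSet_Ioi] with ζ hζ
    rw [norm_mul, norm_exp_neg_mul, gammaDensity]
    exact mul_le_mul_of_nonneg_right (hmono _ (by linarith) ζ hζ) (Real.exp_pos _).le
  -- the part up to the cut
  have hA : ‖∫ ζ in Set.Ioc 0 δ, (((η + ζ) ^ (a - 1) : ℝ) : ℂ) * Complex.exp (-(z * ζ))‖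
      ≤ δ ^ a / a := by
    have hi : IntervalIntegrable (fun ζ : ℝ => ζ ^ (a - 1)) volume 0 δ :=
      intervalIntegral.intervalIntegrable_rpow' (by linarith)
    have hval : ∫ ζ in (0 : ℝ)..δ, ζ ^ (a - 1) = δ ^ a / a := by
      rw [integral_rpow (Or.inl (by linarith)), sub_add_cancel, Real.zero_rpow ha.ne', sub_zero]
    rw [← hval, intervalIntegral.integral_of_le hδ0.le]
    refine norm_integral_le_of_norm_le hi.1 ?_
    filter_upwards [self_mem_ae_restrict measurableSet_Ioc] with ζ hζ
    exact hle _ (by linarith) ζ hζ.1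
  -- the part beyond the cut
  have hB : ‖∫ ζ in Set.Ioi δ, (((η + ζ) ^ (a - 1) : ℝ) : ℂ) * Complex.exp (-(z * ζ))‖
      ≤ 2 * δ ^ a := by
    have i1 : IntegrableOn (fun ζ : ℝ =>
        (((η + ζ) ^ (a - 1) : ℝ) : ℂ) * Complex.exp (-(z * ζ))) (Set.Ioi δ) :=
      hint.mono_set (Set.Ioi_subset_Ioi hδ0.le)
    have hr := integrableOn_Ioi_rpow_of_lt (a := a - 2) (by linarith) hδ0
    have hbd : ∀ᵐ ζ ∂(volume.restrict (Set.Ioi δ)),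
        ‖(((η + ζ) ^ (a - 2) : ℝ) : ℂ) * Complex.exp (-(z * ζ))‖ ≤ ζ ^ (a - 2) := by
      filter_upwards [self_mem_ae_restrict measurableSet_Ioi] with ζ hζ
      exact hle _ (by linarith) ζ (hδ0.trans hζ)
    have i2 : IntegrableOn (fun ζ : ℝ =>
        (((η + ζ) ^ (a - 2) : ℝ) : ℂ) * Complex.exp (-(z * ζ))) (Set.Ioi δ) :=
      Integrable.mono' hr (hmeas _ _) hbd
    have hder : ∀ ζ ∈ Set.Ici δ, HasDerivAt
        (fun ζ : ℝ => (((η + ζ) ^ (a - 1) : ℝ) : ℂ) * Complex.exp (-(z * ζ)))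
        (((a - 1 : ℝ) : ℂ) * ((((η + ζ) ^ (a - 2) : ℝ) : ℂ) * Complex.exp (-(z * ζ)))
          - z * ((((η + ζ) ^ (a - 1) : ℝ) : ℂ) * Complex.exp (-(z * ζ)))) ζ := by
      intro ζ hζ
      have hζ0 : 0 < η + ζ := by have : δ ≤ ζ := hζ; linarith
      have h1 : HasDerivAt (fun ζ : ℝ => (((η + ζ) ^ (a - 1) : ℝ) : ℂ))
          (((1 * (a - 1) * (η + ζ) ^ (a - 1 - 1) : ℝ)) : ℂ) ζ :=
        (((hasDerivAt_id ζ).const_add η).rpow_const (Or.inl hζ0.ne')).ofReal_comp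
      have h2 : HasDerivAt (fun ζ : ℝ => Complex.exp (-(z * ζ)))
          (Complex.exp (-(z * ζ)) * -(z * 1)) ζ :=
        ((((hasDerivAt_id (ζ : ℂ)).const_mul z).neg).cexp).comp_ofReal
      refine (h1.mul h2).congr_deriv ?_
      rw [show a - 1 - 1 = a - 2 by ring]
      push_cast
      ring
    have htend : Tendsto (fun ζ : ℝ => (((η + ζ) ^ (a - 1) : ℝ) : ℂ) * Complex.exp (-(z * ζ)))
        atTop (𝓝 0) := by
      have h1 := tendsto_rpow_neg_atTop (y := 1 - a) (by linarith)
      refine squeeze_zero_norm' ?_ h1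
      filter_upwards [eventually_gt_atTop 0] with ζ hζ
      rw [neg_sub]
      exact hle _ (by linarith) ζ hζ
    have h := integral_Ioi_of_hasDerivAt_of_tendsto' hder
      ((i2.const_mul ((a - 1 : ℝ) : ℂ)).sub (i1.const_mul z)) htend
    rw [integral_sub (i2.const_mul _) (i1.const_mul _), integral_const_mul, integral_const_mul]
      at h
    have hsolve : ∫ ζ in Set.Ioi δ, (((η + ζ) ^ (a - 1) : ℝ) : ℂ) * Complex.exp (-(z * ζ))
        = z⁻¹ * ((((η + δ) ^ (a - 1) : ℝ) : ℂ) * Complex.exp (-(z * δ))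
          + ((a - 1 : ℝ) : ℂ) * ∫ ζ in Set.Ioi δ,
            (((η + ζ) ^ (a - 2) : ℝ) : ℂ) * Complex.exp (-(z * ζ))) := by
      field_simp
      linear_combination -h
    have h3 : ‖∫ ζ in Set.Ioi δ, (((η + ζ) ^ (a - 2) : ℝ) : ℂ) * Complex.exp (-(z * ζ))‖
        ≤ δ ^ (a - 1) / (1 - a) := by
      refine (norm_integral_le_of_norm_le hr hbd).trans (le_of_eq ?_)
      rw [integral_Ioi_rpow_of_lt (by linarith) hδ0, show a - 2 + 1 = a - 1 by ring,
        show a - 1 = -(1 - a) by ring, div_neg, neg_div, neg_neg]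
    have h4 : (0 : ℝ) < 1 - a := by linarith
    rw [hsolve, norm_mul, norm_inv, ← hδ]
    calc _ ≤ δ * (δ ^ (a - 1) + (1 - a) * (δ ^ (a - 1) / (1 - a))) := by
          refine mul_le_mul_of_nonneg_left ((norm_add_le _ _).trans (add_le_add
            (hle _ (by linarith) δ hδ0) ?_)) hδ0.le
          rw [norm_mul, Complex.norm_real, Real.norm_eq_abs, abs_sub_comm, abs_of_pos h4]
          exact mul_le_mul_of_nonneg_left h3 h4.le
      _ = 2 * (δ ^ (a - 1) * δ) := by field_simp; ring
      _ = _ := by rw [← Real.rpow_add_one hδ0.ne', sub_add_cancel]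
  rw [hδa, ← Set.Ioc_union_Ioi_eq_Ioi hδ0.le, setIntegral_union
    (Set.Ioc_disjoint_Ioi le_rfl) measurableSet_Ioi
    (hint.mono_set Set.Ioc_subset_Ioi_self) (hint.mono_set (Set.Ioi_subset_Ioi hδ0.le))]
  calc _ ≤ δ ^ a / a + 2 * δ ^ a := (norm_add_le _ _).trans (add_le_add hA hB)
    _ = _ := by ring

end GammaKernel

end

/-! ### Factorization of functions in the class `ℰˢ` -/

section

section Factorization

open scoped Convolution

lemma HasIntegrableFourier.mul {g h φ ψ : ℝ → ℂ} {ρ : ℝ} (hρ : 0 ≤ ρ) (hφ : ExpIntegrable ρ φ)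
    (hψ : ExpIntegrable ρ ψ) (hg : HasIntegrableFourier g φ) (hh : HasIntegrableFourier h ψ) :
    HasIntegrableFourier (fun x => g x * h x) (φ ⋆[ContinuousLinearMap.mul ℂ ℂ] ψ) := by
  refine ⟨(hφ.convolution hρ hψ).integrable hρ, fun x => ?_⟩
  have h1 := hφ.integral_convolution_smul (C := 1) hρ hψ (continuous_fourierKernel x) fun ξ => by
    rw [norm_fourierKernel, one_mul]
    exact Real.one_le_exp (by positivity)
  simp only [smul_eq_mul] at h1
  beta_reduce
  rw [h1, hg.2, hh.2, ← integral_mul_const]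
  refine integral_congr_ae (Eventually.of_forall fun ξ => ?_)
  simp only [mul_assoc]
  rw [← integral_const_mul]
  congr 1
  refine integral_congr_ae (Eventually.of_forall fun η => ?_)
  simp only
  rw [mul_left_comm, ← Complex.exp_add]
  congr 2
  push_cast
  ring

lemma HasIntegrableFourier.const_mul {g φ : ℝ → ℂ} (hg : HasIntegrableFourier g φ) (c : ℂ) :
    HasIntegrableFourier (fun x => c * g x) fun ξ => c * φ ξ := by
  refine ⟨hg.1.const_mul c, fun x => ?_⟩
  beta_reduce
  rw [hg.2, ← integral_const_mul]
  simp only [mul_assoc]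

/-- A product `g w ^ k` has the power series that its factors suggest. -/
lemma exists_fourierSeries_mul_pow {g w φ ψ : ℝ → ℂ} {ρ : ℝ} (hρ : 0 < ρ) (hφ : ExpIntegrable ρ φ)
    (hψ : ExpIntegrable ρ ψ) (hg : HasIntegrableFourier g φ) (hw : HasIntegrableFourier w ψ)
    (H : Type*) [NormedAddCommGroup H] [InnerProductSpace ℂ H] [CompleteSpace H] (k : ℕ) :
    ∃ (χ : ℝ → ℂ) (hχ : ExpIntegrable ρ χ), HasIntegrableFourier (fun x => g x * w x ^ k) χ ∧
      ∀ {D : H →ₗ.[ℂ] H} {U : ℝ → H →L[ℂ] H} (hU : IsUnitaryGroup D U) (R : H →L[ℂ] H),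
        fourierSeries hU R hρ hχ = fourierSeries hU R hρ hφ * fourierSeries hU R hρ hψ ^ k := by
  induction k with
  | zero => exact ⟨φ, hφ, by simpa using hg, fun hU R => by simp⟩
  | succ k ih =>
    obtain ⟨χ, hχ, h1, h2⟩ := ih
    refine ⟨_, hχ.convolution hρ.le hψ, ?_, fun hU R => ?_⟩
    · have := h1.mul hρ.le hχ hψ hw
      simpa only [pow_succ, mul_assoc] using this
    · rw [fourierSeries_convolution hU R hρ hχ hψ, h2, pow_succ, mul_assoc]

lemma sub_I_eq (x : ℝ) : (x : ℂ) - Complex.I = -Complex.I * (1 + Complex.I * x) := by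
  linear_combination (x : ℂ) * Complex.I_mul_I

lemma sub_I_cpow (x : ℝ) (w : ℂ) :
    ((x : ℂ) - Complex.I) ^ w = (-Complex.I) ^ w * (1 + Complex.I * x) ^ w := by
  have h0 : -Complex.I ≠ 0 := neg_ne_zero.2 Complex.I_ne_zero
  have h1 := one_add_I_mul_ne_zero x
  have harg : |Complex.arg (1 + Complex.I * x)| < Real.pi / 2 :=
    Complex.abs_arg_lt_pi_div_two_iff.2 (Or.inl (by simp))
  have hlog : Complex.log (-Complex.I * (1 + Complex.I * x))
      = Complex.log (-Complex.I) + Complex.log (1 + Complex.I * x) := by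
    rw [Complex.log_mul_eq_add_log_iff h0 h1, Complex.arg_neg_I]
    have := abs_lt.1 harg
    have hpi := Real.pi_pos
    exact ⟨by linarith, by linarith⟩
  rw [sub_I_eq, Complex.cpow_def_of_ne_zero (mul_ne_zero h0 h1), Complex.cpow_def_of_ne_zero h0,
    Complex.cpow_def_of_ne_zero h1, hlog, add_mul, Complex.exp_add]

lemma norm_one_add_I_mul (x : ℝ) : ‖1 + Complex.I * (x : ℂ)‖ = ‖(x : ℂ) - Complex.I‖ := by
  rw [sub_I_eq, norm_mul, norm_neg, Complex.norm_I, one_mul]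

lemma one_le_norm_sub_I (x : ℝ) : 1 ≤ ‖(x : ℂ) - Complex.I‖ := by
  rw [← norm_one_add_I_mul]
  have := Complex.abs_re_le_norm (1 + Complex.I * (x : ℂ))
  simpa using this

/-- Of the conditions defining `ℰˢ`, those for `m = 0` and `m = s` suffice: they give exponential
moments of the transforms of `f` and of `f (x - i) ^ s`. -/
lemma ClassE.exists_expIntegrable {s : ℝ} {f : ℝ → ℂ} (hs : 0 ≤ s) (hf : ClassE s f) :
    ∃ ρ : ℝ, 0 < ρ ∧ ρ < 1 ∧ ExpIntegrable ρ (fourierHat f) ∧ HasIntegrableFourier f (fourierHat f) ∧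
      (∀ n : ℕ, ∃ ψ, HasIntegrableFourier (iteratedDeriv n f) ψ) ∧
      ∃ φ, ExpIntegrable ρ φ ∧
        HasIntegrableFourier (fun x : ℝ => f x * ((x : ℂ) - Complex.I) ^ (s : ℂ)) φ := by
  obtain ⟨hsm, C, hC, hb⟩ := hf
  have hC0 : 0 < C := by linarith
  -- the exponential rate `1 / (2 C)` lies below the radius of convergence `1 / C`, and below `1`,
  -- where the Gamma kernel has exponential moments
  have hρ : (2 * C)⁻¹ * C < 1 := by
    rw [mul_inv, mul_assoc, inv_mul_cancel₀ hC0.ne']; norm_num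
  have hρ1 : (2 * C)⁻¹ < 1 := inv_lt_one_of_one_lt₀ (by linarith)
  have h0 := hb 0 hs (Or.inr ⟨0, by simp⟩)
  simp only [Complex.ofReal_zero, Complex.cpow_zero, mul_one] at h0
  have hhat : HasIntegrableFourier f (fourierHat f) := by
    obtain ⟨φ, hφ, -⟩ := h0 0
    rw [iteratedDeriv_zero] at hφ
    exact Classical.epsilon_spec (p := fun φ => HasIntegrableFourier f φ) ⟨φ, hφ⟩
  have hs' := hb s le_rfl (Or.inl rfl)
  have hsm' : ContDiff ℝ ∞ fun x : ℝ => f x * ((x : ℂ) - Complex.I) ^ (s : ℂ) := by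
    simp_rw [sub_I_cpow]
    refine hsm.mul (contDiff_const.mul ?_)
    refine contDiff_iff_contDiffAt.2 fun x => ?_
    have h1 : ContDiffAt ℂ ∞ (fun z : ℂ => z ^ (s : ℂ)) (1 + Complex.I * x) := by
      have : AnalyticAt ℂ (fun z : ℂ => z ^ (s : ℂ)) (1 + Complex.I * x) :=
        analyticAt_id.cpow analyticAt_const (one_add_I_mul_mem_slitPlane x)
      exact this.contDiffAt
    have h2 : ContDiffAt ℝ ∞ (fun x : ℝ => 1 + Complex.I * (x : ℂ)) x :=
      contDiffAt_const.add (contDiffAt_const.mul Complex.ofRealCLM.contDiff.contDiffAt)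
    exact (h1.restrict_scalars ℝ).comp x h2
  obtain ⟨φ, hφ, -⟩ := hs' 0
  rw [iteratedDeriv_zero] at hφ
  exact ⟨(2 * C)⁻¹, by positivity, hρ1, hhat.expIntegrable hsm hC0 (by positivity) hρ h0, hhat,
    fun n => (h0 n).imp fun _ h => h.1, φ,
    hφ.expIntegrable hsm' hC0 (by positivity) hρ hs', hφ⟩

/-- The function `f` is a product of a function with exponentially decaying Fourier transform and
the `k`-th power of `(1 + i x) ^ (-s / k)`. -/
lemma ClassE.exists_fourierSeries_factor {s : ℝ} {f : ℝ → ℂ} (hs : 0 < s) (hf : ClassE s f)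
    (H : Type*) [NormedAddCommGroup H] [InnerProductSpace ℂ H] [CompleteSpace H]
    {k : ℕ} (hk : 0 < k) :
    ∃ (ρ : ℝ) (hρ : 0 < ρ) (hρ1 : ρ < 1) (φ : ℝ → ℂ) (hφ : ExpIntegrable ρ φ)
      (hfe : ExpIntegrable ρ (fourierHat f)) (ha : 0 < s / k),
      ∀ {D : H →ₗ.[ℂ] H} {U : ℝ → H →L[ℂ] H} (hU : IsUnitaryGroup D U) (R : H →L[ℂ] H),
        fourierSeries hU R hρ hfe = fourierSeries hU R hρ hφ *
          fourierSeries hU R hρ (expIntegrable_gammaKernel ha hρ1) ^ k := by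
  obtain ⟨ρ, hρ, hρ1, hfe, hhat, -, φ, hφ, hφs⟩ := hf.exists_expIntegrable hs.le
  have hk' : (0 : ℝ) < k := by exact_mod_cast hk
  have ha : 0 < s / k := by positivity
  set c : ℂ := ((-Complex.I) ^ (s : ℂ))⁻¹ * ((Real.Gamma (s / k) : ℂ) ^ k)⁻¹ with hc
  have hΓ : (Real.Gamma (s / k) : ℂ) ≠ 0 := by exact_mod_cast (Real.Gamma_pos_of_pos ha).ne'
  obtain ⟨χ, hχ, h1, h2⟩ := exists_fourierSeries_mul_pow hρ (hφ.const_mul c)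
    (expIntegrable_gammaKernel ha hρ1) (hφs.const_mul c) (hasIntegrableFourier_gammaKernel ha) H k
  have hprod : (fun x : ℝ => c * (f x * ((x : ℂ) - Complex.I) ^ (s : ℂ)) *
      (Real.Gamma (s / k) * (1 + Complex.I * x) ^ (-((s / k : ℝ) : ℂ))) ^ k) = f := by
    funext x
    have hz := one_add_I_mul_ne_zero x
    have h3 : ((1 + Complex.I * (x : ℂ)) ^ (-((s / k : ℝ) : ℂ))) ^ k
        = ((1 + Complex.I * x) ^ (s : ℂ))⁻¹ := by
      rw [← Complex.cpow_nat_mul, ← Complex.cpow_neg]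
      congr 1
      have : (k : ℂ) ≠ 0 := by exact_mod_cast hk.ne'
      push_cast
      field_simp
    have h4 : (-Complex.I) ^ (s : ℂ) ≠ 0 := by
      rw [Complex.cpow_ne_zero_iff]
      exact Or.inl (neg_ne_zero.2 Complex.I_ne_zero)
    have h5 : (1 + Complex.I * (x : ℂ)) ^ (s : ℂ) ≠ 0 := by
      rw [Complex.cpow_ne_zero_iff]
      exact Or.inl hz
    rw [sub_I_cpow, mul_pow, h3, hc]
    field_simp
  rw [hprod] at h1
  refine ⟨ρ, hρ, hρ1, _, hφ.const_mul c, hfe, ha, fun hU R => ?_⟩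
  rw [← h2 hU R]
  exact fourierSeries_congr hU R hρ hρ hfe hχ (hhat.ae_unique h1)

end Factorization

end

/-! ### The unitary group in an eigenbasis -/

section

variable {D : H →ₗ.[ℂ] H} {U : ℝ → H →L[ℂ] H} {R : H →L[ℂ] H}

section Eigenbasis

variable {ι : Type*} {e : HilbertBasis ι ℂ H} {l : ι → ℝ}

lemma IsUnitaryGroup.hasDerivAt (hU : IsUnitaryGroup D U) (x : D.domain) (a : ℝ) :
    HasDerivAt (fun a => U a (x : H)) (U a (Complex.I • D x)) a := by
  have h1 : HasDerivAt (fun b : ℝ => U (b - a) (x : H)) (Complex.I • D x) a := by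
    have := hU.generator x
    rw [← sub_self a] at this
    exact this.comp_sub_const a a
  have h2 := ((U a).restrictScalars ℝ).hasFDerivAt.comp_hasDerivAt a h1
  refine h2.congr_of_eventuallyEq (Eventually.of_forall fun b => ?_)
  have := hU.add_apply a (b - a) x
  rw [add_sub_cancel] at this
  exact this

lemma IsUnitaryGroup.inner_map_map (hU : IsUnitaryGroup D U) (a : ℝ) (v w : H) :
    inner ℂ (U a v) (U a w) = inner ℂ v w :=
  LinearIsometry.inner_map_map (⟨(U a).toLinearMap, hU.norm_map a⟩ : H →ₗᵢ[ℂ] H) v w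

/-- The orbit `U(a) eᵢ` solves a linear differential equation, so it is `exp (i a λᵢ) eᵢ`. -/
lemma IsUnitaryGroup.apply_eigenvector (hU : IsUnitaryGroup D U) (he : IsEigenbasis D e l) (i : ι)
    (a : ℝ) : U a (e i) = Complex.exp (Complex.I * a * l i) • e i := by
  obtain ⟨hi, hDi⟩ := he i
  set g : ℝ → H := fun a => Complex.exp (-(Complex.I * a * l i)) • U a (e i) with hg
  have hder : ∀ a, HasDerivAt g 0 a := by
    intro a
    have h1 : HasDerivAt (fun a : ℝ => Complex.exp (-(Complex.I * a * l i)))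
        (Complex.exp (-(Complex.I * a * l i)) * -(Complex.I * 1 * l i)) a :=
      (((((hasDerivAt_id (a : ℂ)).const_mul Complex.I).mul_const (l i : ℂ)).neg).cexp).comp_ofReal
    have h2 := h1.smul (hU.hasDerivAt ⟨e i, hi⟩ a)
    refine h2.congr_deriv ?_
    rw [hDi, map_smul, map_smul]
    module
  have hc : g a = g 0 := is_const_of_deriv_eq_zero
    (fun y => (hder y).differentiableAt) (fun y => (hder y).deriv) a 0
  have h0 : g 0 = e i := by simp [hg, hU.zero_apply]
  have h1 : U a (e i) = Complex.exp (Complex.I * a * l i) • g a := by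
    rw [hg, smul_smul, ← Complex.exp_add, add_neg_cancel, Complex.exp_zero, one_smul]
  rw [h1, hc, h0]

lemma IsUnitaryGroup.inner_eigenvector (hU : IsUnitaryGroup D U) (he : IsEigenbasis D e l) (i : ι)
    (a : ℝ) (v : H) :
    inner ℂ (e i) (U a v) = Complex.exp (Complex.I * a * l i) * inner ℂ (e i) v := by
  rw [← hU.inner_map_map a (e i) v, hU.apply_eigenvector he, inner_smul_left, ← Complex.exp_conj,
    ← mul_assoc, ← Complex.exp_add]
  simp

lemma inner_duhamel_zero (hU : IsUnitaryGroup D U) (he : IsEigenbasis D e l) (v : H) (i : ι)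
    (ξ : ℝ) : inner ℂ (e i) (duhamel U R 0 v ξ)
      = Complex.exp (Complex.I * ξ * l i) * inner ℂ (e i) v :=
  hU.inner_eigenvector he i ξ v

lemma inner_duhamel_succ (hU : IsUnitaryGroup D U) (he : IsEigenbasis D e l) (R : H →L[ℂ] H)
    (n : ℕ) (v : H) (i : ι) (ξ : ℝ) :
    inner ℂ (e i) (duhamel U R (n + 1) v ξ)
      = Complex.I * ∫ η in (0 : ℝ)..ξ, Complex.exp (Complex.I * (ξ - η) * l i) *
        inner ℂ (e i) (R (duhamel U R n v η)) := by
  rw [duhamel_succ, inner_smul_right]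
  have h := (innerSL ℂ (e i)).intervalIntegral_comp_comm
    ((continuous_duhamel_integrand hU R n v (X := ℝ) (a := fun η => ξ - η) (b := fun η => η)
      (by fun_prop) (by fun_prop)).intervalIntegrable (μ := volume) 0 ξ)
  simp only [innerSL_apply_apply] at h
  rw [← h]
  simp_rw [hU.inner_eigenvector he]
  push_cast
  rfl

end Eigenbasis

/-! ### Decay of Gamma functions of the perturbed operator -/

section Decay

/-- Integrals over the triangle `0 < η < ξ`, in the coordinates `η` and `ζ = ξ - η`. -/
lemma integral_triangle {G : ℝ → ℝ → ℂ} (hm : Measurable (Function.uncurry G)) {h1 h2 : ℝ → ℝ}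
    (h1i : Integrable h1) (h2i : Integrable h2)
    (hb : ∀ ξ η, 0 < η → η < ξ → ‖G ξ η‖ ≤ h1 ξ * h2 η) :
    IntegrableOn (fun η => ∫ ζ in Set.Ioi (0 : ℝ), G (η + ζ) η) (Set.Ioi 0) ∧
    ∫ ξ in Set.Ioi (0 : ℝ), ∫ η in (0 : ℝ)..ξ, G ξ η
      = ∫ η in Set.Ioi (0 : ℝ), ∫ ζ in Set.Ioi (0 : ℝ), G (η + ζ) η := by
  classical
  set T : Set (ℝ × ℝ) := {p | 0 < p.2 ∧ p.2 < p.1} with hT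
  have hTm : MeasurableSet T :=
    (measurableSet_lt measurable_const measurable_snd).inter
      (measurableSet_lt measurable_snd measurable_fst)
  set F : ℝ × ℝ → ℂ := T.indicator (Function.uncurry G) with hF
  have hFi : Integrable F (volume.prod volume) := by
    refine Integrable.mono (h1i.mul_prod h2i) (hm.indicator hTm).aestronglyMeasurable
      (Eventually.of_forall fun p => ?_)
    by_cases hp : p ∈ T
    · rw [hF, Set.indicator_of_mem hp]
      exact (hb p.1 p.2 hp.1 hp.2).trans (le_abs_self _)
    · rw [hF, Set.indicator_of_notMem hp, norm_zero]
      exact norm_nonneg _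
  have hL : ∀ ξ, ∫ η, F (ξ, η) = (Set.Ioi (0 : ℝ)).indicator (fun ξ => ∫ η in (0 : ℝ)..ξ, G ξ η) ξ := by
    intro ξ
    by_cases hξ : ξ ∈ Set.Ioi (0 : ℝ)
    · rw [Set.indicator_of_mem hξ, intervalIntegral.integral_of_le (le_of_lt hξ), integral_Ioc_eq_integral_Ioo,
        ← integral_indicator measurableSet_Ioo]
      rfl
    · rw [Set.indicator_of_notMem hξ]
      refine integral_eq_zero_of_ae (Eventually.of_forall fun η => ?_)
      exact Set.indicator_of_notMem (s := T) (a := (ξ, η)) (fun hp => hξ (hp.1.trans hp.2)) _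
  have hR : ∀ η, ∫ ξ, F (ξ, η)
      = (Set.Ioi (0 : ℝ)).indicator (fun η => ∫ ζ in Set.Ioi (0 : ℝ), G (η + ζ) η) η := by
    intro η
    by_cases hη : η ∈ Set.Ioi (0 : ℝ)
    · rw [Set.indicator_of_mem hη, ← integral_add_left_eq_self (fun ξ => F (ξ, η)) η,
        ← integral_indicator measurableSet_Ioi]
      refine integral_congr_ae (Eventually.of_forall fun ζ => ?_)
      by_cases hζ : ζ ∈ Set.Ioi (0 : ℝ)
      · rw [Set.indicator_of_mem hζ]
        exact Set.indicator_of_mem (show (η + ζ, η) ∈ T from ⟨hη, lt_add_of_pos_right _ hζ⟩) _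
      · rw [Set.indicator_of_notMem hζ]
        exact Set.indicator_of_notMem (s := T) (a := (η + ζ, η))
          (fun hp => hζ (pos_of_lt_add_right hp.2)) _
    · rw [Set.indicator_of_notMem hη]
      refine integral_eq_zero_of_ae (Eventually.of_forall fun ξ => ?_)
      exact Set.indicator_of_notMem (s := T) (a := (ξ, η)) (fun hp => hη hp.1) _
  have hswap := integral_integral_swap (f := fun ξ η => F (ξ, η)) hFi
  simp_rw [hL, hR] at hswap
  rw [integral_indicator measurableSet_Ioi, integral_indicator measurableSet_Ioi] at hswap
  refine ⟨?_, hswap⟩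
  rw [← integrable_indicator_iff measurableSet_Ioi]
  exact hFi.integral_prod_right.congr (Eventually.of_forall hR)

/-- The Gamma integral along a ray, with its power shifted by `η`. -/
def shiftedGamma (a x η : ℝ) : ℂ :=
  ∫ ζ in Set.Ioi (0 : ℝ), (((η + ζ) ^ (a - 1) : ℝ) : ℂ) * Complex.exp (-((1 + Complex.I * x) * ζ))

/-- Exchange of the Gamma integral with the Duhamel integral of the diagonal group. The
exponential growth of `p` may have any rate below `1`; here it is `1 / 4`. -/
lemma integral_gammaDensity_triangle {a C : ℝ} (ha : 0 < a) {p : ℝ → ℂ} (hp : Continuous p)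
    (hb : ∀ η, ‖p η‖ ≤ C * Real.exp (1 / 4 * |η|)) (x : ℝ) :
    IntegrableOn (fun η => Real.exp (-η) * (shiftedGamma a x η * p η)) (Set.Ioi 0) ∧
    ∫ ξ in Set.Ioi (0 : ℝ), gammaDensity a ξ * ∫ η in (0 : ℝ)..ξ,
        Complex.exp (-(Complex.I * (ξ - η) * x)) * p η
      = ∫ η in Set.Ioi (0 : ℝ), Real.exp (-η) * (shiftedGamma a x η * p η) := by
  set G : ℝ → ℝ → ℂ := fun ξ η =>
    gammaDensity a ξ * (Complex.exp (-(Complex.I * (ξ - η) * x)) * p η) with hG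
  have hC : 0 ≤ C := by simpa using (norm_nonneg _).trans (hb 0)
  have hm : Measurable (Function.uncurry G) := by
    have h1 : Measurable fun q : ℝ × ℝ => (gammaDensity a q.1 : ℂ) := by
      unfold gammaDensity; fun_prop
    have h2 : Measurable fun q : ℝ × ℝ => p q.2 := hp.measurable.comp measurable_snd
    exact h1.mul ((by fun_prop : Measurable fun q : ℝ × ℝ =>
      Complex.exp (-(Complex.I * (q.1 - q.2) * x))).mul h2)
  -- on the triangle `exp (-ξ) exp (η / 4) ≤ exp (-ξ / 2) exp (-η / 4)`, a product of integrable
  -- weights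
  have h1i := (integrable_indicator_iff measurableSet_Ioi).2
    (integrableOn_rpow_mul_exp (a := a - 1) (c := 1 / 2) (by linarith) (by norm_num))
  have h2i := (integrable_indicator_iff measurableSet_Ioi).2
    ((integrableOn_exp_mul_Ioi (a := -(1 / 4)) (by norm_num) 0).const_mul C)
  have key := integral_triangle hm h1i h2i fun ξ η hη hξ => ?_
  · have hinner : ∀ η, ∫ ζ in Set.Ioi (0 : ℝ), G (η + ζ) η
        = Real.exp (-η) * (shiftedGamma a x η * p η) := by
      intro η
      rw [shiftedGamma, ← integral_mul_const, ← integral_const_mul]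
      refine integral_congr_ae (Eventually.of_forall fun ζ => ?_)
      simp only [hG, gammaDensity]
      push_cast
      rw [add_sub_cancel_left, show -((1 + Complex.I * (x : ℂ)) * ζ)
        = -(ζ : ℂ) + -(Complex.I * ζ * x) by ring, Complex.exp_add,
        show -((η : ℂ) + ζ) = -η + -ζ by ring, Complex.exp_add]
      ring
    simp_rw [hinner] at key
    refine ⟨key.1, ?_⟩
    rw [← key.2]
    refine integral_congr_ae (Eventually.of_forall fun ξ => ?_)
    simp only [hG]
    rw [intervalIntegral.integral_const_mul]
  · rw [Set.indicator_of_mem (show ξ ∈ Set.Ioi (0 : ℝ) from hη.trans hξ),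
      Set.indicator_of_mem (show η ∈ Set.Ioi (0 : ℝ) from hη)]
    have hξ0 : 0 < ξ := hη.trans hξ
    have h4 : Complex.exp (-(Complex.I * (ξ - η) * x)) = Complex.exp ((-((ξ - η) * x) : ℝ) * Complex.I) := by
      congr 1
      push_cast
      ring
    simp only [hG]
    rw [norm_mul, norm_mul, h4, Complex.norm_exp_ofReal_mul_I, one_mul, Complex.norm_real,
      Real.norm_of_nonneg (by unfold gammaDensity; positivity), gammaDensity]
    have h5 := hb η
    rw [abs_of_pos hη] at h5
    calc ξ ^ (a - 1) * Real.exp (-ξ) * ‖p η‖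
        ≤ ξ ^ (a - 1) * Real.exp (-ξ) * (C * Real.exp (1 / 4 * η)) := by gcongr
      _ = ξ ^ (a - 1) * C * Real.exp (-ξ + 1 / 4 * η) := by rw [Real.exp_add]; ring
      _ ≤ ξ ^ (a - 1) * C * Real.exp (-(1 / 2) * ξ + -(1 / 4) * η) := by
          gcongr ?_ * Real.exp ?_
          linarith
      _ = _ := by rw [Real.exp_add]; ring

variable {ι : Type*} {e : HilbertBasis ι ℂ H} {l : ι → ℝ} {a ρ : ℝ}

lemma inner_coeff_fourierSeries (hU : IsUnitaryGroup D U) (R : H →L[ℂ] H) (hρ : 0 < ρ)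
    {φ : ℝ → ℂ} (hφ : ExpIntegrable ρ φ) (n : ℕ) (v w : H) :
    inner ℂ w (PowerSeries.coeff n (fourierSeries hU R hρ hφ) v)
      = ∫ ξ, φ ξ • inner ℂ w (duhamel U R n v ξ) := by
  rw [coeff_fourierSeries_apply]
  have h := (innerSL ℂ w).integral_comp_comm (integrable_smul_duhamel hU R hρ hφ n v)
  simp only [innerSL_apply_apply, inner_smul_right] at h
  rw [← h]
  rfl

lemma inner_coeff_gamma_zero (hU : IsUnitaryGroup D U) (he : IsEigenbasis D e l) (R : H →L[ℂ] H)
    (hρ : 0 < ρ) (hρ1 : ρ < 1) (ha : 0 < a) (v : H) (i : ι) :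
    inner ℂ (e i) (PowerSeries.coeff 0
        (fourierSeries hU R hρ (expIntegrable_gammaKernel ha hρ1)) v)
      = Real.Gamma a * (1 + Complex.I * l i) ^ (-(a : ℂ)) * inner ℂ (e i) v := by
  rw [inner_coeff_fourierSeries]
  simp_rw [inner_duhamel_zero hU he, smul_eq_mul, ← mul_assoc]
  rw [integral_mul_const, ← (hasIntegrableFourier_gammaKernel ha).2]

/-- In a coefficient of positive order of a Gamma function of `D + t R` the leftmost unitary
factor can be integrated explicitly: it contributes `shiftedGamma`, which decays in the
eigenvalue. -/
lemma inner_coeff_gamma_succ (hU : IsUnitaryGroup D U) (he : IsEigenbasis D e l) (R : H →L[ℂ] H)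
    (hρ : 0 < ρ) (hρ1 : ρ < 1) (ha : 0 < a) (n : ℕ) (v : H) (i : ι) :
    IntegrableOn (fun η => (Real.exp (-η) : ℂ) * (shiftedGamma a (l i) η *
      inner ℂ (e i) (R (duhamel U R n v (-η))))) (Set.Ioi 0) ∧
    inner ℂ (e i) (PowerSeries.coeff (n + 1)
        (fourierSeries hU R hρ (expIntegrable_gammaKernel ha hρ1)) v)
      = -Complex.I * ∫ η in Set.Ioi (0 : ℝ), Real.exp (-η) * (shiftedGamma a (l i) η *
        inner ℂ (e i) (R (duhamel U R n v (-η)))) := by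
  have hp : Continuous fun η => inner ℂ (e i) (R (duhamel U R n v (-η))) :=
    continuous_const.inner (R.continuous.comp ((continuous_duhamel hU R n v).comp continuous_neg))
  have hb : ∀ η, ‖inner ℂ (e i) (R (duhamel U R n v (-η)))‖
      ≤ (‖R‖ * ((‖R‖ / (1 / 4)) ^ n * ‖v‖)) * Real.exp (1 / 4 * |η|) := by
    intro η
    refine (norm_inner_le_norm _ _).trans ?_
    rw [e.orthonormal.1 i, one_mul]
    have := norm_duhamel_le_exp hU R (ρ := 1 / 4) (by norm_num) n v (-η)
    rw [abs_neg] at this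
    calc _ ≤ ‖R‖ * ‖duhamel U R n v (-η)‖ := R.le_opNorm _
      _ ≤ ‖R‖ * ((‖R‖ / (1 / 4)) ^ n * ‖v‖ * Real.exp (1 / 4 * |η|)) := by gcongr
      _ = _ := by ring
  have key := integral_gammaDensity_triangle ha hp hb (l i)
  refine ⟨key.1, ?_⟩
  rw [inner_coeff_fourierSeries, integral_gammaKernel_smul, ← key.2, ← integral_const_mul]
  refine integral_congr_ae (Eventually.of_forall fun ξ => ?_)
  simp only
  have hneg := intervalIntegral.integral_comp_neg (a := 0) (b := ξ) fun η =>
    Complex.exp (Complex.I * (((-ξ : ℝ) : ℂ) - η) * l i) * inner ℂ (e i) (R (duhamel U R n v η))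
  rw [neg_zero] at hneg
  rw [inner_duhamel_succ hU he, intervalIntegral.integral_symm, ← hneg, smul_eq_mul]
  have hexp : ∀ η : ℝ, Complex.I * (((-ξ : ℝ) : ℂ) - ((-η : ℝ) : ℂ)) * l i
      = -(Complex.I * (ξ - η) * l i) := fun η => by push_cast; ring
  simp_rw [hexp]
  ring

/-- Diagonal operators on finitely many basis vectors. -/
lemma norm_sum_mul_inner_smul_le (e : HilbertBasis ι ℂ H) (s : Finset ι) {c : ι → ℂ} {B : ℝ}
    (hB : 0 ≤ B) (hc : ∀ i ∈ s, ‖c i‖ ≤ B) (v : H) :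
    ‖∑ i ∈ s, (c i * inner ℂ (e i) v) • e i‖ ≤ B * ‖v‖ := by
  refine abs_le_of_sq_le_sq' ?_ (by positivity) |>.2
  have h1 : ‖∑ i ∈ s, (c i * inner ℂ (e i) v) • e i‖ ^ 2
      = ∑ i ∈ s, ‖c i * inner ℂ (e i) v‖ ^ 2 := by
    have h := e.orthonormal.inner_sum (fun i => c i * inner ℂ (e i) v)
      (fun i => c i * inner ℂ (e i) v) s
    rw [inner_self_eq_norm_sq_to_K] at h
    have h2 : ∀ z : ℂ, (starRingEnd ℂ) z * z = ((‖z‖ ^ 2 : ℝ) : ℂ) := fun z => by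
      rw [Complex.conj_mul']; push_cast; rfl
    simp_rw [h2] at h
    refine Complex.ofReal_injective ?_
    push_cast at h ⊢
    exact h
  rw [h1, mul_pow]
  calc ∑ i ∈ s, ‖c i * inner ℂ (e i) v‖ ^ 2 ≤ ∑ i ∈ s, B ^ 2 * ‖inner ℂ (e i) v‖ ^ 2 := by
        refine Finset.sum_le_sum fun i hi => ?_
        rw [norm_mul, mul_pow]
        have := hc i hi
        gcongr
    _ = B ^ 2 * ∑ i ∈ s, ‖inner ℂ (e i) v‖ ^ 2 := by rw [Finset.mul_sum]
    _ ≤ _ := by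
        have := e.orthonormal.sum_inner_products_le v (s := s)
        gcongr

lemma norm_shiftedGamma_le (ha : 0 < a) (ha1 : a < 1) {η : ℝ} (hη : 0 ≤ η) (x : ℝ) :
    ‖shiftedGamma a x η‖ ≤ (1 / a + 2) * ‖(x : ℂ) - Complex.I‖ ^ (-a) := by
  rw [← norm_one_add_I_mul]
  exact norm_integral_shifted_le ha ha1 hη x

/-- The constant in the decay estimate for the Gamma functions of the perturbed operator. -/
def gammaConst (a : ℝ) : ℝ := Real.Gamma a + (1 / a + 2)

/-- On the spectral subspace where `|D - i| ^ (-a) ≤ B`, the coefficients of the perturbed Gamma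
function are of size `B`. -/
lemma norm_finProj_coeff_gamma_le (hU : IsUnitaryGroup D U) (he : IsEigenbasis D e l)
    (R : H →L[ℂ] H) (hρ : 0 < ρ) (hρ1 : ρ < 1) (ha : 0 < a) (ha1 : a < 1) (s : Finset ι) {B : ℝ}
    (hB : 0 ≤ B) (hs : ∀ i ∈ s, ‖(l i : ℂ) - Complex.I‖ ^ (-a) ≤ B) (n : ℕ) (v : H) :
    ‖finProj e s (PowerSeries.coeff n
        (fourierSeries hU R hρ (expIntegrable_gammaKernel ha hρ1)) v)‖
      ≤ gammaConst a * B * (4 * ‖R‖) ^ n * ‖v‖ := by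
  have hΓ : 0 ≤ Real.Gamma a := (Real.Gamma_pos_of_pos ha).le
  have ha2 : 0 ≤ 1 / a + 2 := by positivity
  rw [finProj_apply]
  cases n with
  | zero =>
    simp_rw [inner_coeff_gamma_zero hU he R hρ hρ1 ha]
    refine (norm_sum_mul_inner_smul_le e s (B := gammaConst a * B)
      (mul_nonneg (add_nonneg hΓ ha2) hB) (fun i hi => ?_) v).trans (le_of_eq (by ring))
    rw [norm_mul, ← Complex.ofReal_neg, Complex.norm_cpow_real, norm_one_add_I_mul,
      Complex.norm_real, Real.norm_of_nonneg hΓ]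
    exact mul_le_mul (le_add_of_nonneg_right ha2) (hs i hi) (by positivity) (add_nonneg hΓ ha2)
  | succ n =>
    have hcoef := fun i => inner_coeff_gamma_succ hU he R hρ hρ1 ha n v i
    have hint : ∑ i ∈ s, inner ℂ (e i) (PowerSeries.coeff (n + 1)
          (fourierSeries hU R hρ (expIntegrable_gammaKernel ha hρ1)) v) • e i
        = -Complex.I • ∫ η in Set.Ioi (0 : ℝ), (Real.exp (-η) : ℂ) • ∑ i ∈ s,
          (shiftedGamma a (l i) η * inner ℂ (e i) (R (duhamel U R n v (-η)))) • e i := by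
      simp_rw [Finset.smul_sum, smul_smul]
      rw [integral_finsetSum _ fun i _ => (hcoef i).1.smul_const (e i), Finset.smul_sum]
      refine Finset.sum_congr rfl fun i _ => ?_
      rw [(hcoef i).2, integral_smul_const, smul_smul]
    rw [hint, norm_smul, norm_neg, Complex.norm_I, one_mul]
    have hbound : IntegrableOn (fun η : ℝ => gammaConst a * B * (‖R‖ * (4 * ‖R‖) ^ n) * ‖v‖ *
        Real.exp (-(3 / 4) * η)) (Set.Ioi 0) :=
      (integrableOn_exp_mul_Ioi (by norm_num) 0).const_mul _
    refine (norm_integral_le_of_norm_le hbound ?_).trans ?_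
    · filter_upwards [self_mem_ae_restrict measurableSet_Ioi] with η hη
      have hη : 0 < η := hη
      rw [norm_smul, Complex.norm_real, Real.norm_of_nonneg (Real.exp_pos _).le]
      have h1 := norm_sum_mul_inner_smul_le e s (c := fun i => shiftedGamma a (l i) η)
        (B := gammaConst a * B) (mul_nonneg (add_nonneg hΓ ha2) hB) (fun i hi =>
          (norm_shiftedGamma_le ha ha1 hη.le (l i)).trans (mul_le_mul
            (le_add_of_nonneg_left hΓ) (hs i hi) (by positivity) (add_nonneg hΓ ha2)))
        (R (duhamel U R n v (-η)))
      have h2 := norm_duhamel_le_exp hU R (ρ := 1 / 4) (by norm_num) n v (-η)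
      rw [abs_neg, abs_of_pos hη] at h2
      have hg : 0 ≤ gammaConst a := add_nonneg hΓ ha2
      calc _ ≤ Real.exp (-η) * (gammaConst a * B * (‖R‖ * ((‖R‖ / (1 / 4)) ^ n * ‖v‖ *
              Real.exp (1 / 4 * η)))) := by
            refine mul_le_mul_of_nonneg_left (h1.trans (mul_le_mul_of_nonneg_left
              ((R.le_opNorm _).trans ?_) (by positivity))) (Real.exp_pos _).le
            gcongr
        _ = gammaConst a * B * (‖R‖ * (4 * ‖R‖) ^ n) * ‖v‖ *
              Real.exp (-η + 1 / 4 * η) := by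
            rw [Real.exp_add, show ‖R‖ / (1 / 4) = 4 * ‖R‖ by ring]; ring
        _ = _ := by rw [show -η + 1 / 4 * η = -(3 / 4) * η by ring]
    · rw [integral_const_mul, integral_exp_mul_Ioi (by norm_num)]
      have hg : 0 ≤ gammaConst a := add_nonneg hΓ ha2
      have hnn : 0 ≤ gammaConst a * B * (‖R‖ * (4 * ‖R‖) ^ n) * ‖v‖ := by positivity
      calc _ = gammaConst a * B * (‖R‖ * (4 * ‖R‖) ^ n) * ‖v‖ * (4 / 3) := by norm_num
        _ ≤ gammaConst a * B * (‖R‖ * (4 * ‖R‖) ^ n) * ‖v‖ * 4 := by gcongr; norm_num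
        _ = _ := by ring

end Decay

end

/-! ### Dyadic spectral levels -/

section

variable {D : H →ₗ.[ℂ] H} {U : ℝ → H →L[ℂ] H} {R : H →L[ℂ] H}

section Levels

variable {ι : Type*} {e : HilbertBasis ι ℂ H} {l : ι → ℝ}

lemma hasSum_inner_smul (e : HilbertBasis ι ℂ H) (v : H) :
    HasSum (fun i => inner ℂ (e i) v • e i) v := by
  simpa only [e.repr_apply_apply] using e.hasSum_repr v

lemma tendsto_finProj (e : HilbertBasis ι ℂ H) (v : H) :
    Tendsto (fun J : Finset ι => finProj e J v) atTop (𝓝 v) := by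
  have h := hasSum_inner_smul e v
  simp_rw [finProj_apply]
  exact h

open Classical in
/-- A bound for the projections of `v` to all finite sets of basis vectors beyond the cutoff bounds
the part of `v` beyond the cutoff. -/
lemma norm_one_sub_cutoff_apply_le (e : HilbertBasis ι ℂ H) {L : ℕ → Finset ι}
    (hL : Pairwise fun i j => Disjoint (L i) (L j)) (j : ℕ) {v : H} {B : ℝ}
    (hB : ∀ s : Finset ι, (∀ i ∈ s, ∀ m < j, i ∉ L m) → ‖finProj e s v‖ ≤ B) :
    ‖(1 - cutoff e L j) v‖ ≤ B := by
  set A : Finset ι := (Finset.range j).biUnion L with hA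
  have hcut : cutoff e L j = finProj e A := by
    ext w
    rw [cutoff, sum_apply, finProj_apply, hA, Finset.sum_biUnion fun i _ k _ hik => hL hik]
    exact Finset.sum_congr rfl fun i _ => finProj_apply e (L i) w
  have hlim : Tendsto (fun J : Finset ι => ‖finProj e J v - finProj e A v‖) atTop
      (𝓝 ‖(1 - cutoff e L j) v‖) := by
    rw [hcut]
    exact ((tendsto_finProj e v).sub_const _).norm
  refine le_of_tendsto hlim ?_
  filter_upwards [eventually_ge_atTop A] with J hJ
  have : finProj e J v - finProj e A v = finProj e (J \ A) v := by
    rw [finProj_apply, finProj_apply, finProj_apply, ← Finset.sum_sdiff hJ, add_sub_cancel_right]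
  rw [this]
  refine hB _ fun i hi m hm him => ?_
  rw [Finset.mem_sdiff] at hi
  exact hi.2 (Finset.mem_biUnion.2 ⟨m, Finset.mem_range.2 hm, him⟩)

/-- The dyadic level of the eigenvalue `x`: the `j` with `2 ^ j ≤ |x - i| < 2 ^ (j + 1)`. -/
def dyadicLevel (x : ℝ) : ℕ := ⌊Real.logb 2 ‖(x : ℂ) - Complex.I‖⌋₊

lemma two_pow_dyadicLevel_le (x : ℝ) : (2 : ℝ) ^ dyadicLevel x ≤ ‖(x : ℂ) - Complex.I‖ := by
  have h1 := one_le_norm_sub_I x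
  have h := Nat.floor_le (Real.logb_nonneg one_lt_two h1)
  rw [Real.le_logb_iff_rpow_le one_lt_two (by linarith), Real.rpow_natCast] at h
  exact h

lemma norm_sub_I_lt (x : ℝ) : ‖(x : ℂ) - Complex.I‖ < (2 : ℝ) ^ (dyadicLevel x + 1) := by
  have h1 := one_le_norm_sub_I x
  have h := Nat.lt_floor_add_one (Real.logb 2 ‖(x : ℂ) - Complex.I‖)
  rw [Real.logb_lt_iff_lt_rpow one_lt_two (by linarith)] at h
  rw [← Real.rpow_natCast]
  exact_mod_cast h

variable {s : ℝ}

lemma finite_dyadicLevel (hs : 0 < s) (hsum : Summable fun i => ‖(l i : ℂ) - Complex.I‖ ^ (-s))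
    (j : ℕ) : {i | dyadicLevel (l i) = j}.Finite := by
  have h2 : (0 : ℝ) < (2 ^ (j + 1)) ^ (-s) := by positivity
  have h := hsum.tendsto_cofinite_zero.eventually (gt_mem_nhds h2)
  refine (eventually_cofinite.1 h).subset fun i hi hlt => ?_
  have hi : dyadicLevel (l i) = j := hi
  have h3 := norm_sub_I_lt (l i)
  rw [hi] at h3
  have h1 := one_le_norm_sub_I (l i)
  exact absurd hlt (not_lt.2 (Real.rpow_le_rpow_of_nonpos (by linarith) h3.le (by linarith)))

/-- The indices of the eigenvalues at the dyadic level `j`. -/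
def dyadicSet (hs : 0 < s) (hsum : Summable fun i => ‖(l i : ℂ) - Complex.I‖ ^ (-s)) (j : ℕ) :
    Finset ι := (finite_dyadicLevel hs hsum j).toFinset

lemma mem_dyadicSet (hs : 0 < s) (hsum : Summable fun i => ‖(l i : ℂ) - Complex.I‖ ^ (-s)) {j : ℕ}
    {i : ι} : i ∈ dyadicSet hs hsum j ↔ dyadicLevel (l i) = j := by
  simp [dyadicSet]

lemma disjoint_dyadicSet (hs : 0 < s)
    (hsum : Summable fun i => ‖(l i : ℂ) - Complex.I‖ ^ (-s)) :
    Pairwise fun i j => Disjoint (dyadicSet hs hsum i) (dyadicSet hs hsum j) := by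
  intro i j hij
  rw [Finset.disjoint_left]
  intro a h1 h2
  rw [mem_dyadicSet] at h1 h2
  exact hij (h1.symm.trans h2)

/-- The summability of `|λ - i| ^ (-s)` in dyadic form. -/
lemma summable_card_dyadicSet (hs : 0 < s)
    (hsum : Summable fun i => ‖(l i : ℂ) - Complex.I‖ ^ (-s)) {k : ℕ} (hk : 0 < k) :
    Summable fun j => (dyadicSet hs hsum j).card * ((2 : ℝ) ^ (-(s / k))) ^ (j * k) := by
  classical
  have hterm : ∀ j, (dyadicSet hs hsum j).card * ((2 : ℝ) ^ (-(s / k))) ^ (j * k)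
      ≤ 2 ^ s * ∑ i ∈ dyadicSet hs hsum j, ‖(l i : ℂ) - Complex.I‖ ^ (-s) := by
    intro j
    rw [← nsmul_eq_mul, ← Finset.sum_const, Finset.mul_sum]
    refine Finset.sum_le_sum fun i hi => ?_
    rw [mem_dyadicSet] at hi
    have h1 := one_le_norm_sub_I (l i)
    have h3 := norm_sub_I_lt (l i)
    rw [hi] at h3
    have hk' : (k : ℝ) ≠ 0 := by exact_mod_cast hk.ne'
    have h4 : ((2 : ℝ) ^ (-(s / k))) ^ (j * k) = 2 ^ s * ((2 : ℝ) ^ (j + 1)) ^ (-s) := by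
      rw [← Real.rpow_natCast, ← Real.rpow_natCast, ← Real.rpow_mul zero_le_two,
        ← Real.rpow_mul zero_le_two, ← Real.rpow_add two_pos]
      congr 1
      push_cast
      field_simp
      ring
    rw [h4]
    exact mul_le_mul_of_nonneg_left
      (Real.rpow_le_rpow_of_nonpos (by linarith) h3.le (by linarith)) (by positivity)
  refine summable_of_sum_range_le
    (c := 2 ^ s * ∑' i, ‖(l i : ℂ) - Complex.I‖ ^ (-s)) (fun j => by positivity) fun N => ?_
  refine (Finset.sum_le_sum fun j _ => hterm j).trans ?_
  rw [← Finset.mul_sum, ← Finset.sum_biUnion fun i _ j _ hij => disjoint_dyadicSet hs hsum hij]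
  gcongr
  exact hsum.sum_le_tsum _ fun i _ => by positivity

/-- The perturbed Gamma functions decay along the dyadic levels, uniformly on bounded sets of
perturbations. -/
lemma cutoffDecay_gamma (hU : IsUnitaryGroup D U) (he : IsEigenbasis D e l) {ρ a M : ℝ}
    (hs : 0 < s) (hsum : Summable fun i => ‖(l i : ℂ) - Complex.I‖ ^ (-s))
    (hρ : 0 < ρ) (hρ1 : ρ < 1) (ha : 0 < a) (ha1 : a < 1) (hR : ‖R‖ ≤ M) :
    CutoffDecay e (dyadicSet hs hsum) (fourierSeries hU R hρ (expIntegrable_gammaKernel ha hρ1))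
      (gammaConst a) (2 ^ (-a)) (4 * M) := by
  intro j n
  have hg : 0 ≤ gammaConst a :=
    add_nonneg (Real.Gamma_pos_of_pos ha).le (by positivity)
  have hM : 0 ≤ M := (norm_nonneg _).trans hR
  rw [PowerSeries.coeff_C_mul]
  refine ContinuousLinearMap.opNorm_le_bound _ (by positivity) fun v => ?_
  rw [mul_apply_eq_comp]
  refine norm_one_sub_cutoff_apply_le e (disjoint_dyadicSet hs hsum) j fun t ht => ?_
  refine (norm_finProj_coeff_gamma_le hU he R hρ hρ1 ha ha1 t (B := (2 ^ (-a)) ^ j)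
    (by positivity) (fun i hi => ?_) n v).trans (by gcongr)
  have h1 : j ≤ dyadicLevel (l i) := by
    by_contra! hlt
    exact ht i hi _ hlt ((mem_dyadicSet hs hsum).2 rfl)
  have h2 : (2 : ℝ) ^ j ≤ ‖(l i : ℂ) - Complex.I‖ :=
    (pow_le_pow_right₀ one_le_two h1).trans (two_pow_dyadicLevel_le _)
  refine (Real.rpow_le_rpow_of_nonpos (by positivity) h2 (by linarith)).trans (le_of_eq ?_)
  rw [← Real.rpow_natCast, ← Real.rpow_natCast, ← Real.rpow_mul zero_le_two,
    ← Real.rpow_mul zero_le_two, mul_comm]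

end Levels

end

/-! ### The resolvent of a self-adjoint operator -/

section

variable {D : H →ₗ.[ℂ] H} {S : H →L[ℂ] H} {s : ℝ}

section Resolvent

open ContinuousLinearMap

lemma symmetric_of_isSelfAdjoint (hD : IsSelfAdjoint D) (x y : D.domain) :
    inner ℂ (D x) (y : H) = inner ℂ (x : H) (D y) := by
  have h := LinearPMap.adjoint_isFormalAdjoint hD.dense_domain
  rw [LinearPMap.isSelfAdjoint_def.1 hD] at h
  exact h x y

namespace IsResolvent

variable (hS : IsResolvent D Complex.I S)
include hS

lemma mem_domain (v : H) : S v ∈ D.domain := (hS.1 v).1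

lemma apply_eq (v : H) : D ⟨S v, hS.mem_domain v⟩ = v + Complex.I • S v :=
  eq_add_of_sub_eq (hS.1 v).2

lemma injective : Function.Injective S := by
  rw [injective_iff_map_eq_zero]
  intro v hv
  have h := hS.apply_eq v
  have h0 : (⟨S v, hS.mem_domain v⟩ : D.domain) = 0 := Subtype.ext hv
  rw [h0, hv, LinearPMap.map_zero, smul_zero, add_zero] at h
  exact h.symm

lemma sub_star (hD : IsSelfAdjoint D) : S - star S = (2 * Complex.I) • (star S * S) := by
  ext w
  refine ext_inner_left ℂ fun v => ?_
  have h := symmetric_of_isSelfAdjoint hD ⟨S v, hS.mem_domain v⟩ ⟨S w, hS.mem_domain w⟩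
  rw [hS.apply_eq, hS.apply_eq] at h
  simp only [inner_add_left, inner_add_right, inner_smul_left, inner_smul_right,
    Complex.conj_I] at h
  simp only [sub_apply, smul_apply, mul_apply_eq_comp, star_eq_adjoint, inner_sub_right,
    inner_smul_right, adjoint_inner_right]
  linear_combination h

/-- The Cayley transform of `D`. -/
lemma cayley_mem_unitary (hD : IsSelfAdjoint D) :
    1 + (2 * Complex.I) • S ∈ unitary (H →L[ℂ] H) := by
  set W : H →L[ℂ] H := 1 + (2 * Complex.I) • S with hW
  have hWs : star W = 1 - (2 * Complex.I) • star S := by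
    rw [hW, star_add, star_one, star_smul, sub_eq_add_neg, ← neg_smul]
    congr 2
    simp
  have h1 : star W * W = 1 := by
    have h := hS.sub_star hD
    rw [hWs, hW, sub_mul, one_mul, mul_add, mul_one, smul_mul_smul_comm]
    have h2 : (2 * Complex.I) * (2 * Complex.I) = (-4 : ℂ) := by
      linear_combination 4 * Complex.I_mul_I
    have h3 : (2 * Complex.I) • (S - star S) = (-4 : ℂ) • (star S * S) := by
      rw [h, smul_smul, h2]
    rw [smul_sub] at h3
    rw [h2, ← h3]
    abel
  -- the range of `W` is dense because `i` is not an eigenvalue of `D`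
  have hinj : Function.Injective (star W : H →L[ℂ] H) := by
    rw [injective_iff_map_eq_zero]
    intro v hv
    have hx : ∀ x : D.domain, inner ℂ (Complex.I • v) (x : H) = inner ℂ v (D x) := by
      intro x
      have h2 : inner ℂ (star W v) (D x - Complex.I • (x : H)) = 0 := by rw [hv, inner_zero_left]
      rw [star_eq_adjoint, adjoint_inner_left, hW, add_apply, smul_apply, one_apply_eq_self,
        hS.2 x, inner_add_right, inner_sub_right, inner_smul_right, inner_smul_right] at h2
      rw [inner_smul_left, Complex.conj_I]
      linear_combination -h2
    have hmem : v ∈ D.domain := by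
      rw [← LinearPMap.isSelfAdjoint_def.1 hD]
      exact LinearPMap.mem_adjoint_domain_of_exists _ ⟨_, hx⟩
    have hDv : D ⟨v, hmem⟩ = Complex.I • v := by
      refine hD.dense_domain.eq_of_inner_left ℂ fun x hxm => ?_
      rw [symmetric_of_isSelfAdjoint hD ⟨v, hmem⟩ ⟨x, hxm⟩]
      exact (hx ⟨x, hxm⟩).symm
    have h2 := hS.2 ⟨v, hmem⟩
    rw [hDv, sub_self, map_zero] at h2
    exact h2.symm
  refine Unitary.mem_iff.2 ⟨h1, ?_⟩
  ext v
  apply hinj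
  have h2 : star W * (W * star W) = star W := by rw [← mul_assoc, h1, one_mul]
  exact congrArg (fun T : H →L[ℂ] H => T v) h2

lemma isStarNormal (hD : IsSelfAdjoint D) : IsStarNormal S := by
  have hW := hS.cayley_mem_unitary hD
  have h : S = (2 * Complex.I)⁻¹ • ((1 + (2 * Complex.I) • S) - 1) := by
    rw [add_sub_cancel_left, smul_smul, inv_mul_cancel₀ (by simp), one_smul]
  set W : H →L[ℂ] H := 1 + (2 * Complex.I) • S with hW'
  have hc : Commute (star W) W := by
    rw [Commute, SemiconjBy, (Unitary.mem_iff.1 hW).1, (Unitary.mem_iff.1 hW).2]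
  rw [h]
  refine ⟨?_⟩
  rw [star_smul, star_sub, star_one]
  exact (((hc.sub_left (Commute.one_left _)).sub_right
    ((Commute.one_right _))).smul_left _).smul_right _

/-- The spectrum of the Cayley transform lies on the unit circle. -/
lemma eq_zero_or_im_pos (hD : IsSelfAdjoint D) {z : ℂ} (hz : z ∈ spectrum ℂ S) :
    z = 0 ∨ 0 < z.im := by
  have hW := hS.cayley_mem_unitary hD
  have h1 : 1 + 2 * Complex.I * z ∈ spectrum ℂ (1 + (2 * Complex.I) • S) := by
    have h := spectrum.subset_polynomial_aeval S
      (1 + Polynomial.C (2 * Complex.I) * Polynomial.X) ⟨z, hz, rfl⟩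
    simpa [Algebra.smul_def] using h
  have h2 := spectrum.subset_circle_of_unitary hW h1
  rw [mem_sphere_zero_iff_norm] at h2
  have h3 : Complex.normSq (1 + 2 * Complex.I * z) = 1 := by
    rw [Complex.normSq_eq_norm_sq, h2, one_pow]
  rw [Complex.normSq_apply] at h3
  simp at h3
  by_cases him : 0 < z.im
  · exact Or.inr him
  · left
    apply Complex.ext
    · simp only [Complex.zero_re]; nlinarith [sq_nonneg z.re, sq_nonneg z.im]
    · simp only [Complex.zero_im]; nlinarith [sq_nonneg z.re, sq_nonneg z.im]

lemma continuousOn_cpow (hD : IsSelfAdjoint D) (hs : 0 < s) :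
    ContinuousOn (fun z : ℂ => z ^ (s : ℂ)) (spectrum ℂ S) := by
  intro z hz
  refine ContinuousAt.continuousWithinAt ?_
  rcases hS.eq_zero_or_im_pos hD hz with rfl | h
  · exact Complex.continuousAt_cpow_zero_of_re_pos (by simpa using hs) |>.comp
      (f := fun z : ℂ => (z, (s : ℂ))) (by fun_prop)
  · exact continuousAt_id.cpow continuousAt_const (Or.inr h.ne')

end IsResolvent

end Resolvent

/-! ### An orthonormal basis of eigenvectors -/

section EigenbasisExistence

open ContinuousLinearMap

lemma IsTraceClass.isCompactOperator {T : H →L[ℂ] H} (hT : IsTraceClass T) :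
    IsCompactOperator T := by
  obtain ⟨x, y, h1, h2⟩ := hT
  have hsum : Summable fun k => InnerProductSpace.rankOne ℂ (y k) (x k) := by
    refine Summable.of_norm_bounded h1 fun k => ?_
    rw [InnerProductSpace.norm_rankOne, mul_comm]
  have hT : T = ∑' k, InnerProductSpace.rankOne ℂ (y k) (x k) := by
    ext v
    have h3 := (ContinuousLinearMap.apply ℂ H v).hasSum hsum.hasSum
    refine (h2 v).unique ?_
    simpa using h3
  rw [hT]
  refine isCompactOperator_of_tendsto hsum.hasSum.tendsto_sum_nat
    (Eventually.of_forall fun n => ?_)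
  induction n with
  | zero => simpa using isCompactOperator_zero
  | succ n ih =>
    rw [Finset.sum_range_succ]
    refine IsCompactOperator.add ih ?_
    have hr : (InnerProductSpace.rankOne ℂ (y n) (x n) : H → H)
        = (ContinuousLinearMap.toSpanSingleton ℂ (y n)) ∘ (innerSL ℂ (x n)) := by
      ext v; simp
    change IsCompactOperator (InnerProductSpace.rankOne ℂ (y n) (x n) : H → H)
    rw [hr]
    exact (isCompactOperator_of_locallyCompactSpace_dom (innerSL ℂ (x n))).clm_comp _

namespace IsResolvent

variable (hS : IsResolvent D Complex.I S)
include hS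

/-- A further power of `S` is a multiple of `S ^ s`, and powers of the resolvent are injective. -/
lemma cfc_cpow_injective (hD : IsSelfAdjoint D) (hs : 0 ≤ s) :
    Function.Injective (cfc (fun z : ℂ => z ^ (s : ℂ)) S : H →L[ℂ] H) := by
  have hn := hS.isStarNormal hD
  rcases hs.eq_or_lt with rfl | hs
  · have : (fun z : ℂ => z ^ ((0 : ℝ) : ℂ)) = fun _ => 1 := by simp
    rw [this, cfc_const_one ℂ S]
    exact Function.injective_id
  · obtain ⟨N, hN⟩ := exists_nat_gt s
    have hpow : S ^ N = cfc (fun z : ℂ => z ^ ((N - s : ℝ) : ℂ)) S *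
        cfc (fun z : ℂ => z ^ (s : ℂ)) S := by
      rw [← cfc_mul _ _ S (hS.continuousOn_cpow hD (sub_pos.2 hN)) (hS.continuousOn_cpow hD hs),
        ← cfc_pow_id (R := ℂ) S N]
      refine cfc_congr fun z _ => ?_
      by_cases hz : z = 0
      · have hN0 : N ≠ 0 := by
          rintro rfl
          rw [Nat.cast_zero] at hN
          linarith
        rw [hz, zero_pow hN0, Complex.zero_cpow (Complex.ofReal_ne_zero.2 hs.ne'), mul_zero]
      · rw [← Complex.cpow_add _ _ hz, Complex.ofReal_sub, sub_add_cancel, Complex.ofReal_natCast,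
          Complex.cpow_natCast]
    have hinj : Function.Injective (S ^ N : H →L[ℂ] H) := by
      rw [FunLike.coe_pow_eq_iterate]
      exact hS.injective.iterate N
    intro v w hvw
    apply hinj
    rw [hpow, mul_apply_eq_comp, mul_apply_eq_comp, hvw]

lemma apply_of_eigen {x : H} {a : ℝ} (hx : x ∈ D.domain) (h : D ⟨x, hx⟩ = (a : ℂ) • x) :
    S x = ((a : ℂ) - Complex.I)⁻¹ • x := by
  have h1 := hS.2 ⟨x, hx⟩
  rw [h] at h1
  simp only at h1
  rw [← sub_smul, map_smul] at h1
  have h0 : (a : ℂ) - Complex.I ≠ 0 := norm_pos_iff.1 (by linarith [one_le_norm_sub_I a])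
  rw [eq_inv_smul_iff₀ h0, h1]

lemma eigen_of_apply {x : H} {a : ℝ} (h : S x = ((a : ℂ) - Complex.I)⁻¹ • x) :
    ∃ hx : x ∈ D.domain, D ⟨x, hx⟩ = (a : ℂ) • x := by
  have h0 : (a : ℂ) - Complex.I ≠ 0 := norm_pos_iff.1 (by linarith [one_le_norm_sub_I a])
  have h1 : x = S (((a : ℂ) - Complex.I) • x) := by
    rw [map_smul, h, smul_smul, mul_inv_cancel₀ h0, one_smul]
  have hx : x ∈ D.domain := by rw [h1]; exact hS.mem_domain _
  refine ⟨hx, ?_⟩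
  have h2 := hS.apply_eq (((a : ℂ) - Complex.I) • x)
  have h3 : (⟨x, hx⟩ : D.domain) = ⟨_, hS.mem_domain (((a : ℂ) - Complex.I) • x)⟩ := Subtype.ext h1
  rw [h3, h2, ← h1]
  module

/-- On a finite dimensional subspace that is invariant under the resolvent, `D` is a symmetric
operator, and its eigenvectors span. -/
lemma eq_zero_of_finiteDimensional (hD : IsSelfAdjoint D) (E : Submodule ℂ H)
    [FiniteDimensional ℂ E] (hE : ∀ x ∈ E, S x ∈ E) {v : H}
    (hv : ∀ (a : ℝ) (x : H), S x = ((a : ℂ) - Complex.I)⁻¹ • x → inner ℂ v x = 0) {x : H}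
    (hx : x ∈ E) : inner ℂ v x = 0 := by
  set SE : E →ₗ[ℂ] E := (S : H →ₗ[ℂ] H).restrict hE with hSE
  have hinj : Function.Injective SE := fun a b hab =>
    Subtype.ext (hS.injective (congrArg Subtype.val hab))
  set Q : E ≃ₗ[ℂ] E := LinearEquiv.ofInjectiveEndo SE hinj with hQ
  have hSQ : ∀ y : E, S (Q.symm y : H) = y := fun y => by
    have : Q (Q.symm y) = y := Q.apply_symm_apply y
    exact congrArg Subtype.val this
  -- the operator `A = S⁻¹ + i` is the restriction of `D` to `E`
  set A : E →ₗ[ℂ] E := Q.symm.toLinearMap + Complex.I • LinearMap.id with hA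
  have hAD : ∀ y : E, ∃ hy : (y : H) ∈ D.domain, D ⟨y, hy⟩ = (A y : H) := by
    intro y
    have hy : (y : H) ∈ D.domain := by rw [← hSQ y]; exact hS.mem_domain _
    refine ⟨hy, ?_⟩
    have h2 := hS.apply_eq (Q.symm y : H)
    have h3 : (⟨y, hy⟩ : D.domain) = ⟨_, hS.mem_domain (Q.symm y : H)⟩ :=
      Subtype.ext (hSQ y).symm
    rw [h3, h2, hSQ]
    rfl
  have hsym : A.IsSymmetric := by
    intro y z
    obtain ⟨hy, hyA⟩ := hAD y
    obtain ⟨hz, hzA⟩ := hAD z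
    rw [Submodule.coe_inner, Submodule.coe_inner, ← hyA, ← hzA]
    exact symmetric_of_isSelfAdjoint hD ⟨y, hy⟩ ⟨z, hz⟩
  set b := hsym.eigenvectorBasis rfl with hb
  have hbi : ∀ i, inner ℂ v (b i : H) = 0 := by
    intro i
    obtain ⟨hy, hyA⟩ := hAD (b i)
    have h1 : (A (b i) : H) = ((hsym.eigenvalues rfl i : ℝ) : ℂ) • (b i : H) :=
      congrArg Subtype.val (hsym.apply_eigenvectorBasis rfl i)
    exact hv (hsym.eigenvalues rfl i) _ (hS.apply_of_eigen hy (hyA.trans h1))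
  have hsum := b.sum_repr ⟨x, hx⟩
  have : x = ∑ i, b.repr ⟨x, hx⟩ i • (b i : H) := by
    have := congrArg (Submodule.subtype E) hsum
    rw [map_sum] at this
    exact this.symm
  rw [this, inner_sum]
  exact Finset.sum_eq_zero fun i _ => by rw [inner_smul_right, hbi, mul_zero]

lemma commute_cfc (hD : IsSelfAdjoint D) (g : ℂ → ℂ) : Commute S (cfc g S) := by
  have hn := hS.isStarNormal hD
  exact Commute.cfc (Commute.refl S) hn.star_comm_self.symm.symm g |>.symm

/-- The eigenvectors of `D` span a dense subspace: the eigenspaces of the compact operator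
`|(D - i) ^ (-s)| ^ 2` are finite dimensional and invariant under the resolvent. -/
lemma eq_zero_of_forall_inner_eigen (hD : IsSelfAdjoint D) (hs : 0 ≤ s)
    (hT : IsTraceClass (cfc (fun z : ℂ => z ^ (s : ℂ)) S)) {v : H}
    (hv : ∀ (a : ℝ) (x : H), S x = ((a : ℂ) - Complex.I)⁻¹ • x → inner ℂ v x = 0) : v = 0 := by
  have hn := hS.isStarNormal hD
  set T := cfc (fun z : ℂ => z ^ (s : ℂ)) S with hTdef
  set K : H →L[ℂ] H := star T * T with hK
  have hKc : IsCompactOperator K := hT.isCompactOperator.clm_comp (star T)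
  have hKs : K.IsSymmetric := (IsSelfAdjoint.star_mul_self T).isSymmetric
  have hKinj : Function.Injective K := by
    rw [injective_iff_map_eq_zero]
    intro w hw
    refine hS.cfc_cpow_injective hD hs (?_ : T w = T 0)
    rw [map_zero T, ← inner_self_eq_zero (𝕜 := ℂ)]
    have : inner ℂ w (K w) = 0 := by rw [hw, inner_zero_right]
    rwa [hK, mul_apply_eq_comp, star_eq_adjoint, adjoint_inner_right] at this
  -- `S` is normal, so it commutes with the functions of `S` and their adjoints
  have hcomm : Commute S K := by
    have h1 := hS.commute_cfc hD fun z : ℂ => z ^ (s : ℂ)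
    have h2 : Commute S (star T) := by
      rw [hTdef, ← cfc_star]
      exact hS.commute_cfc hD _
    exact h2.mul_right h1
  have hperp : v ∈ (⨆ μ, Module.End.eigenspace (K : Module.End ℂ H) μ)ᗮ := by
    rw [Submodule.mem_orthogonal']
    intro u hu
    refine Submodule.iSup_induction _ (motive := fun u => inner ℂ v u = 0) hu
      (fun μ x hx => ?_) (inner_zero_right _) fun x y hx hy => by rw [inner_add_right, hx, hy, add_zero]
    by_cases hμ : μ = 0
    · have hx0 : K x = 0 := by
        have := Module.End.mem_eigenspace_iff.1 hx
        rwa [hμ, zero_smul] at this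
      rw [hKinj (hx0.trans (map_zero K).symm), inner_zero_right]
    · have hfin := finite_dimensional_eigenspace hKc μ hμ
      refine hS.eq_zero_of_finiteDimensional hD
        (Module.End.eigenspace (K : Module.End ℂ H) μ) (fun y hy => ?_) hv hx
      rw [Module.End.mem_eigenspace_iff] at hy ⊢
      have hy' : K y = μ • y := hy
      have h1 : K (S y) = S (K y) := (congrArg (fun A : H →L[ℂ] H => A y) hcomm.eq).symm
      change K (S y) = μ • S y
      rw [h1, hy', map_smul]
  rw [orthogonalComplement_iSup_eigenspaces_eq_bot hKc hKs] at hperp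
  exact (Submodule.mem_bot ℂ).1 hperp

/-- A self-adjoint operator with trace class `(D - i) ^ (-s)` has an orthonormal basis of
eigenvectors. -/
theorem exists_eigenbasis (hD : IsSelfAdjoint D) (hs : 0 ≤ s)
    (hT : IsTraceClass (cfc (fun z : ℂ => z ^ (s : ℂ)) S)) :
    ∃ (w : Set H) (e : HilbertBasis w ℂ H) (l : w → ℝ), IsEigenbasis D e l := by
  -- the eigenspaces of `D`, described through its resolvent; the basis is the union of bases of
  -- them
  set G : ℝ → Submodule ℂ H := fun a =>
    Module.End.eigenspace (S : Module.End ℂ H) ((a : ℂ) - Complex.I)⁻¹ with hG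
  have hmem : ∀ a x, x ∈ G a ↔ S x = ((a : ℂ) - Complex.I)⁻¹ • x := fun a x =>
    Module.End.mem_eigenspace_iff
  have hcomplete : ∀ a, CompleteSpace (G a) := by
    intro a
    have : IsClosed (G a : Set H) := by
      have : (G a : Set H) = {x | S x = ((a : ℂ) - Complex.I)⁻¹ • x} := Set.ext (hmem a)
      rw [this]
      exact isClosed_eq S.continuous (continuous_const_smul _)
    exact this.completeSpace_coe
  have hfam : OrthogonalFamily ℂ (fun a => G a) fun a => (G a).subtypeₗᵢ := by
    intro a b hab x y
    obtain ⟨hx, hDx⟩ := hS.eigen_of_apply ((hmem a x).1 x.2)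
    obtain ⟨hy, hDy⟩ := hS.eigen_of_apply ((hmem b y).1 y.2)
    have h := symmetric_of_isSelfAdjoint hD ⟨x, hx⟩ ⟨y, hy⟩
    rw [hDx, hDy, inner_smul_left, inner_smul_right, Complex.conj_ofReal] at h
    have h2 : ((a : ℂ) - b) * inner ℂ (x : H) (y : H) = 0 := by linear_combination h
    rcases mul_eq_zero.1 h2 with h3 | h3
    · exact absurd (Complex.ofReal_injective (sub_eq_zero.1 h3)) hab
    · exact h3
  choose w b hb using fun a => exists_hilbertBasis ℂ (G a)
  set V : (Σ a, w a) → H := fun p => (G p.1).subtypeₗᵢ (b p.1 p.2) with hV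
  have hVo : Orthonormal ℂ V := hfam.orthonormal_sigma_orthonormal fun a => (b a).orthonormal
  have hbot : (Submodule.span ℂ (Set.range (Subtype.val : Set.range V → H)))ᗮ = ⊥ := by
    rw [Subtype.range_coe, Submodule.eq_bot_iff]
    intro v hv
    refine hS.eq_zero_of_forall_inner_eigen hD hs hT fun a x hx => ?_
    have h1 := (hasSum_inner_smul (b a) ⟨x, (hmem a x).2 hx⟩).mapL
      ((innerSL ℂ v).comp (G a).subtypeL)
    refine h1.unique ?_
    convert hasSum_zero with i
    have h2 := (Submodule.mem_orthogonal' _ _).1 hv (V ⟨a, i⟩) (Submodule.subset_span ⟨_, rfl⟩)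
    have h3 : inner ℂ v ((b a i : G a) : H) = 0 := h2
    simp [h3]
  have key : ∀ j : Set.range V, ∃ a : ℝ, ∃ h : (j : H) ∈ D.domain, D ⟨j, h⟩ = (a : ℂ) • (j : H) := by
    rintro ⟨_, ⟨p, rfl⟩⟩
    exact ⟨p.1, hS.eigen_of_apply ((hmem p.1 _).1 (b p.1 p.2).2)⟩
  choose l hl using key
  refine ⟨Set.range V, HilbertBasis.mkOfOrthogonalEqBot hVo.toSubtypeRange hbot, l, fun j => ?_⟩
  rw [HilbertBasis.coe_mkOfOrthogonalEqBot]
  exact hl j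

end IsResolvent

end EigenbasisExistence

end

/-! ### Summability of the eigenvalues -/

section

variable {D : H →ₗ.[ℂ] H} {S : H →L[ℂ] H} {s : ℝ}

section Eigenvalues

open ContinuousLinearMap

/-- The continuous functional calculus on a common eigenvector of `S` and its adjoint. -/
lemma cfc_apply_eigenvector (hn : IsStarNormal S) {x : H} {μ : ℂ} (hx0 : x ≠ 0) (hx : S x = μ • x)
    (hx' : star S x = star μ • x) {g : ℂ → ℂ} (hg : ContinuousOn g (spectrum ℂ S)) :
    cfc g S x = g μ • x := by
  have hμ : μ ∈ spectrum ℂ S := by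
    rw [spectrum.mem_iff]
    intro hu
    have hinj : Function.Injective (algebraMap ℂ (H →L[ℂ] H) μ - S : H →L[ℂ] H) := by
      obtain ⟨B, hB⟩ := hu.exists_left_inv
      intro a b hab
      have h1 := congrArg (fun z => B z) hab
      have h2 : ∀ z, B ((algebraMap ℂ (H →L[ℂ] H) μ - S) z) = z := fun z =>
        congrArg (fun A : H →L[ℂ] H => A z) hB
      simpa only [h2] using h1
    refine hx0 (hinj ?_)
    rw [map_zero, sub_apply, hx, Algebra.algebraMap_eq_smul_one, smul_apply, one_apply_eq_self,
      sub_self]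
  rw [cfc_apply g S hn hg]
  suffices h : ∀ f : C(spectrum ℂ S, ℂ), cfcHom hn f x = f ⟨μ, hμ⟩ • x from h _
  intro f
  induction f using ContinuousMap.induction_on_of_compact with
  | const r =>
    have : ContinuousMap.const (spectrum ℂ S) r = algebraMap ℂ C(spectrum ℂ S, ℂ) r := rfl
    rw [this, AlgHomClass.commutes, Algebra.algebraMap_eq_smul_one, smul_apply, one_apply_eq_self]
    rfl
  | id =>
    rw [cfcHom_id hn]
    exact hx
  | star_id =>
    rw [map_star, cfcHom_id hn]
    exact hx'
  | add f g hf hg => rw [map_add, add_apply, hf, hg, ContinuousMap.add_apply, add_smul]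
  | mul f g hf hg =>
    rw [map_mul, mul_apply_eq_comp, hg, map_smul, hf, smul_smul, ContinuousMap.mul_apply, mul_comm]
  | frequently f h =>
    refine h.mem_of_closed (s := {f | cfcHom hn f x = f ⟨μ, hμ⟩ • x}) (isClosed_eq ?_ ?_)
    · exact (ContinuousLinearMap.apply ℂ H x).continuous.comp (cfcHom_continuous hn)
    · exact (continuous_eval_const _).smul continuous_const

namespace IsResolvent

variable (hS : IsResolvent D Complex.I S)
include hS

lemma star_apply_of_eigen (hD : IsSelfAdjoint D) {x : H} {a : ℝ}
    (h : S x = ((a : ℂ) - Complex.I)⁻¹ • x) : star S x = star ((a : ℂ) - Complex.I)⁻¹ • x := by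
  have h1 := congrArg (fun A : H →L[ℂ] H => A x) (hS.sub_star hD)
  simp only [sub_apply, smul_apply, mul_apply_eq_comp, h, map_smul] at h1
  have h0 : (a : ℂ) - Complex.I ≠ 0 := norm_pos_iff.1 (by linarith [one_le_norm_sub_I a])
  have h2 : (a : ℂ) + Complex.I ≠ 0 := by
    intro h3
    have := congrArg Complex.im h3
    simp at this
  have h3 : star ((a : ℂ) - Complex.I)⁻¹ = ((a : ℂ) + Complex.I)⁻¹ := by simp
  rw [h3, eq_inv_smul_iff₀ h2]
  have h4 := congrArg (fun y => ((a : ℂ) - Complex.I) • y) h1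
  simp only [smul_sub, smul_smul] at h4
  rw [mul_inv_cancel₀ h0, one_smul, mul_left_comm, mul_inv_cancel₀ h0, mul_one] at h4
  rw [sub_eq_iff_eq_add] at h4
  refine Eq.trans ?_ h4.symm
  rw [← add_smul]
  congr 1
  ring

/-- Trace class powers of the resolvent have summable eigenvalues. -/
theorem summable_norm_rpow (hD : IsSelfAdjoint D) (hs : 0 ≤ s)
    (hT : IsTraceClass (cfc (fun z : ℂ => z ^ (s : ℂ)) S)) {ι : Type*} {e : HilbertBasis ι ℂ H}
    {l : ι → ℝ} (he : IsEigenbasis D e l) :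
    Summable fun i => ‖(l i : ℂ) - Complex.I‖ ^ (-s) := by
  have hn := hS.isStarNormal hD
  have hcont : ContinuousOn (fun z : ℂ => z ^ (s : ℂ)) (spectrum ℂ S) := by
    rcases hs.eq_or_lt with rfl | hs
    · simp only [Complex.ofReal_zero, Complex.cpow_zero]
      exact continuousOn_const
    · exact hS.continuousOn_cpow hD hs
  refine (hT.hasSum_trace e).summable.norm.congr fun i => ?_
  obtain ⟨hi, hDi⟩ := he i
  have h1 := hS.apply_of_eigen hi hDi
  have h0 : (l i : ℂ) - Complex.I ≠ 0 := norm_pos_iff.1 (by linarith [one_le_norm_sub_I (l i)])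
  rw [cfc_apply_eigenvector hn (e.orthonormal.ne_zero i) h1 (hS.star_apply_of_eigen hD h1) hcont,
    inner_smul_right, inner_self_eq_norm_sq_to_K, e.orthonormal.1 i]
  simp only [RCLike.ofReal_one, one_pow, mul_one]
  rw [Complex.norm_cpow_real, norm_inv, Real.inv_rpow (norm_nonneg _),
    Real.rpow_neg (norm_nonneg _)]

end IsResolvent

end Eigenvalues

/-! ### Existence of the unitary group -/

section UnitaryGroup

variable {ι : Type*} {e : HilbertBasis ι ℂ H} {l : ι → ℝ}

lemma ext_inner_hilbertBasis (e : HilbertBasis ι ℂ H) {v w : H}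
    (h : ∀ i, inner ℂ (e i) v = inner ℂ (e i) w) : v = w :=
  (hasSum_inner_smul e v).unique (by simpa only [h] using hasSum_inner_smul e w)

lemma inner_eigen_apply (hD : IsSelfAdjoint D) (he : IsEigenbasis D e l) (i : ι) (x : D.domain) :
    inner ℂ (e i) (D x) = l i * inner ℂ (e i) (x : H) := by
  obtain ⟨hi, hDi⟩ := he i
  rw [← symmetric_of_isSelfAdjoint hD ⟨e i, hi⟩ x, hDi, inner_smul_left, Complex.conj_ofReal]

/-- The vectors `exp (i a lᵢ) eᵢ` form an orthonormal basis too. -/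
def rotatedBasis (e : HilbertBasis ι ℂ H) (l : ι → ℝ) (a : ℝ) : HilbertBasis ι ℂ H :=
  HilbertBasis.mkOfOrthogonalEqBot (v := fun i => Complex.exp (Complex.I * a * l i) • e i)
    (by
      classical
      rw [orthonormal_iff_ite]
      intro i j
      rw [inner_smul_left, inner_smul_right, (orthonormal_iff_ite.1 e.orthonormal) i j]
      split_ifs with h
      · subst h
        rw [mul_one, ← Complex.exp_conj, ← Complex.exp_add]
        simp
      · simp)
    (by
      rw [Submodule.eq_bot_iff]
      intro v hv
      refine ext_inner_hilbertBasis e fun i => ?_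
      have h := (Submodule.mem_orthogonal _ _).1 hv _ (Submodule.subset_span ⟨i, rfl⟩)
      rw [inner_smul_left, mul_eq_zero] at h
      rw [inner_zero_right]
      refine h.resolve_left ?_
      rw [← Complex.exp_conj]
      exact Complex.exp_ne_zero _)

lemma rotatedBasis_apply (e : HilbertBasis ι ℂ H) (l : ι → ℝ) (a : ℝ) (i : ι) :
    rotatedBasis e l a i = Complex.exp (Complex.I * a * l i) • e i := by
  rw [rotatedBasis, HilbertBasis.coe_mkOfOrthogonalEqBot]

/-- The diagonal unitary operator with eigenvalues `exp (i a lᵢ)`. -/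
def diagonalUnitary (e : HilbertBasis ι ℂ H) (l : ι → ℝ) (a : ℝ) : H ≃ₗᵢ[ℂ] H :=
  e.repr.trans (rotatedBasis e l a).repr.symm

lemma diagonalUnitary_apply_basis (e : HilbertBasis ι ℂ H) (l : ι → ℝ) (a : ℝ) (i : ι) :
    diagonalUnitary e l a (e i) = Complex.exp (Complex.I * a * l i) • e i := by
  classical
  rw [diagonalUnitary, LinearIsometryEquiv.trans_apply, e.repr_self, HilbertBasis.repr_symm_single,
    rotatedBasis_apply]

lemma inner_diagonalUnitary (e : HilbertBasis ι ℂ H) (l : ι → ℝ) (a : ℝ) (i : ι) (v : H) :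
    inner ℂ (e i) (diagonalUnitary e l a v)
      = Complex.exp (Complex.I * a * l i) * inner ℂ (e i) v := by
  rw [← (diagonalUnitary e l a).inner_map_map (e i) v, diagonalUnitary_apply_basis, inner_smul_left,
    ← Complex.exp_conj, ← mul_assoc, ← Complex.exp_add]
  simp

lemma continuous_diagonalUnitary (e : HilbertBasis ι ℂ H) (l : ι → ℝ) (v : H) :
    Continuous fun a => diagonalUnitary e l a v := by
  refine continuous_of_uniform_approx_of_continuous fun u hu => ?_
  obtain ⟨ε, hε, hεu⟩ := Metric.mem_uniformity_dist.1 hu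
  obtain ⟨J, hJ⟩ := ((tendsto_finProj e v).eventually (Metric.ball_mem_nhds v hε)).exists
  refine ⟨fun a => diagonalUnitary e l a (finProj e J v), ?_, fun a => hεu ?_⟩
  · simp_rw [finProj_apply, map_sum, map_smul, diagonalUnitary_apply_basis]
    fun_prop
  · rw [LinearIsometryEquiv.dist_map, dist_comm]
    exact hJ

/-- The diagonal unitary operators form the unitary group of `D`. -/
theorem isUnitaryGroup_diagonalUnitary (hD : IsSelfAdjoint D) (he : IsEigenbasis D e l) :
    IsUnitaryGroup D fun a => ((diagonalUnitary e l a : H ≃L[ℂ] H) : H →L[ℂ] H) where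
  zero := by
    ext v
    refine ext_inner_hilbertBasis e fun i => ?_
    refine (inner_diagonalUnitary e l 0 i v).trans ?_
    simp
  add a b := by
    ext v
    refine ext_inner_hilbertBasis e fun i => ?_
    refine (inner_diagonalUnitary e l (a + b) i v).trans ?_
    refine Eq.trans ?_ (inner_diagonalUnitary e l a i (diagonalUnitary e l b v)).symm
    rw [inner_diagonalUnitary, ← mul_assoc, ← Complex.exp_add]
    congr 2
    push_cast
    ring
  norm_map a v := (diagonalUnitary e l a).norm_map v
  continuous v := continuous_diagonalUnitary e l v
  generator x := by
    have hc : Continuous fun τ : ℝ => diagonalUnitary e l τ (Complex.I • D x) :=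
      continuous_diagonalUnitary e l _
    -- the integrated form of the differential equation, checked on each basis vector
    have hint : ∀ a : ℝ, diagonalUnitary e l a x
        = x + ∫ τ in (0 : ℝ)..a, diagonalUnitary e l τ (Complex.I • D x) := by
      intro a
      refine ext_inner_hilbertBasis e fun i => ?_
      have h := (innerSL ℂ (e i)).intervalIntegral_comp_comm (hc.intervalIntegrable (μ := volume) 0 a)
      simp only [innerSL_apply_apply, inner_diagonalUnitary, inner_smul_right,
        inner_eigen_apply hD he] at h
      rw [inner_add_right, inner_diagonalUnitary, ← h]
      have hder : ∀ τ : ℝ, HasDerivAt (fun τ : ℝ => Complex.exp (Complex.I * τ * l i) *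
          inner ℂ (e i) (x : H)) (Complex.exp (Complex.I * τ * l i) *
          (Complex.I * (l i * inner ℂ (e i) (x : H)))) τ := by
        intro τ
        have h1 : HasDerivAt (fun a : ℝ => Complex.exp (Complex.I * a * l i))
            (Complex.exp (Complex.I * τ * l i) * (Complex.I * 1 * l i)) τ :=
          ((((hasDerivAt_id (τ : ℂ)).const_mul Complex.I).mul_const (l i : ℂ)).cexp).comp_ofReal
        refine (h1.mul_const _).congr_deriv ?_
        ring
      rw [intervalIntegral.integral_eq_sub_of_hasDerivAt (fun τ _ => hder τ)
        (Continuous.intervalIntegrable (by fun_prop) _ _)]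
      simp
    have h := (intervalIntegral.integral_hasDerivAt_right (hc.intervalIntegrable 0 0)
      (hc.stronglyMeasurableAtFilter _ _) hc.continuousAt).const_add (x : H)
    have h0 : diagonalUnitary e l 0 (Complex.I • D x) = Complex.I • D x := by
      refine ext_inner_hilbertBasis e fun i => ?_
      rw [inner_diagonalUnitary]
      simp
    rw [h0] at h
    exact h.congr_of_eventuallyEq (Eventually.of_forall hint)

lemma isUnitaryGroup_unitaryGroup (hD : IsSelfAdjoint D) (he : IsEigenbasis D e l) :
    IsUnitaryGroup D (unitaryGroup D) :=
  Classical.epsilon_spec (p := fun U => IsUnitaryGroup D U)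
    ⟨_, isUnitaryGroup_diagonalUnitary hD he⟩

end UnitaryGroup

end

/-! ### Strong continuity in the perturbation -/

section

variable {D : H →ₗ.[ℂ] H} {U : ℝ → H →L[ℂ] H} {R : H →L[ℂ] H} {ρ M : ℝ} {φ : ℝ → ℂ}

section StrongContinuity

variable {α : Type*} {F : Filter α} [F.IsCountablyGenerated] {Rf : α → H →L[ℂ] H}

lemma tendsto_duhamel (hU : IsUnitaryGroup D U) (hb : ∀ a, ‖Rf a‖ ≤ M)
    (hR : ∀ v, Tendsto (fun a => Rf a v) F (𝓝 (R v))) (n : ℕ) (v : H) (ξ : ℝ) :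
    Tendsto (fun a => duhamel U (Rf a) n v ξ) F (𝓝 (duhamel U R n v ξ)) := by
  induction n generalizing ξ with
  | zero => exact tendsto_const_nhds
  | succ n ih =>
    simp_rw [duhamel_succ]
    refine Tendsto.const_smul ?_ _
    refine intervalIntegral.tendsto_integral_filter_of_dominated_convergence
      (fun η => M * ((|η| * M) ^ n / n.factorial * ‖v‖)) ?_ ?_ ?_ ?_
    · exact Eventually.of_forall fun a => (continuous_duhamel_integrand hU (Rf a) n v
        (a := fun η => ξ - η) (b := fun η => η) (by fun_prop) (by fun_prop)).aestronglyMeasurable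
    · refine Eventually.of_forall fun a => Eventually.of_forall fun η _ => ?_
      have hM : 0 ≤ M := (norm_nonneg _).trans (hb a)
      rw [hU.norm_map]
      refine ((Rf a).le_opNorm _).trans (mul_le_mul (hb a) ((norm_duhamel_le hU _ n v η).trans ?_)
        (norm_nonneg _) hM)
      have := hb a
      gcongr
    · exact Continuous.intervalIntegrable (by fun_prop) _ _
    · refine Eventually.of_forall fun η _ => ?_
      exact ((U (ξ - η)).continuous.tendsto _).comp (tendsto_apply_of_bounded hb hR (ih η))

lemma geomBound_fourierSeries (hU : IsUnitaryGroup D U) (hρ : 0 < ρ) (hφ : ExpIntegrable ρ φ)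
    (hR : ‖R‖ ≤ M) : GeomBound (fourierSeries hU R hρ hφ) (expNorm ρ φ) (M / ρ) := fun n =>
  (norm_coeff_fourierSeries_le hU R hρ hφ n).trans (mul_le_mul_of_nonneg_left
    (pow_le_pow_left₀ (by positivity) (by gcongr) n) (expNorm_nonneg _ _))

lemma strongTendsto_fourierSeries (hU : IsUnitaryGroup D U) (hρ : 0 < ρ) (hφ : ExpIntegrable ρ φ)
    (hb : ∀ a, ‖Rf a‖ ≤ M) (hR : ∀ v, Tendsto (fun a => Rf a v) F (𝓝 (R v))) :
    StrongTendsto F (fun a => fourierSeries hU (Rf a) hρ hφ) (fourierSeries hU R hρ hφ) := by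
  intro n v
  simp_rw [coeff_fourierSeries_apply]
  refine tendsto_integral_filter_of_dominated_convergence
    (fun ξ => (M / ρ) ^ n * ‖v‖ * (Real.exp (ρ * |ξ|) * ‖φ ξ‖)) ?_ ?_
    (hφ.integrable_exp_mul_norm.const_mul _) ?_
  · exact Eventually.of_forall fun a => (integrable_smul_duhamel hU (Rf a) hρ hφ n v).1
  · refine Eventually.of_forall fun a => Eventually.of_forall fun ξ => ?_
    have hM : 0 ≤ M := (norm_nonneg _).trans (hb a)
    rw [norm_smul]
    calc ‖φ ξ‖ * ‖duhamel U (Rf a) n v ξ‖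
        ≤ ‖φ ξ‖ * ((‖Rf a‖ / ρ) ^ n * ‖v‖ * Real.exp (ρ * |ξ|)) := by
          gcongr
          exact norm_duhamel_le_exp hU (Rf a) hρ n v ξ
      _ ≤ ‖φ ξ‖ * ((M / ρ) ^ n * ‖v‖ * Real.exp (ρ * |ξ|)) := by
          have := hb a
          gcongr
      _ = _ := by ring
  · exact Eventually.of_forall fun ξ => (tendsto_duhamel hU hb hR n v ξ).const_smul _

end StrongContinuity

/-! ### Trace class estimates for the power series of `f` -/

section TraceClass

variable {ι : Type*} {e : HilbertBasis ι ℂ H} {l : ι → ℝ} {s : ℝ} {f : ℝ → ℂ}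

lemma norm_finProj_le (e : HilbertBasis ι ℂ H) (J : Finset ι) : ‖finProj e J‖ ≤ 1 := by
  refine ContinuousLinearMap.opNorm_le_bound _ zero_le_one fun v => ?_
  rw [finProj_apply]
  simpa using norm_sum_mul_inner_smul_le e J (c := fun _ => 1) zero_le_one (fun i _ => by simp) v

/-- The perturbation, compressed to the span of finitely many basis vectors. -/
def compression (e : HilbertBasis ι ℂ H) (R : H →L[ℂ] H) (J : Finset ι) : H →L[ℂ] H :=
  finProj e J * R * finProj e J

lemma norm_compression_le (e : HilbertBasis ι ℂ H) (R : H →L[ℂ] H) (J : Finset ι) :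
    ‖compression e R J‖ ≤ ‖R‖ := by
  have h := norm_finProj_le e J
  calc ‖compression e R J‖ ≤ ‖finProj e J‖ * ‖R‖ * ‖finProj e J‖ :=
        (norm_mul_le _ _).trans (mul_le_mul_of_nonneg_right (norm_mul_le _ _) (norm_nonneg _))
    _ ≤ 1 * ‖R‖ * 1 := by gcongr
    _ = ‖R‖ := by ring

lemma tendsto_compression (e : HilbertBasis ι ℂ H) (R : H →L[ℂ] H) (v : H) :
    Tendsto (fun J => compression e R J v) atTop (𝓝 (R v)) := by
  simp only [compression, mul_apply_eq_comp]
  exact tendsto_apply_of_bounded (A₀ := 1) (norm_finProj_le e) (tendsto_finProj e)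
    ((R.continuous.tendsto _).comp (tendsto_finProj e v))

/-- The power series of `f(D + t R)` has trace class coefficients with geometric bounds, and their
traces are the limits of those for the compressed perturbations. -/
theorem exists_nuclearBound_fourierSeries (hU : IsUnitaryGroup D U) (he : IsEigenbasis D e l)
    (hs : 0 ≤ s) (hsum : Summable fun i => ‖(l i : ℂ) - Complex.I‖ ^ (-s)) (hf : ClassE s f)
    (R : H →L[ℂ] H) :
    ∃ (ρ : ℝ) (hρ : 0 < ρ) (hfe : ExpIntegrable ρ (fourierHat f)) (z K : ℝ), 0 ≤ z ∧ 0 ≤ K ∧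
      (∀ n, NuclearBound (PowerSeries.coeff n (fourierSeries hU R hρ hfe)) (z * K ^ n)) ∧
      ∀ n, Tendsto
        (fun J => trace (PowerSeries.coeff n (fourierSeries hU (compression e R J) hρ hfe))) atTop
        (𝓝 (trace (PowerSeries.coeff n (fourierSeries hU R hρ hfe)))) := by
  have hcount : Countable ι := by
    have h := hsum.countable_support
    have hu : Function.support (fun i => ‖(l i : ℂ) - Complex.I‖ ^ (-s)) = Set.univ := by
      refine Set.eq_univ_of_forall fun i => ?_
      have := one_le_norm_sub_I (l i)
      exact (Real.rpow_pos_of_pos (by linarith) _).ne'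
    rw [hu] at h
    exact Set.countable_univ_iff.1 h
  rcases hs.eq_or_lt with rfl | hs
  · obtain ⟨ρ, hρ, -, hfe, -⟩ := hf.exists_expIntegrable le_rfl
    -- for `s = 0` the identity is trace class, and the space is finite dimensional
    have hfin : Finite ι := by
      simp only [neg_zero, Real.rpow_zero] at hsum
      by_contra h
      have := not_finite_iff_infinite.1 h
      exact one_ne_zero ((summable_const_iff _).1 hsum)
    have := Fintype.ofFinite ι
    have hone : finProj e Finset.univ = 1 := by
      ext v
      rw [finProj_apply]
      exact (hasSum_fintype _).unique (hasSum_inner_smul e v)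
    have htr : ∀ A : H →L[ℂ] H, NuclearBound A (Fintype.card ι * ‖A‖) ∧
        trace A = ∑ i, inner ℂ (e i) (A (e i)) := by
      intro A
      have h := nuclearBound_mul_finProj_mul e Finset.univ A 1
      rw [hone, mul_one, mul_one] at h
      refine ⟨h.1.mono ?_, by simpa using h.2⟩
      have : ‖(1 : H →L[ℂ] H)‖ ≤ 1 := ContinuousLinearMap.norm_id_le
      calc _ ≤ (Fintype.card ι : ℝ) * (‖A‖ * 1) := by rw [Finset.card_univ]; gcongr
        _ = _ := by rw [mul_one]
    refine ⟨ρ, hρ, hfe, Fintype.card ι * expNorm ρ (fourierHat f), ‖R‖ / ρ,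
      mul_nonneg (by positivity) (expNorm_nonneg _ _), by positivity, fun n => ?_, fun n => ?_⟩
    · refine (htr _).1.mono ?_
      rw [mul_assoc]
      gcongr
      exact norm_coeff_fourierSeries_le hU R hρ hfe n
    · simp_rw [(htr _).2]
      refine tendsto_finsetSum _ fun i _ => Tendsto.inner tendsto_const_nhds ?_
      exact strongTendsto_fourierSeries hU hρ hfe (norm_compression_le e R)
        (tendsto_compression e R) n (e i)
  -- with `k > s` the exponent `a = s / k` of the Gamma kernel lies in `(0, 1)`, as its decay
  -- requires
  · obtain ⟨k, hk⟩ := exists_nat_gt s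
    have hk0 : 0 < k := by exact_mod_cast hs.trans hk
    obtain ⟨ρ, hρ, hρ1, φ, hφ, hfe, ha, hfac⟩ := hf.exists_fourierSeries_factor hs H hk0
    have ha1 : s / k < 1 := (div_lt_one (by exact_mod_cast hk0)).2 hk
    set K : ℝ := max (‖R‖ / ρ) (4 * ‖R‖) with hK
    have hK0 : 0 ≤ K := le_max_of_le_right (by positivity)
    have hr1 : (2 : ℝ) ^ (-(s / k)) < 1 := Real.rpow_lt_one_of_one_lt_of_neg one_lt_two (by linarith)
    have hZ : ∀ {R' : H →L[ℂ] H}, ‖R'‖ ≤ ‖R‖ →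
        GeomBound (fourierSeries hU R' hρ hφ) (expNorm ρ φ) K := fun h =>
      (geomBound_fourierSeries hU hρ hφ h).mono (by positivity) le_rfl (le_max_left _ _)
    have hV : ∀ {R' : H →L[ℂ] H}, ‖R'‖ ≤ ‖R‖ → CutoffDecay e (dyadicSet hs hsum)
        (fourierSeries hU R' hρ (expIntegrable_gammaKernel ha hρ1)) (gammaConst (s / k))
        (2 ^ (-(s / k))) K := fun h j =>
      (cutoffDecay_gamma hU he hs hsum hρ hρ1 ha ha1 h j).mono (by positivity) le_rfl
        (le_max_right _ _)
    have hn := nuclearBound_mul_pow (disjoint_dyadicSet hs hsum) hK0 (by positivity) hr1 hk0.ne'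
      (summable_card_dyadicSet hs hsum hk0) (hZ le_rfl) (hV le_rfl)
    refine ⟨ρ, hρ, hfe, k * expNorm ρ φ * gammaConst (s / k) ^ k *
      (∑' j, (dyadicSet hs hsum j).card * ((2 : ℝ) ^ (-(s / k))) ^ (j * k)),
      2 ^ (k + 2) * K, ?_, by positivity, fun n => ?_, fun n => ?_⟩
    rotate_left
    · rw [hfac hU R]
      exact (hn n).1
    · simp_rw [hfac hU]
      exact tendsto_trace_mul_pow (disjoint_dyadicSet hs hsum) hK0 (by positivity) hr1 hk0.ne'
        (summable_card_dyadicSet hs hsum hk0) (hZ le_rfl) (hV le_rfl)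
        (fun J => hZ (norm_compression_le e R J)) (fun J => hV (norm_compression_le e R J))
        (strongTendsto_fourierSeries hU hρ hφ (norm_compression_le e R) (tendsto_compression e R))
        (strongTendsto_fourierSeries hU hρ _ (norm_compression_le e R) (tendsto_compression e R)) n
    · have hg : 0 ≤ gammaConst (s / k) := add_nonneg (Real.Gamma_pos_of_pos ha).le (by positivity)
      have := expNorm_nonneg ρ φ
      exact mul_nonneg (by positivity) (tsum_nonneg fun j => by positivity)

end TraceClass

end

/-! ### Divided differences of exponentials -/

section

variable {ρ : ℝ}

section ExpDividedDifference

/-- The divided difference of `x ↦ exp (i ξ x)` at `x₀, …, xₙ`, by Duhamel's recursion. -/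
def expDividedDiff : (n : ℕ) → (Fin (n + 1) → ℝ) → ℝ → ℂ
  | 0, x, ξ => Complex.exp (Complex.I * ξ * x 0)
  | n + 1, x, ξ => Complex.I * ∫ η in (0 : ℝ)..ξ, Complex.exp (Complex.I * (ξ - η) * x 0) *
      expDividedDiff n (Fin.tail x) η

lemma expDividedDiff_succ_eq (n : ℕ) (x : Fin (n + 2) → ℝ) (ξ : ℝ) :
    expDividedDiff (n + 1) x ξ = Complex.exp (Complex.I * ξ * x 0) *
      (Complex.I * ∫ η in (0 : ℝ)..ξ, Complex.exp (-(Complex.I * η * x 0)) *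
        expDividedDiff n (Fin.tail x) η) := by
  have h : ∀ η : ℝ, Complex.exp (Complex.I * (ξ - η) * x 0) * expDividedDiff n (Fin.tail x) η
      = Complex.exp (Complex.I * ξ * x 0) *
        (Complex.exp (-(Complex.I * η * x 0)) * expDividedDiff n (Fin.tail x) η) := by
    intro η
    rw [← mul_assoc, ← Complex.exp_add]
    congr 2
    ring
  rw [expDividedDiff]
  simp_rw [h]
  rw [intervalIntegral.integral_const_mul, mul_left_comm]

lemma hasDerivAt_exp_mul (ξ x : ℝ) : HasDerivAt (fun ξ : ℝ => Complex.exp (Complex.I * ξ * x))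
    (Complex.I * x * Complex.exp (Complex.I * ξ * x)) ξ := by
  have h1 : HasDerivAt (fun a : ℝ => Complex.exp (Complex.I * a * x))
      (Complex.exp (Complex.I * ξ * x) * (Complex.I * 1 * x)) ξ :=
    ((((hasDerivAt_id (ξ : ℂ)).const_mul Complex.I).mul_const (x : ℂ)).cexp).comp_ofReal
  refine h1.congr_deriv ?_
  ring

lemma continuous_expDividedDiff (n : ℕ) (x : Fin (n + 1) → ℝ) :
    Continuous (expDividedDiff n x) := by
  induction n with
  | zero =>
    change Continuous fun ξ : ℝ => Complex.exp (Complex.I * ξ * x 0)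
    fun_prop
  | succ n ih =>
    have h := ih (Fin.tail x)
    have : expDividedDiff (n + 1) x = fun ξ : ℝ => Complex.exp (Complex.I * ξ * x 0) *
      (Complex.I * ∫ η in (0 : ℝ)..ξ, Complex.exp (-(Complex.I * η * x 0)) *
        expDividedDiff n (Fin.tail x) η) := funext (expDividedDiff_succ_eq n x)
    rw [this]
    have hp : Continuous fun ξ : ℝ => ∫ η in (0 : ℝ)..ξ, Complex.exp (-(Complex.I * η * x 0)) *
        expDividedDiff n (Fin.tail x) η :=
      intervalIntegral.continuous_primitive
        (fun a b => Continuous.intervalIntegrable (by fun_prop) a b) 0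
    fun_prop

lemma hasDerivAt_expDividedDiff_succ (n : ℕ) (x : Fin (n + 2) → ℝ) (ξ : ℝ) :
    HasDerivAt (expDividedDiff (n + 1) x) (Complex.I * x 0 * expDividedDiff (n + 1) x ξ
      + Complex.I * expDividedDiff n (Fin.tail x) ξ) ξ := by
  have hc := continuous_expDividedDiff n (Fin.tail x)
  have hg : Continuous fun η : ℝ => Complex.exp (-(Complex.I * η * x 0)) *
        expDividedDiff n (Fin.tail x) η := by fun_prop
  have h1 := (intervalIntegral.integral_hasDerivAt_right (hg.intervalIntegrable 0 ξ)
    (hg.stronglyMeasurableAtFilter _ _) hg.continuousAt).const_mul Complex.I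
  have h2 := (hasDerivAt_exp_mul ξ (x 0)).mul h1
  have : expDividedDiff (n + 1) x = _ := funext (expDividedDiff_succ_eq n x)
  rw [this]
  refine h2.congr_deriv ?_
  have h3 : Complex.exp (Complex.I * ξ * x 0) * Complex.exp (-(Complex.I * ξ * x 0)) = 1 := by
    rw [← Complex.exp_add, add_neg_cancel, Complex.exp_zero]
  linear_combination (Complex.I * expDividedDiff n (Fin.tail x) ξ) * h3

lemma expDividedDiff_succ_zero (n : ℕ) (x : Fin (n + 2) → ℝ) : expDividedDiff (n + 1) x 0 = 0 := by
  rw [expDividedDiff, intervalIntegral.integral_same, mul_zero]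

/-- A function with `h' = c h` that vanishes at the origin is zero. -/
lemma eq_zero_of_hasDerivAt_mul {h : ℝ → ℂ} {c : ℂ} (hd : ∀ ξ, HasDerivAt h (c * h ξ) ξ)
    (h0 : h 0 = 0) (ξ : ℝ) : h ξ = 0 := by
  have hg : ∀ ξ, HasDerivAt (fun ξ : ℝ => Complex.exp (-(c * ξ)) * h ξ) 0 ξ := by
    intro ξ
    have h1 : HasDerivAt (fun ξ : ℝ => Complex.exp (-(c * ξ)))
        (Complex.exp (-(c * ξ)) * -(c * 1)) ξ :=
      (((hasDerivAt_id (ξ : ℂ)).const_mul c).neg.cexp).comp_ofReal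
    refine (h1.mul (hd ξ)).congr_deriv ?_
    ring
  have := is_const_of_deriv_eq_zero (fun y => (hg y).differentiableAt) (fun y => (hg y).deriv) ξ 0
  simp only [h0, mul_zero] at this
  exact (mul_eq_zero.1 this).resolve_left (Complex.exp_ne_zero _)

/-- The recursion of divided differences. Both sides solve the same linear differential equation
in `ξ`. -/
lemma sub_mul_expDividedDiff (n : ℕ) (x : Fin (n + 2) → ℝ) (ξ : ℝ) :
    ((x (Fin.last (n + 1)) - x 0 : ℝ) : ℂ) * expDividedDiff (n + 1) x ξ
      = expDividedDiff n (Fin.tail x) ξ - expDividedDiff n (Fin.init x) ξ := by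
  rw [← sub_eq_zero]
  induction n generalizing ξ with
  | zero =>
    refine eq_zero_of_hasDerivAt_mul (c := Complex.I * x 0) (h := fun ξ =>
      ((x (Fin.last 1) - x 0 : ℝ) : ℂ) * expDividedDiff 1 x ξ -
        (expDividedDiff 0 (Fin.tail x) ξ - expDividedDiff 0 (Fin.init x) ξ)) (fun ξ => ?_) ?_ ξ
    · have h1 := (hasDerivAt_expDividedDiff_succ 0 x ξ).const_mul
        ((x (Fin.last 1) - x 0 : ℝ) : ℂ)
      have h2 : HasDerivAt (expDividedDiff 0 (Fin.tail x)) _ ξ :=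
        hasDerivAt_exp_mul ξ (Fin.tail x 0)
      have h3 : HasDerivAt (expDividedDiff 0 (Fin.init x)) _ ξ :=
        hasDerivAt_exp_mul ξ (Fin.init x 0)
      refine (h1.sub (h2.sub h3)).congr_deriv ?_
      simp only [expDividedDiff, Fin.tail, Fin.init]
      have : x (Fin.last 1) = x (Fin.succ 0) := rfl
      rw [this]
      simp only [Fin.castSucc_zero]
      push_cast
      ring
    · simp [expDividedDiff]
  | succ n ih =>
    refine eq_zero_of_hasDerivAt_mul (c := Complex.I * x 0) (h := fun ξ =>
      ((x (Fin.last (n + 2)) - x 0 : ℝ) : ℂ) * expDividedDiff (n + 2) x ξ -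
        (expDividedDiff (n + 1) (Fin.tail x) ξ - expDividedDiff (n + 1) (Fin.init x) ξ))
      (fun ξ => ?_) ?_ ξ
    · have h1 := (hasDerivAt_expDividedDiff_succ (n + 1) x ξ).const_mul
        ((x (Fin.last (n + 2)) - x 0 : ℝ) : ℂ)
      have h2 := hasDerivAt_expDividedDiff_succ n (Fin.tail x) ξ
      have h3 := hasDerivAt_expDividedDiff_succ n (Fin.init x) ξ
      refine (h1.sub (h2.sub h3)).congr_deriv ?_
      have h4 := ih (Fin.tail x) ξ
      rw [Fin.tail_init_eq_init_tail]
      have e1 : Fin.tail x (Fin.last (n + 1)) = x (Fin.last (n + 2)) := rfl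
      have e2 : Fin.init x 0 = x 0 := rfl
      rw [e1] at h4
      rw [e2]
      push_cast at h4 ⊢
      linear_combination Complex.I * h4
    · simp [expDividedDiff_succ_zero]

/-- Hermite's formula for divided differences of exponentials. -/
lemma expDividedDiff_eq_simplexIntegral (n : ℕ) (x : Fin (n + 1) → ℝ) (ξ : ℝ) :
    expDividedDiff n x ξ = (Complex.I * ξ) ^ n *
      simplexIntegral n fun s => Complex.exp (Complex.I * ξ * ((∑ i, s i * x i : ℝ) : ℂ)) := by
  induction n generalizing ξ with
  | zero => simp [simplexIntegral_zero, expDividedDiff]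
  | succ n ih =>
    have hc : Continuous fun s : Fin (n + 2) → ℝ =>
        Complex.exp (Complex.I * ξ * ((∑ i, s i * x i : ℝ) : ℂ)) := by fun_prop
    have hscale := intervalIntegral.smul_integral_comp_mul_left
      (f := fun η : ℝ => (Complex.exp (Complex.I * (ξ - η) * x 0) *
        expDividedDiff n (Fin.tail x) η : ℂ)) (a := 0) (b := 1) ξ
    rw [mul_zero, mul_one] at hscale
    have hsplit : ∀ (r : ℝ) (s : Fin (n + 1) → ℝ),
        Complex.exp (Complex.I * ξ * ((∑ i, (Fin.cons (1 - r) (r • s) : Fin (n + 2) → ℝ) i * x i : ℝ) : ℂ))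
          = Complex.exp (Complex.I * (ξ - ((ξ * r : ℝ) : ℂ)) * x 0) *
            Complex.exp (Complex.I * ((ξ * r : ℝ) : ℂ) * ((∑ i, s i * Fin.tail x i : ℝ) : ℂ)) := by
      intro r s
      rw [Fin.sum_univ_succ, ← Complex.exp_add]
      congr 1
      simp only [Fin.cons_zero, Fin.cons_succ, Pi.smul_apply, smul_eq_mul, Fin.tail, mul_assoc,
        ← Finset.mul_sum]
      push_cast
      ring
    have hconst : ∀ c : ℂ, ∀ F : (Fin (n + 1) → ℝ) → ℂ,
        simplexIntegral n (fun s => c * F s) = c * simplexIntegral n F := fun c F =>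
      integral_const_mul c _
    have hI : (∫ r in (0 : ℝ)..1, (Complex.exp (Complex.I * (ξ - ((ξ * r : ℝ) : ℂ)) * x 0) *
          expDividedDiff n (Fin.tail x) (ξ * r) : ℂ))
        = (Complex.I * ξ) ^ n * ∫ r in (0 : ℝ)..1, r ^ n • simplexIntegral n fun s =>
          Complex.exp (Complex.I * ξ *
            ((∑ i, (Fin.cons (1 - r) (r • s) : Fin (n + 2) → ℝ) i * x i : ℝ) : ℂ)) := by
      rw [← intervalIntegral.integral_const_mul]
      refine intervalIntegral.integral_congr fun r _ => ?_
      rw [ih (Fin.tail x) (ξ * r), Complex.real_smul]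
      simp_rw [hsplit, hconst]
      push_cast
      ring
    rw [expDividedDiff, ← hscale, simplexIntegral_succ n hc, Complex.real_smul, hI]
    ring

lemma norm_simplexIntegral_le (n : ℕ) {F : (Fin (n + 1) → ℝ) → ℂ} (hF : ∀ s, ‖F s‖ ≤ 1) :
    ‖simplexIntegral n F‖ ≤ volume.real (corner n) := by
  have := norm_setIntegral_le_of_norm_le_const (μ := volume) (s := corner n) (C := 1)
    (f := fun s => F (Fin.cons (1 - ∑ i, s i) s)) (isCompact_corner n).measure_lt_top
    fun s _ => hF _
  rwa [one_mul] at this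

lemma norm_expDividedDiff_le (n : ℕ) (x : Fin (n + 1) → ℝ) (ξ : ℝ) :
    ‖expDividedDiff n x ξ‖ ≤ volume.real (corner n) * |ξ| ^ n := by
  rw [expDividedDiff_eq_simplexIntegral, norm_mul, norm_pow, norm_mul, Complex.norm_I, one_mul,
    Complex.norm_real, Real.norm_eq_abs, mul_comm]
  gcongr
  exact norm_simplexIntegral_le n fun s => (norm_fourierKernel _ _).le

end ExpDividedDifference

/-! ### Divided differences as Fourier integrals -/

section DividedDifference

variable {φ f : ℝ → ℂ}

lemma ExpIntegrable.integrable_mul_of_le_pow (hρ : 0 < ρ) (hφ : ExpIntegrable ρ φ) {G : ℝ → ℂ}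
    (hG : Continuous G) {c : ℝ} {m : ℕ} (hb : ∀ ξ, ‖G ξ‖ ≤ c * |ξ| ^ m) :
    Integrable fun ξ => φ ξ * G ξ := by
  have hc : 0 ≤ c := by simpa using (norm_nonneg _).trans (hb 1)
  refine hφ.integrable_smul (C := c * (m.factorial / ρ ^ m)) hG.aestronglyMeasurable
    fun ξ => (hb ξ).trans ?_
  have h := Real.pow_div_factorial_le_exp (ρ * |ξ|) (by positivity) m
  rw [div_le_iff₀ (by positivity), mul_pow] at h
  rw [mul_assoc]
  gcongr
  rw [div_mul_eq_mul_div, le_div_iff₀ (by positivity)]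
  linarith

lemma norm_I_mul_mul_expDividedDiff_le (n : ℕ) (x : Fin (n + 1) → ℝ) (ξ : ℝ) :
    ‖Complex.I * ξ * expDividedDiff n x ξ‖ ≤ volume.real (corner n) * |ξ| ^ (n + 1) := by
  rw [norm_mul, norm_mul, Complex.norm_I, one_mul, Complex.norm_real, Real.norm_eq_abs, pow_succ]
  calc _ ≤ |ξ| * (volume.real (corner n) * |ξ| ^ n) := by
        gcongr
        exact norm_expDividedDiff_le n x ξ
    _ = _ := by ring

lemma integrable_mul_expDividedDiff (hρ : 0 < ρ) (hφ : ExpIntegrable ρ φ) (n : ℕ)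
    (x : Fin (n + 1) → ℝ) :
    Integrable fun ξ : ℝ => φ ξ * (Complex.I * ξ * expDividedDiff n x ξ) := by
  have hc := continuous_expDividedDiff n x
  exact hφ.integrable_mul_of_le_pow hρ (by fun_prop) (norm_I_mul_mul_expDividedDiff_le n x)

lemma iteratedDeriv_eq_integral (hf : ContDiff ℝ ∞ f) (hφ : HasIntegrableFourier f φ)
    (hex : ∀ n : ℕ, ∃ ψ, HasIntegrableFourier (iteratedDeriv n f) ψ) (n : ℕ) (x : ℝ) :
    iteratedDeriv n f x = ∫ ξ : ℝ, φ ξ * ((Complex.I * ξ) ^ n * Complex.exp (Complex.I * ξ * x)) := by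
  obtain ⟨ψ, hψ⟩ := hex n
  rw [hψ.2 x]
  refine integral_congr_ae ?_
  filter_upwards [hφ.iteratedDeriv_ae hf hex n hψ] with ξ h
  rw [h]
  ring

/-- Divided differences of the derivative of `f`, in both cases of their definition, as an integral
of divided differences of exponentials. -/
theorem dividedDiff_deriv_eq_integral (hρ : 0 < ρ) (hφe : ExpIntegrable ρ φ)
    (hf : ContDiff ℝ ∞ f) (hφ : HasIntegrableFourier f φ)
    (hex : ∀ n : ℕ, ∃ ψ, HasIntegrableFourier (iteratedDeriv n f) ψ) (n : ℕ)
    (x : Fin (n + 1) → ℝ) :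
    dividedDiff (deriv f) n x = ∫ ξ : ℝ, φ ξ * (Complex.I * ξ * expDividedDiff n x ξ) := by
  rw [dividedDiff]
  split_ifs with hx
  · induction n with
    | zero =>
      have h := iteratedDeriv_eq_integral hf hφ hex 1 (x 0)
      rw [iteratedDeriv_one] at h
      rw [dividedDiffRec, h]
      simp only [pow_one, expDividedDiff]
    | succ n ih =>
      have hne : ((x (Fin.last (n + 1)) - x 0 : ℝ) : ℂ) ≠ 0 := by
        rw [Complex.ofReal_ne_zero, sub_ne_zero]
        exact fun h => (Fin.last_pos' (n := n + 1)).ne' (hx h)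
      have h1 : Function.Injective (Fin.tail x) := fun a b h => Fin.succ_injective _ (hx h)
      have h2 : Function.Injective (Fin.init x) := fun a b h => Fin.castSucc_injective _ (hx h)
      rw [dividedDiffRec, ih _ h1, ih _ h2, div_eq_iff hne,
        ← integral_sub (integrable_mul_expDividedDiff hρ hφe n _)
          (integrable_mul_expDividedDiff hρ hφe n _), ← integral_mul_const]
      refine integral_congr_ae (Eventually.of_forall fun ξ => ?_)
      simp only
      have h3 := sub_mul_expDividedDiff n x ξ
      linear_combination (-φ ξ * Complex.I * ξ) * h3
  -- at coinciding points the Hermite formula is exchanged with the Fourier integral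
  · have hiter : ∀ y, iteratedDeriv n (deriv f) y
        = ∫ ξ : ℝ, φ ξ * ((Complex.I * ξ) ^ (n + 1) * Complex.exp (Complex.I * ξ * y)) := by
      intro y
      rw [← iteratedDeriv_eq_integral hf hφ hex, iteratedDeriv_succ']
    have hfin : IsFiniteMeasure (volume.restrict (corner n)) :=
      ⟨by rw [Measure.restrict_apply_univ]; exact (isCompact_corner n).measure_lt_top⟩
    have hg : Integrable fun ξ : ℝ => φ ξ * (Complex.I * ξ) ^ (n + 1) :=
      hφe.integrable_mul_of_le_pow hρ (c := 1) (m := n + 1) (by fun_prop) fun ξ => by simp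
    have hprod : Integrable (Function.uncurry fun (s : Fin n → ℝ) (ξ : ℝ) =>
        φ ξ * ((Complex.I * ξ) ^ (n + 1) * Complex.exp (Complex.I * ξ *
          ((∑ i, (Fin.cons (1 - ∑ i, s i) s : Fin (n + 1) → ℝ) i * x i : ℝ) : ℂ))))
        ((volume.restrict (corner n)).prod volume) := by
      have h1 := hg.comp_snd (volume.restrict (corner n))
      have hcont : Continuous fun p : (Fin n → ℝ) × ℝ => Complex.exp (Complex.I * p.2 *
          ((∑ i, (Fin.cons (1 - ∑ i, p.1 i) p.1 : Fin (n + 1) → ℝ) i * x i : ℝ) : ℂ)) := by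
        have h2 : Continuous fun p : (Fin n → ℝ) × ℝ =>
            (Fin.cons (1 - ∑ i, p.1 i) p.1 : Fin (n + 1) → ℝ) :=
          Continuous.finCons (by fun_prop) (by fun_prop)
        have h3 : ∀ i, Continuous fun p : (Fin n → ℝ) × ℝ =>
            (Fin.cons (1 - ∑ i, p.1 i) p.1 : Fin (n + 1) → ℝ) i := fun i =>
          (continuous_apply i).comp h2
        fun_prop
      refine (h1.mul_bdd (c := 1) hcont.aestronglyMeasurable
        (Eventually.of_forall fun p => (norm_fourierKernel _ _).le)).congr
        (Eventually.of_forall fun p => ?_)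
      simp only [Function.uncurry]
      ring
    simp_rw [hiter]
    have hswap := integral_integral_swap hprod
    refine hswap.trans (integral_congr_ae (Eventually.of_forall fun ξ => ?_))
    simp only
    rw [integral_const_mul, integral_const_mul, expDividedDiff_eq_simplexIntegral, pow_succ']
    simp only [simplexIntegral, corner]
    ring

end DividedDifference

end

/-! ### The trace of a group of matrix power series -/

section

variable {D : H →ₗ.[ℂ] H} {U : ℝ → H →L[ℂ] H} {R : H →L[ℂ] H}

section MatrixTrace

variable {n : Type*} [Fintype n] [DecidableEq n]

lemma trace_coeff_mul_comm (A B : PowerSeries (Matrix n n ℂ)) (m : ℕ) :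
    (PowerSeries.coeff m (A * B)).trace = (PowerSeries.coeff m (B * A)).trace := by
  rw [PowerSeries.coeff_mul, PowerSeries.coeff_mul, Matrix.trace_sum, Matrix.trace_sum,
    ← Finset.Nat.sum_antidiagonal_swap]
  exact Finset.sum_congr rfl fun p _ => Matrix.trace_mul_comm _ _

/-- The Euler operator `t d/dt` on power series. -/
def eulerSeries (A : PowerSeries (Matrix n n ℂ)) : PowerSeries (Matrix n n ℂ) :=
  PowerSeries.mk fun m => (m : ℂ) • PowerSeries.coeff m A

lemma eulerSeries_mul (A B : PowerSeries (Matrix n n ℂ)) :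
    eulerSeries (A * B) = eulerSeries A * B + A * eulerSeries B := by
  ext1 m
  simp only [eulerSeries, map_add, PowerSeries.coeff_mul, PowerSeries.coeff_mk]
  rw [← Finset.sum_add_distrib, Finset.smul_sum]
  refine Finset.sum_congr rfl fun p hp => ?_
  rw [← Finset.HasAntidiagonal.mem_antidiagonal.1 hp, smul_mul_assoc, mul_smul_comm, ← add_smul]
  push_cast
  rfl

/-- Let `M` be a one-parameter group of matrix power series whose coefficients of positive order
are `i ξ G(ξ)`. The logarithmic derivative in `t` of `M` has a trace that is additive in `ξ`, and
therefore it is determined by `G(0)`. -/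
lemma trace_coeff_group {M : ℝ → PowerSeries (Matrix n n ℂ)} (hadd : ∀ ξ η, M (ξ + η) = M ξ * M η)
    (h0 : M 0 = 1) {G : ℕ → ℝ → Matrix n n ℂ}
    (hG : ∀ m ξ, PowerSeries.coeff (m + 1) (M ξ) = (Complex.I * ξ) • G m ξ)
    (hM : ∀ m, Continuous fun ξ => PowerSeries.coeff m (M ξ)) (hGc : ∀ m, Continuous (G m))
    (hG0 : ∀ m, G (m + 1) 0 = 0) (m : ℕ) (c : ℝ) :
    ((m + 1 : ℕ) : ℂ) * (PowerSeries.coeff (m + 1) (M c)).trace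
      = Complex.I * c * (PowerSeries.coeff m (M c) * G 0 0).trace := by
  -- the trace of `M(c)` times the logarithmic derivative `M(ξ)⁻¹ eulerSeries (M ξ)`: it is additive
  -- in `ξ` by the product rule and cyclicity, and at `ξ = c` it is the wanted coefficient
  set y : ℝ → ℂ := fun ξ =>
    (PowerSeries.coeff (m + 1) (M (c - ξ) * eulerSeries (M ξ))).trace with hy
  have hyadd : ∀ ξ η, y (ξ + η) = y ξ + y η := by
    intro ξ η
    have h1 : M (c - (ξ + η)) * eulerSeries (M (ξ + η))
        = M (c - (ξ + η)) * eulerSeries (M ξ) * M η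
          + M (c - (ξ + η)) * M ξ * eulerSeries (M η) := by
      rw [hadd, eulerSeries_mul, mul_add, mul_assoc, mul_assoc]
    have h2 : M (c - (ξ + η)) * M ξ = M (c - η) := by
      rw [← hadd]; congr 1; ring
    have h3 : M η * M (c - (ξ + η)) = M (c - ξ) := by
      rw [← hadd]; congr 1; ring
    simp only [hy]
    rw [h1, map_add, Matrix.trace_add, h2, trace_coeff_mul_comm, ← mul_assoc, h3]
  set w : ℝ → ℂ := fun ξ => Complex.I * ∑ p ∈ Finset.HasAntidiagonal.antidiagonal m,
    (PowerSeries.coeff p.1 (M (c - ξ)) * (((p.2 + 1 : ℕ) : ℂ) • G p.2 ξ)).trace with hw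
  have hyw : ∀ ξ : ℝ, y ξ = ξ * w ξ := by
    intro ξ
    simp only [hy, hw]
    rw [PowerSeries.coeff_mul, Finset.Nat.sum_antidiagonal_succ', Matrix.trace_add,
      Matrix.trace_sum, Finset.mul_sum, Finset.mul_sum]
    simp only [eulerSeries, PowerSeries.coeff_mk, hG]
    simp only [Nat.cast_zero, zero_smul, mul_zero, Matrix.trace_zero]
    rw [zero_add]
    refine Finset.sum_congr rfl fun p _ => ?_
    simp only [mul_smul_comm, Matrix.trace_smul, smul_eq_mul]
    ring
  have hwc : Continuous w := by
    refine continuous_const.mul (continuous_finsetSum _ fun p _ => Continuous.matrix_trace ?_)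
    have h : Continuous fun ξ => ((p.2 + 1 : ℕ) : ℂ) • G p.2 ξ :=
      (hGc p.2).const_smul (((p.2 + 1 : ℕ) : ℂ))
    exact ((hM p.1).comp (by fun_prop)).matrix_mul h
  have hyc : Continuous y := by
    have : y = fun ξ : ℝ => (ξ : ℂ) * w ξ := funext hyw
    rw [this]
    fun_prop
  -- a continuous additive function is linear; its slope is read off at the origin
  have hlin : ∀ ξ : ℝ, y ξ = ξ * y 1 := by
    intro ξ
    have := map_real_smul (AddMonoidHom.mk' y hyadd) hyc ξ 1
    simpa using this
  have hw0 : w 0 = y 1 := by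
    have h1 : Tendsto w (𝓝[≠] 0) (𝓝 (w 0)) := hwc.continuousAt.tendsto.mono_left nhdsWithin_le_nhds
    refine tendsto_nhds_unique h1 (tendsto_const_nhds.congr' ?_)
    filter_upwards [self_mem_nhdsWithin] with ξ hξ
    have hξ0 : (ξ : ℂ) ≠ 0 := Complex.ofReal_ne_zero.2 hξ
    exact mul_left_cancel₀ hξ0 ((hlin ξ).symm.trans (hyw ξ))
  have hyc' : y c = ((m + 1 : ℕ) : ℂ) * (PowerSeries.coeff (m + 1) (M c)).trace := by
    simp only [hy, sub_self, h0, one_mul, eulerSeries, PowerSeries.coeff_mk, Matrix.trace_smul,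
      smul_eq_mul]
  rw [← hyc', hlin, ← hw0]
  simp only [hw, sub_zero]
  rw [Finset.sum_eq_single (m, 0)]
  · simp
    ring
  · intro p hp hne
    obtain ⟨a, b⟩ := p
    have hab : a + b = m := Finset.HasAntidiagonal.mem_antidiagonal.1 hp
    cases b with
    | zero => exact absurd (by rw [← hab, add_zero]) hne
    | succ b => simp [hG0]
  · intro h
    exact absurd (Finset.HasAntidiagonal.mem_antidiagonal.2 (add_zero m)) h

end MatrixTrace

/-! ### Compressed perturbations -/

section Compression

variable {ι : Type*} {e : HilbertBasis ι ℂ H} {l : ι → ℝ} {J : Finset ι}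

lemma inner_finProj_of_mem (e : HilbertBasis ι ℂ H) {i : ι} (hi : i ∈ J) (v : H) :
    inner ℂ (e i) (finProj e J v) = inner ℂ (e i) v := by
  rw [finProj_apply]
  exact e.orthonormal.inner_right_sum _ hi

lemma inner_finProj_of_notMem (e : HilbertBasis ι ℂ H) {i : ι} (hi : i ∉ J) (v : H) :
    inner ℂ (e i) (finProj e J v) = 0 := by
  rw [finProj_apply, inner_sum]
  refine Finset.sum_eq_zero fun j hj => ?_
  have hij : i ≠ j := fun h => hi (h ▸ hj)
  rw [inner_smul_right, e.orthonormal.inner_eq_zero hij, mul_zero]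

lemma inner_compression_of_mem {i : ι} (hi : i ∈ J) (v : H) :
    inner ℂ (e i) (compression e R J v)
      = ∑ m : J, inner ℂ (e i) (R (e m)) * inner ℂ (e m) v := by
  rw [compression, mul_apply_eq_comp, mul_apply_eq_comp, inner_finProj_of_mem e hi, finProj_apply,
    map_sum, inner_sum, ← Finset.sum_coe_sort]
  refine Finset.sum_congr rfl fun m _ => ?_
  rw [map_smul, inner_smul_right, mul_comm]

lemma inner_compression_of_notMem {i : ι} (hi : i ∉ J) (v : H) :
    inner ℂ (e i) (compression e R J v) = 0 := by
  rw [compression, mul_apply_eq_comp, mul_apply_eq_comp, inner_finProj_of_notMem e hi]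

lemma inner_duhamel_compression_of_notMem (hU : IsUnitaryGroup D U) (he : IsEigenbasis D e l)
    {i : ι} (hi : i ∉ J) (n : ℕ) {v : H} (hv : n = 0 → inner ℂ (e i) v = 0) (ξ : ℝ) :
    inner ℂ (e i) (duhamel U (compression e R J) n v ξ) = 0 := by
  cases n with
  | zero => rw [inner_duhamel_zero hU he, hv rfl, mul_zero]
  | succ n =>
    rw [inner_duhamel_succ hU he]
    simp [inner_compression_of_notMem hi]

lemma eq_sum_of_inner_eq_zero {v : H} (hv : ∀ i ∉ J, inner ℂ (e i) v = 0) :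
    v = ∑ m : J, inner ℂ (e m) v • e m := by
  rw [Finset.sum_coe_sort J fun m => inner ℂ (e m) v • e m]
  exact (hasSum_inner_smul e v).unique (hasSum_sum_of_ne_finset_zero fun i hi => by
    rw [hv i hi, zero_smul])

/-- The matrix of the coefficient of `tⁿ` in the group generated by `i (D + t P R P)`, where `P`
is the projection onto the span of the basis vectors in `J`. -/
def duhamelMatrix (U : ℝ → H →L[ℂ] H) (R : H →L[ℂ] H) (e : HilbertBasis ι ℂ H) (J : Finset ι)
    (n : ℕ) (ξ : ℝ) : Matrix J J ℂ :=
  Matrix.of fun j k => inner ℂ (e j) (duhamel U (compression e R J) n (e k) ξ)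

lemma basis_inner_eq_zero (e : HilbertBasis ι ℂ H) {i : ι} (hi : i ∉ J) (k : J) :
    inner ℂ (e i) (e k) = 0 :=
  e.orthonormal.inner_eq_zero fun h => hi (h ▸ k.2)

lemma duhamelMatrix_add (hU : IsUnitaryGroup D U) (he : IsEigenbasis D e l) (n : ℕ) (ξ η : ℝ) :
    duhamelMatrix U R e J n (ξ + η) = ∑ p ∈ Finset.HasAntidiagonal.antidiagonal n,
      duhamelMatrix U R e J p.1 ξ * duhamelMatrix U R e J p.2 η := by
  ext j k
  rw [Matrix.sum_apply, duhamelMatrix, Matrix.of_apply, duhamel_add hU, inner_sum]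
  refine Finset.sum_congr rfl fun p _ => ?_
  set v := duhamel U (compression e R J) p.2 (e k) η with hv
  have h : v = ∑ m : J, inner ℂ (e m) v • e m := eq_sum_of_inner_eq_zero fun i hi =>
    inner_duhamel_compression_of_notMem hU he hi _ (fun _ => basis_inner_eq_zero e hi k) η
  have h2 : duhamel U (compression e R J) p.1 v ξ
      = ∑ m : J, inner ℂ (e m) v • duhamel U (compression e R J) p.1 (e m) ξ := by
    conv_lhs => rw [h]
    rw [← duhamelCLM_apply hU, map_sum]
    exact Finset.sum_congr rfl fun m _ => map_smul (duhamelCLM hU _ _ _) _ _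
  rw [h2, inner_sum, Matrix.mul_apply]
  refine Finset.sum_congr rfl fun m _ => ?_
  rw [inner_smul_right, mul_comm]
  rfl

/-- The trace of a coefficient of the compressed group, through the coefficient before it: the
derivative of `tr exp (i ξ (D + t Q))` is `i ξ tr (Q exp (i ξ (D + t Q)))`. -/
lemma trace_duhamelMatrix_succ (hU : IsUnitaryGroup D U) (he : IsEigenbasis D e l) (n : ℕ) (ξ : ℝ) :
    ((n + 1 : ℕ) : ℂ) * (duhamelMatrix U R e J (n + 1) ξ).trace
      = Complex.I * ξ * ∑ j : J, ∑ k : J,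
        duhamelMatrix U R e J n ξ j k * inner ℂ (e k) (R (e j)) := by
  classical
  set Q := compression e R J with hQ
  set g : ℕ → J → ℝ → H := fun m k ξ =>
    ∫ r in (0 : ℝ)..1, U ((1 - r) * ξ) (Q (duhamel U Q m (e k) (r * ξ))) with hg
  have hgc : ∀ m k, Continuous (g m k) := fun m k =>
    intervalIntegral.continuous_parametric_intervalIntegral_of_continuous'
      (continuous_duhamel_integrand hU Q m (e k) (X := ℝ × ℝ)
        (a := fun q => (1 - q.2) * q.1) (b := fun q => q.2 * q.1) (by fun_prop) (by fun_prop)) 0 1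
  have hg0 : ∀ m k, g m k 0 = Q (duhamel U Q m (e k) 0) := by
    intro m k
    simp [hg, hU.zero_apply]
  have hzero : ∀ m (v : H), duhamel U Q (m + 1) v 0 = 0 := by
    intro m v
    rw [duhamel_succ, intervalIntegral.integral_same, smul_zero]
  have key := trace_coeff_group (n := J)
    (M := fun ξ => PowerSeries.mk fun m => duhamelMatrix U R e J m ξ)
    (G := fun m ξ => Matrix.of fun j k => inner ℂ (e j) (g m k ξ))
    (fun ξ η => ?_) ?_ (fun m ξ => ?_) (fun m => ?_) (fun m => ?_) (fun m => ?_) n ξ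
  · simp only [PowerSeries.coeff_mk] at key
    rw [key, Matrix.trace]
    congr 1
    refine Finset.sum_congr rfl fun j _ => ?_
    rw [Matrix.diag_apply, Matrix.mul_apply]
    refine Finset.sum_congr rfl fun k _ => ?_
    rw [Matrix.of_apply, hg0, duhamel_zero, hU.zero_apply, hQ, inner_compression_of_mem k.2,
      Finset.sum_eq_single j]
    · rw [inner_self_eq_norm_sq_to_K, e.orthonormal.1]
      simp
    · intro m _ hm
      rw [e.orthonormal.inner_eq_zero fun h => hm (Subtype.ext h), mul_zero]
    · simp
  · ext1 m
    rw [PowerSeries.coeff_mul]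
    simp only [PowerSeries.coeff_mk]
    exact duhamelMatrix_add hU he m ξ η
  · ext1 m
    rw [PowerSeries.coeff_mk, PowerSeries.coeff_one]
    ext j k
    rw [duhamelMatrix, Matrix.of_apply]
    cases m with
    | zero =>
      rw [duhamel_zero, hU.zero_apply, orthonormal_iff_ite.1 e.orthonormal, if_pos rfl,
        Matrix.one_apply]
      simp only [Subtype.ext_iff]
    | succ m => simp [← hQ, hzero]
  · ext j k
    simp only [PowerSeries.coeff_mk]
    rw [duhamelMatrix, Matrix.of_apply, duhamel_succ_unit, inner_smul_right]
    rfl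
  · simp only [PowerSeries.coeff_mk]
    exact continuous_matrix fun j k => continuous_const.inner (continuous_duhamel hU _ _ _)
  · exact continuous_matrix fun j k => continuous_const.inner (hgc m k)
  · ext j k
    rw [Matrix.of_apply, hg0, hzero, map_zero, inner_zero_right]
    rfl

/-- Matrix coefficients of the compressed group as sums over paths in `J`. -/
lemma inner_duhamel_compression (hU : IsUnitaryGroup D U) (he : IsEigenbasis D e l) (n : ℕ) (v : H)
    (j : J) (ξ : ℝ) :
    inner ℂ (e j) (duhamel U (compression e R J) n v ξ) = ∑ p : Fin n → J,
      (∏ k : Fin n, inner ℂ (e ((Fin.cons j p : Fin (n + 1) → J) k.castSucc))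
        (R (e ((Fin.cons j p : Fin (n + 1) → J) k.succ)))) *
      expDividedDiff n (fun k => l ((Fin.cons j p : Fin (n + 1) → J) k)) ξ *
      inner ℂ (e ((Fin.cons j p : Fin (n + 1) → J) (Fin.last n))) v := by
  induction n generalizing j ξ with
  | zero => simp [inner_duhamel_zero hU he, expDividedDiff]
  | succ n ih =>
    rw [inner_duhamel_succ hU he, ← (Fin.consEquiv fun _ : Fin (n + 1) => (J : Type _)).sum_comp,
      Fintype.sum_prod_type]
    simp_rw [inner_compression_of_mem j.2, ih, Finset.mul_sum]
    rw [intervalIntegral.integral_finsetSum fun m _ => ?_, Finset.mul_sum]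
    · refine Finset.sum_congr rfl fun m _ => ?_
      rw [intervalIntegral.integral_finsetSum fun p _ => ?_, Finset.mul_sum]
      · refine Finset.sum_congr rfl fun p _ => ?_
        have hc : (Fin.consEquiv fun _ : Fin (n + 1) => (J : Type _)) (m, p)
            = (Fin.cons m p : Fin (n + 1) → J) := rfl
        rw [hc, Fin.prod_univ_succ]
        simp only [Fin.castSucc_zero, Fin.cons_zero, Fin.cons_succ, ← Fin.succ_castSucc,
          ← Fin.succ_last]
        rw [expDividedDiff]
        have ht : Fin.tail (fun k => l ((Fin.cons j (Fin.cons m p : Fin (n + 1) → J) :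
            Fin (n + 2) → J) k)) = fun k => l ((Fin.cons m p : Fin (n + 1) → J) k) := by
          funext k
          simp [Fin.tail]
        rw [ht, Fin.cons_zero]
        rw [show ∀ a b c d : ℂ, a * b * (Complex.I * c) * d = Complex.I * (a * b * d * c) from
          fun a b c d => by ring]
        congr 1
        rw [← intervalIntegral.integral_const_mul]
        refine intervalIntegral.integral_congr fun η _ => ?_
        ring
      · have := continuous_expDividedDiff n fun k => l ((Fin.cons m p : Fin (n + 1) → J) k)
        exact Continuous.intervalIntegrable (by fun_prop) _ _
    · refine Continuous.intervalIntegrable (continuous_finsetSum _ fun p _ => ?_) _ _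
      have := continuous_expDividedDiff n fun k => l ((Fin.cons m p : Fin (n + 1) → J) k)
      fun_prop

end Compression

end

/-! ### Traces of compressed perturbations as cycle sums -/

section

variable {D : H →ₗ.[ℂ] H} {U : ℝ → H →L[ℂ] H} {R : H →L[ℂ] H} {ρ : ℝ} {φ f : ℝ → ℂ}

section CycleSum

variable {ι : Type*} {e : HilbertBasis ι ℂ H} {l : ι → ℝ} {J : Finset ι}

lemma sum_piFinset_eq_sum_coe {n : ℕ} {M : Type*} [AddCommMonoid M] (J : Finset ι)
    (F : (Fin n → ι) → M) :
    ∑ i ∈ Fintype.piFinset fun _ : Fin n => J, F i = ∑ i : Fin n → J, F fun k => i k := by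
  refine Finset.sum_bij' (fun i hi k => (⟨i k, Fintype.mem_piFinset.1 hi k⟩ : J))
    (fun i _ k => (i k : ι)) (fun _ _ => Finset.mem_univ _)
    (fun i _ => Fintype.mem_piFinset.2 fun k => (i k).2) (fun _ _ => rfl) (fun _ _ => rfl)
    (fun _ _ => rfl)

/-- A trace over closed paths in `J`. -/
lemma sum_duhamelMatrix_mul (hU : IsUnitaryGroup D U) (he : IsEigenbasis D e l) (n : ℕ) (ξ : ℝ) :
    ∑ j : J, ∑ k : J, duhamelMatrix U R e J n ξ j k * inner ℂ (e k) (R (e j))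
      = ∑ i : Fin (n + 1) → J, (∏ k : Fin (n + 1), inner ℂ (e (i k)) (R (e (i (k + 1))))) *
        expDividedDiff n (fun k => l (i k)) ξ := by
  rw [← (Fin.consEquiv fun _ : Fin (n + 1) => (J : Type _)).sum_comp, Fintype.sum_prod_type]
  refine Finset.sum_congr rfl fun j _ => ?_
  have hc : ∀ p : Fin n → J, (Fin.consEquiv fun _ : Fin (n + 1) => (J : Type _)) (j, p)
      = (Fin.cons j p : Fin (n + 1) → J) := fun _ => rfl
  simp_rw [duhamelMatrix, Matrix.of_apply, inner_duhamel_compression hU he, Finset.sum_mul, hc]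
  rw [Finset.sum_comm]
  refine Finset.sum_congr rfl fun p _ => ?_
  set q : Fin (n + 1) → J := Fin.cons j p with hq
  have hq0 : q 0 = j := by rw [hq, Fin.cons_zero]
  rw [Fin.prod_univ_castSucc, Finset.sum_eq_single (q (Fin.last n))]
  · simp only [Fin.coeSucc_eq_succ, Fin.last_add_one, hq0]
    rw [inner_self_eq_norm_sq_to_K, e.orthonormal.1]
    simp only [RCLike.ofReal_one, one_pow]
    ring
  · intro k _ hk
    have hne : (q (Fin.last n) : ι) ≠ k := fun h => hk (Subtype.ext h).symm
    rw [e.orthonormal.inner_eq_zero hne, mul_zero, zero_mul]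
  · simp

/-- For a compressed perturbation the trace formula is exact in each order: the cyclic product of
matrix elements comes from the trace over closed paths, and the divided difference of `deriv f`
from integrating the exponential ones against the Fourier transform of `f`, the factor `i ξ` from
`trace_duhamelMatrix_succ` being the derivative. -/
theorem trace_coeff_compression (hU : IsUnitaryGroup D U) (he : IsEigenbasis D e l) (hρ : 0 < ρ)
    (hφe : ExpIntegrable ρ φ) (hf : ContDiff ℝ ∞ f) (hφ : HasIntegrableFourier f φ)
    (hex : ∀ n : ℕ, ∃ ψ, HasIntegrableFourier (iteratedDeriv n f) ψ) (n : ℕ) :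
    ((n + 1 : ℕ) : ℂ) *
        trace (PowerSeries.coeff (n + 1) (fourierSeries hU (compression e R J) hρ hφe))
      = ∑ i ∈ Fintype.piFinset fun _ : Fin (n + 1) => J,
        (∏ k : Fin (n + 1), inner ℂ (e (i k)) (R (e (i (k + 1))))) *
          dividedDiff (deriv f) n (fun k => l (i k)) := by
  set B := PowerSeries.coeff (n + 1) (fourierSeries hU (compression e R J) hρ hφe) with hB
  -- a coefficient of positive order maps into the span of the basis vectors in `J`
  have hPB : 1 * finProj e J * B = B := by
    ext v
    refine ext_inner_hilbertBasis e fun i => ?_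
    rw [one_mul, mul_apply_eq_comp]
    by_cases hi : i ∈ J
    · exact inner_finProj_of_mem e hi _
    · rw [inner_finProj_of_notMem e hi, hB, inner_coeff_fourierSeries]
      simp_rw [inner_duhamel_compression_of_notMem hU he hi (n + 1) (fun h => absurd h (by simp))]
      simp
  have htr : trace B = ∫ ξ, φ ξ * (duhamelMatrix U R e J (n + 1) ξ).trace := by
    rw [← hPB, (nuclearBound_mul_finProj_mul e J 1 B).2, ← Finset.sum_coe_sort]
    simp only [Matrix.trace, Matrix.diag_apply, Finset.mul_sum]
    rw [integral_finsetSum]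
    · refine Finset.sum_congr rfl fun j _ => ?_
      rw [hB, one_apply_eq_self, inner_coeff_fourierSeries]
      rfl
    · intro j _
      have h := (innerSL ℂ (e j)).integrable_comp
        (integrable_smul_duhamel hU (compression e R J) hρ hφe (n + 1) (e j))
      refine h.congr (Eventually.of_forall fun ξ => ?_)
      simp [duhamelMatrix]
  rw [htr, ← integral_const_mul, sum_piFinset_eq_sum_coe]
  have hint : ∀ ξ : ℝ, ((n + 1 : ℕ) : ℂ) * (φ ξ * (duhamelMatrix U R e J (n + 1) ξ).trace)
      = ∑ i : Fin (n + 1) → J, (∏ k : Fin (n + 1), inner ℂ (e (i k)) (R (e (i (k + 1))))) *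
        (φ ξ * (Complex.I * ξ * expDividedDiff n (fun k => l (i k)) ξ)) := by
    intro ξ
    rw [mul_left_comm, trace_duhamelMatrix_succ hU he, sum_duhamelMatrix_mul hU he,
      Finset.mul_sum, Finset.mul_sum]
    exact Finset.sum_congr rfl fun i _ => by ring
  simp_rw [hint]
  rw [integral_finsetSum _ fun i _ => (integrable_mul_expDividedDiff hρ hφe n _).const_mul _]
  refine Finset.sum_congr rfl fun i _ => ?_
  rw [integral_const_mul, dividedDiff_deriv_eq_integral hρ hφe hf hφ hex]

end CycleSum

end

/-! ### Power series in the coupling constant -/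

section

section PowerSeriesInT

/-- Geometrically bounded coefficients give a smooth function near the origin whose derivatives at
the origin are read off from the coefficients. -/
lemma contDiffOn_of_hasSum {c : ℕ → ℂ} {z K δ : ℝ} (hK : 0 ≤ K) (hδ : 0 < δ) (hδK : δ * K < 1)
    (hc : ∀ n, ‖c n‖ ≤ z * K ^ n) {g : ℝ → ℂ}
    (hg : ∀ t ∈ Set.Ioo (-δ) δ, HasSum (fun n => (t : ℂ) ^ n * c n) (g t)) :
    ContDiffOn ℝ ∞ g (Set.Ioo (-δ) δ) ∧
      ∀ n, iteratedDeriv n g 0 = (n.factorial : ℂ) * c n := by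
  set p : FormalMultilinearSeries ℝ ℝ ℂ := fun n =>
    ContinuousMultilinearMap.mkPiRing ℝ (Fin n) (c n) with hp
  have hfps : HasFPowerSeriesOnBall g p 0 (ENNReal.ofReal δ) := by
    refine ⟨?_, by simpa using hδ, fun {y} hy => ?_⟩
    · refine p.le_radius_of_bound (r := δ.toNNReal) z fun n => ?_
      have hz : 0 ≤ z := by simpa using (norm_nonneg _).trans (hc 0)
      rw [hp, ContinuousMultilinearMap.norm_mkPiRing, Real.coe_toNNReal δ hδ.le]
      calc ‖c n‖ * δ ^ n ≤ z * K ^ n * δ ^ n := by gcongr; exact hc n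
        _ = z * (δ * K) ^ n := by rw [mul_pow]; ring
        _ ≤ z * 1 := by gcongr; exact pow_le_one₀ (by positivity) hδK.le
        _ = z := mul_one z
    · have hy' : y ∈ Set.Ioo (-δ) δ := by
        rw [Metric.mem_eball, edist_dist, ENNReal.ofReal_lt_ofReal_iff hδ, dist_zero_right,
          Real.norm_eq_abs] at hy
        exact abs_lt.1 hy
      rw [zero_add]
      refine (hg y hy').congr_fun fun n => ?_
      simp [hp, ContinuousMultilinearMap.mkPiRing_apply]
  constructor
  · intro t ht
    refine (hfps.analyticOnNhd t ?_).contDiffAt.contDiffWithinAt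
    rw [Metric.mem_eball, edist_dist, ENNReal.ofReal_lt_ofReal_iff hδ, dist_zero_right,
      Real.norm_eq_abs]
    exact abs_lt.2 ht
  · intro n
    rw [iteratedDeriv_eq_iteratedFDeriv, ← hfps.factorial_smul 1 n]
    simp [hp, ContinuousMultilinearMap.mkPiRing_apply]

end PowerSeriesInT

end

/-! ### The perturbed function as a power series -/

section

variable {D : H →ₗ.[ℂ] H} {R : H →L[ℂ] H} {ρ : ℝ}

section PerturbedFunction

variable {φ f : ℝ → ℂ} {t : ℝ}

lemma norm_expansionalTerm_le (hU : IsUnitaryGroup D (unitaryGroup D)) (R : H →L[ℂ] H)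
    (hρ : 0 < ρ) (t ξ : ℝ) (v : H) (n : ℕ) :
    ‖expansionalTerm D R t ξ v n‖ ≤ (|t| * (‖R‖ / ρ)) ^ n * (‖v‖ * Real.exp (ρ * |ξ|)) := by
  rw [expansionalTerm_eq hU, norm_smul, norm_pow, Complex.norm_real, Real.norm_eq_abs]
  calc |t| ^ n * ‖duhamel (unitaryGroup D) R n v ξ‖
      ≤ |t| ^ n * (((‖R‖ / ρ) ^ n * ‖v‖) * Real.exp (ρ * |ξ|)) := by
        gcongr
        exact norm_duhamel_le_exp hU R hρ n v ξ
    _ = _ := by rw [mul_pow]; ring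

lemma summable_expansionalTerm (hU : IsUnitaryGroup D (unitaryGroup D)) (hρ : 0 < ρ)
    (ht : |t| * (‖R‖ / ρ) < 1) (ξ : ℝ) (v : H) : Summable (expansionalTerm D R t ξ v) :=
  Summable.of_norm_bounded ((summable_geometric_of_lt_one (by positivity) ht).mul_right _)
    (norm_expansionalTerm_le hU R hρ t ξ v)

lemma continuous_expansionalTerm (hU : IsUnitaryGroup D (unitaryGroup D)) (R : H →L[ℂ] H)
    (t : ℝ) (v : H) (n : ℕ) : Continuous fun ξ => expansionalTerm D R t ξ v n := by
  simp_rw [expansionalTerm_eq hU]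
  exact (continuous_duhamel hU R n v).const_smul ((t : ℂ) ^ n)

lemma integrable_smul_expansional (hU : IsUnitaryGroup D (unitaryGroup D)) (hρ : 0 < ρ)
    (hφ : ExpIntegrable ρ φ) (ht : |t| * (‖R‖ / ρ) < 1) (v : H) :
    Integrable fun ξ => φ ξ • expansional D R t ξ v := by
  have hgeo := summable_geometric_of_lt_one (by positivity) ht
  refine hφ.integrable_smul (C := (∑' n, (|t| * (‖R‖ / ρ)) ^ n) * ‖v‖) ?_ fun ξ => ?_
  · exact aestronglyMeasurable_of_tendsto_ae (u := atTop)
      (f := fun N ξ => ∑ n ∈ Finset.range N, expansionalTerm D R t ξ v n)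
      (fun N => (continuous_finsetSum _ fun n _ =>
        continuous_expansionalTerm hU R t v n).aestronglyMeasurable)
      (Eventually.of_forall fun ξ =>
        (summable_expansionalTerm hU hρ ht ξ v).hasSum.tendsto_sum_nat)
  · refine (tsum_of_norm_bounded (hgeo.mul_right _).hasSum
      (norm_expansionalTerm_le hU R hρ t ξ v)).trans (le_of_eq ?_)
    rw [tsum_mul_right, mul_assoc]

/-- The expansional may be integrated against the Fourier transform term by term. -/
lemma hasSum_coeff_fourierSeries (hU : IsUnitaryGroup D (unitaryGroup D)) (hρ : 0 < ρ)
    (hφ : ExpIntegrable ρ φ) (ht : |t| * (‖R‖ / ρ) < 1) (v : H) :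
    HasSum (fun n => ((t : ℂ) ^ n • PowerSeries.coeff n (fourierSeries hU R hρ hφ)) v)
      (∫ ξ, φ ξ • expansional D R t ξ v) := by
  have hb := norm_expansionalTerm_le hU R hρ t (v := v)
  have hint : ∀ n, Integrable fun ξ => φ ξ • expansionalTerm D R t ξ v n := fun n =>
    hφ.integrable_smul (C := (|t| * (‖R‖ / ρ)) ^ n * ‖v‖)
      (continuous_expansionalTerm hU R t v n).aestronglyMeasurable
      fun ξ => (hb ξ n).trans (le_of_eq (mul_assoc _ _ _).symm)
  have hsum : Summable fun n => ∫ ξ, ‖φ ξ • expansionalTerm D R t ξ v n‖ := by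
    refine Summable.of_nonneg_of_le (fun n => integral_nonneg fun ξ => norm_nonneg _)
      (fun n => ?_) ((summable_geometric_of_lt_one (by positivity) ht).mul_right
        (‖v‖ * expNorm ρ φ))
    rw [expNorm, ← integral_const_mul, ← integral_const_mul]
    refine integral_mono (hint n).norm ((hφ.integrable_exp_mul_norm.const_mul _).const_mul _)
      fun ξ => ?_
    simp only [norm_smul]
    calc ‖φ ξ‖ * ‖expansionalTerm D R t ξ v n‖
        ≤ ‖φ ξ‖ * ((|t| * (‖R‖ / ρ)) ^ n * (‖v‖ * Real.exp (ρ * |ξ|))) :=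
          mul_le_mul_of_nonneg_left (hb ξ n) (norm_nonneg _)
      _ = _ := by ring
  have h := hasSum_integral_of_summable_integral_norm hint hsum
  have e1 : ∀ ξ, ∑' n, φ ξ • expansionalTerm D R t ξ v n = φ ξ • expansional D R t ξ v :=
    fun ξ => (summable_expansionalTerm hU hρ ht ξ v).tsum_const_smul (φ ξ)
  simp_rw [e1] at h
  refine h.congr_fun fun n => ?_
  rw [_root_.smul_apply, coeff_fourierSeries_apply, ← integral_smul]
  refine integral_congr_ae (Eventually.of_forall fun ξ => ?_)
  simp only [expansionalTerm_eq hU]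
  rw [smul_comm]

lemma NuclearBound.const_smul {T : H →L[ℂ] H} {b : ℝ} (h : NuclearBound T b) (c : ℂ) :
    NuclearBound (c • T) (‖c‖ * b) ∧ trace (c • T) = c * trace T := by
  obtain ⟨x, y, h1, h2, h3⟩ := h
  have e1 : (fun k => ‖x k‖ * ‖c • y k‖) = fun k => ‖c‖ * (‖x k‖ * ‖y k‖) := by
    funext k
    rw [norm_smul]
    ring
  have s1 : Summable fun k => ‖x k‖ * ‖c • y k‖ := e1 ▸ h1.mul_left ‖c‖
  have s3 : ∀ v, HasSum (fun k => inner ℂ (x k) v • c • y k) ((c • T) v) := fun v =>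
    ((h3 v).const_smul c).congr_fun fun k => smul_comm _ _ _
  refine ⟨⟨x, fun k => c • y k, s1, ?_, s3⟩, ?_⟩
  · rw [e1, tsum_mul_left]
    gcongr
  · rw [trace_eq_tsum s1 s3, trace_eq_tsum h1 h3, ← tsum_mul_left]
    simp_rw [inner_smul_right]

/-- For small `t` the perturbed function is a convergent power series of trace class operators. -/
theorem exists_perturbedFunction (hU : IsUnitaryGroup D (unitaryGroup D)) (hρ : 0 < ρ)
    (hfe : ExpIntegrable ρ (fourierHat f)) {z K : ℝ} (hK : 0 ≤ K)
    (hT : ∀ n, NuclearBound (PowerSeries.coeff n (fourierSeries hU R hρ hfe)) (z * K ^ n))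
    (ht : |t| * (‖R‖ / ρ) < 1) (htK : |t| * K < 1) :
    ∃ T : H →L[ℂ] H, IsPerturbedFunction D R f t T ∧ IsTraceClass T ∧
      HasSum (fun n => (t : ℂ) ^ n * trace (PowerSeries.coeff n (fourierSeries hU R hρ hfe)))
        (trace T) := by
  set c := fun n => PowerSeries.coeff n (fourierSeries hU R hρ hfe) with hc
  have hb : ∀ n, NuclearBound ((t : ℂ) ^ n • c n) (‖(t : ℂ) ^ n‖ * (z * K ^ n)) := fun n =>
    ((hT n).const_smul _).1
  have hsb : Summable fun n => ‖(t : ℂ) ^ n‖ * (z * K ^ n) := by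
    refine ((summable_geometric_of_lt_one (by positivity) htK).mul_left z).congr fun n => ?_
    rw [norm_pow, Complex.norm_real, Real.norm_eq_abs, mul_pow]
    ring
  have hs : Summable fun n => (t : ℂ) ^ n • c n :=
    Summable.of_norm_bounded hsb fun n => (hb n).norm_le
  have hv : ∀ v, HasSum (fun n => ((t : ℂ) ^ n • c n) v) ((∑' n, (t : ℂ) ^ n • c n) v) := fun v =>
    hs.hasSum.mapL (ContinuousLinearMap.apply ℂ H v)
  refine ⟨∑' n, (t : ℂ) ^ n • c n, fun v => ⟨fun ξ => summable_expansionalTerm hU hρ ht ξ v,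
    integrable_smul_expansional hU hρ hfe ht v,
    (hv v).unique (hasSum_coeff_fourierSeries hU hρ hfe ht v)⟩, ?_⟩
  obtain ⟨hn, htr⟩ := nuclearBound_of_hasSum hb hsb hv
  refine ⟨hn.isTraceClass, htr.congr_fun fun n => ?_⟩
  exact (((hT n).const_smul _).2).symm

end PerturbedFunction

end

end SpectralAction

end

open SpectralAction in
theorem lemma8p3 {H : Type*} [NormedAddCommGroup H] [InnerProductSpace ℂ H] [CompleteSpace H]
    (D : H →ₗ.[ℂ] H) (hD : IsSelfAdjoint D) (s : ℝ) (hs : 0 ≤ s) (hDs : IsSummable D s)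
    (R : H →L[ℂ] H) (f : ℝ → ℂ) (hf : ClassE s f) :
    (∃ (w : Set H) (e : HilbertBasis w ℂ H) (l : w → ℝ), IsEigenbasis D e l) ∧
    ∃ δ : ℝ, 0 < δ ∧ ∃ F : ℝ → H →L[ℂ] H,
      (∀ t ∈ Set.Ioo (-δ) δ, IsPerturbedFunction D R f t (F t) ∧ IsTraceClass (F t)) ∧
      ContDiffOn ℝ ∞ (fun t => trace (F t)) (Set.Ioo (-δ) δ) ∧
      ∀ (ι : Type*) (e : HilbertBasis ι ℂ H) (l : ι → ℝ), IsEigenbasis D e l →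
        ∀ n : ℕ, Tendsto
          (fun J : Finset ι => ((n.factorial : ℕ) : ℂ) *
            ∑ i ∈ Fintype.piFinset fun _ : Fin (n + 1) => J,
              (∏ k : Fin (n + 1), inner ℂ (e (i k)) (R (e (i (k + 1))))) *
                dividedDiff (deriv f) n (fun k => l (i k)))
          atTop (𝓝 (iteratedDeriv (n + 1) (fun t => trace (F t)) 0)) := by
  obtain ⟨S, hS, hT⟩ := hDs
  have hbasis := hS.exists_eigenbasis hD hs hT
  refine ⟨hbasis, ?_⟩
  obtain ⟨w, e₀, l₀, he₀⟩ := hbasis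
  have hU := isUnitaryGroup_unitaryGroup hD he₀
  obtain ⟨ρ, hρ, hfe, z, K, -, hK, hN, -⟩ :=
    exists_nuclearBound_fourierSeries hU he₀ hs (hS.summable_norm_rpow hD hs hT he₀) hf R
  obtain ⟨-, -, -, -, hff, hex, -⟩ := hf.exists_expIntegrable hs
  -- within `1 / B` both the trace norm series and the expansional converge geometrically
  set B := K + ‖R‖ / ρ + 1 with hB
  have hR : 0 ≤ ‖R‖ / ρ := by positivity
  have hB0 : 0 < B := by positivity
  have hδ : 0 < B⁻¹ := inv_pos.2 hB0
  have hsmall : ∀ a, a < B → B⁻¹ * a < 1 := fun a ha =>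
    (inv_mul_lt_iff₀ hB0).2 (by rwa [mul_one])
  have hδK : B⁻¹ * K < 1 := hsmall K (by linarith)
  have hδR : B⁻¹ * (‖R‖ / ρ) < 1 := hsmall _ (by linarith)
  have hF : ∀ t : ℝ, ∃ T : H →L[ℂ] H, t ∈ Set.Ioo (-B⁻¹) B⁻¹ →
      IsPerturbedFunction D R f t T ∧ IsTraceClass T ∧
      HasSum (fun n => (t : ℂ) ^ n * trace (PowerSeries.coeff n (fourierSeries hU R hρ hfe)))
        (trace T) := by
    intro t
    by_cases ht : t ∈ Set.Ioo (-B⁻¹) B⁻¹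
    · have habs : |t| ≤ B⁻¹ := (abs_lt.2 ht).le
      obtain ⟨T, h⟩ := exists_perturbedFunction hU hρ hfe hK hN
        ((mul_le_mul_of_nonneg_right habs hR).trans_lt hδR)
        ((mul_le_mul_of_nonneg_right habs hK).trans_lt hδK)
      exact ⟨T, fun _ => h⟩
    · exact ⟨0, fun h => absurd h ht⟩
  choose F hF using hF
  obtain ⟨hsmooth, hder⟩ := contDiffOn_of_hasSum hK hδ hδK (fun n => (hN n).norm_trace_le)
    (g := fun t => trace (F t)) fun t ht => (hF t ht).2.2
  refine ⟨B⁻¹, hδ, F, fun t ht => ⟨(hF t ht).1, (hF t ht).2.1⟩, hsmooth, ?_⟩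
  intro ι e l he n
  obtain ⟨ρ', hρ', hfe', -, -, -, -, -, hlim⟩ :=
    exists_nuclearBound_fourierSeries hU he hs (hS.summable_norm_rpow hD hs hT he) hf R
  -- the coefficients do not depend on the eigenbasis, nor on the exponential weight
  rw [hder, fourierSeries_congr hU R hρ hρ' hfe hfe' (ae_eq_refl _), Nat.factorial_succ]
  refine ((hlim (n + 1)).const_mul (((n + 1) * n.factorial : ℕ) : ℂ)).congr fun J => ?_
  rw [← trace_coeff_compression hU he hρ' hfe' hf.1 hff hex n]
  push_cast
  ring
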